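/- Let $m,k$ be integers with $m>k>0$ and let $T\in(0,\infty)$. Let $M=M^m_k$ be the compact complex manifold which is the total space of the holomorphic $\mathbb{CP}^1$-bundle over $\mathbb{CP}^{m-1}$ arising as the projective compactification of the $k$-th tensor power of the tautological line bundle. Let $x,y,\varphi:[0,T]\to\mathbb{R}$ be $C^\infty$ functions of the variable $t$ which, with $\dot{(\ )}=d/dt$, satisfy on $[0,T]$ the equations $$2\ddot x=\dot y^2-\dot x^2+1,\qquad \varphi\ddot y=(m-1)\varphi\dot x\dot y-\dot\varphi\dot y-y\,e^{y-x},\qquad \ddot\varphi=(m-1)\dot x\dot\varphi+m\varphi-m,$$ $$2\dot x\dot\varphi-(2m-1)\varphi\dot x^2+\varphi\dot y^2+2(y-1)e^{y-x}-\varphi+2m=0,$$ and the boundary conditions $\varphi(0)=\varphi(T)=0$, $\varphi>0$ on $(0,T)$, $\dot\varphi(0)=k=-\dot\varphi(T)$. For a Riemannian metric $g$ on $M$ write $\nabla$ for its Levi-Civita connection and its gradient, $\mathrm{Ric}$ and $\mathrm{s}$ for its Ricci tensor and scalar curvature, $\Delta=\mathrm{tr}_g\nabla d$ for its Laplacian,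 and $\{b\}_0=b-(\mathrm{tr}_g b)g/n$, where $n=2m=\dim_{\mathbb R}M$, for the traceless part of a symmetric 2-tensor $b$. Call $(g,t)$ an *associated pair* if $g$ is a Kähler metric on $M$ and $t:M\to[0,T]$ is a smooth surjective function such that, with $\kappa=e^{t}$ and with functions on $[0,T]$ evaluated at $t$, (i) $\{\alpha\nabla d\kappa+\mathrm{Ric}\}_0=0$, where $\alpha=(m-1)(\dot x+1)e^{-t}$; (ii) $\Delta\kappa=2(\dot\varphi+m\varphi)$ and $g(\nabla\kappa,\nabla\kappa)=2e^{t}\varphi$; (iii) $e^{t}\,\mathrm{s}/2=m(m-1)-m(m-1)\varphi-(2m-1)\dot\varphi-\ddot\varphi$. Then $M$ is compact, Hausdorff and connected, and associated pairs $(g,t)$ exist. For every associated pair $(g,t)$, let $\sigma=e^{(x-y+t)/2}:M\to(0,\infty)$ and $f=(m-1)y:M\to\mathbb{R}$ (with $x,y$ evaluated at $t$). Then $\bar g=g/\sigma^2$ is a smooth Riemannian metric on $M$ and a Ricci soliton with soliton constant $1$, that is, $\mathcal{L}_w\bar g+\overline{\mathrm{Ric}}=\bar g$ for some smooth vector field $w$.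 Moreover, $f$ is smooth, and $\bar g$ and $f$ satisfy the normalized gradient soliton equation $$\bar\nabla df+\overline{\mathrm{Ric}}=\bar g,\qquad \bar\Delta f-\bar g(\bar\nabla f,\bar\nabla f)+2f=0,$$ as well as the three-equation system (a) $\{\bar\nabla df+\overline{\mathrm{Ric}}\}_0=0$ (traceless part with respect to $\bar g$); (b) $\bar\Delta f-\bar g(\bar\nabla f,\bar\nabla f)+2f=0$; (c) $(n-2)(\bar\Delta f+\bar{\mathrm{s}}-n)+n[\bar\Delta f-\bar g(\bar\nabla f,\bar\nabla f)+2f]=0$. -/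

import Mathlib

open Set Function
open scoped Manifold ContDiff Topology TensorProduct LinearAlgebra.Projectivization

set_option maxSynthPendingDepth 3

noncomputable section

/-! ## The complex manifold `M^m_k`

The projective compactification `ℙ(L^{⊗k} ⊕ 1)` of the `k`-th tensor power of the tautological line
bundle `L` over `ℂP^{m-1}`. -/

/-- The point set of `M^m_k`: pairs consisting of a point `p` of `ℂP^{m-1}`, that is, of a line
`p.submodule` in `ℂ^m`, and a point of the projective line `ℙ((p.submodule)^{⊗k} ⊕ ℂ)`. -/
def TautCompact (m k : ℕ) : Type :=
  Σ p : ℙ ℂ (Fin m → ℂ), ℙ ℂ ((⨂[ℂ]^k p.submodule) × ℂ)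

namespace TautCompact

variable {m k : ℕ}

/-- The linear function on the line `p.submodule^{⊗k}` which is the `k`-th tensor power of the
`i`-th coordinate function on `p.submodule ⊆ ℂ^m`. -/
def powCoord (k : ℕ) (p : ℙ ℂ (Fin m → ℂ)) (i : Fin m) : (⨂[ℂ]^k p.submodule) →ₗ[ℂ] ℂ :=
  PiTensorProduct.lift ((MultilinearMap.mkPiAlgebra ℂ (Fin k) ℂ).compLinearMap
    fun _ => (LinearMap.proj i : (Fin m → ℂ) →ₗ[ℂ] ℂ).domRestrict p.submodule)

lemma powCoord_tprod (p : ℙ ℂ (Fin m → ℂ)) (i : Fin m) (z : p.submodule) :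
    powCoord k p i (PiTensorProduct.tprod ℂ fun _ => z) = (z : Fin m → ℂ) i ^ k := by
  simp [powCoord]

lemma mem_mk_submodule (z : Fin m → ℂ) (hz : z ≠ 0) :
    z ∈ (Projectivization.mk ℂ z hz).submodule := by
  rw [Projectivization.submodule_mk]; exact Submodule.mem_span_singleton_self z

lemma subtype_mk_ne_zero {p : ℙ ℂ (Fin m → ℂ)} {z : Fin m → ℂ} (hz : z ≠ 0)
    (h : z ∈ p.submodule) : (⟨z, h⟩ : p.submodule) ≠ 0 :=
  fun h' => hz (congrArg Subtype.val h')

lemma fibre_ne_zero (p : ℙ ℂ (Fin m → ℂ)) (z : p.submodule) (hz : z ≠ 0) (a : ℂ × ℂ)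
    (ha : a ≠ 0) :
    ((a.1 • PiTensorProduct.tprod ℂ fun _ => z, a.2) : (⨂[ℂ]^k p.submodule) × ℂ) ≠ 0 := by
  intro h
  rw [Prod.mk_eq_zero] at h
  have hz' : (z : Fin m → ℂ) ≠ 0 := by simpa using hz
  obtain ⟨i, hi⟩ := Function.ne_iff.1 hz'
  have h1 := congrArg (powCoord k p i) h.1
  rw [map_smul, powCoord_tprod, map_zero, smul_eq_mul] at h1
  have : a.1 = 0 := (mul_eq_zero.1 h1).resolve_right (pow_ne_zero _ hi)
  exact ha (Prod.ext this h.2)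

/-- The point `[u z^{⊗k} : v]` of the fibre over `p`, for a nonzero vector `z` of the line `p` and
`(u, v) = a ≠ 0`. -/
def ptOver (k : ℕ) (p : ℙ ℂ (Fin m → ℂ)) (z : p.submodule) (hz : z ≠ 0) (a : ℂ × ℂ) (ha : a ≠ 0) :
    TautCompact m k :=
  ⟨p, Projectivization.mk ℂ (a.1 • PiTensorProduct.tprod ℂ fun _ => z, a.2)
    (fibre_ne_zero p z hz a ha)⟩

/-- The point `[u z^{⊗k} : v]` of the fibre over `[z]`, where `(u, v) = a ≠ 0`. -/
def pt (k : ℕ) (z : Fin m → ℂ) (hz : z ≠ 0) (a : ℂ × ℂ) (ha : a ≠ 0) : TautCompact m k :=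
  ptOver k (Projectivization.mk ℂ z hz) ⟨z, mem_mk_submodule z hz⟩
    (subtype_mk_ne_zero hz _) a ha

lemma ptOver_congr {p p' : ℙ ℂ (Fin m → ℂ)} (h : p = p') {z : p.submodule} {z' : p'.submodule}
    (hz : z ≠ 0) (hz' : z' ≠ 0) (hzz : (z : Fin m → ℂ) = z') {a : ℂ × ℂ} (ha : a ≠ 0) :
    ptOver k p z hz a ha = ptOver k p' z' hz' a ha := by
  subst h
  obtain rfl : z = z' := Subtype.ext hzz
  rfl

lemma pt_eq_ptOver (p : ℙ ℂ (Fin m → ℂ)) (z : p.submodule) (hz : z ≠ 0) (a : ℂ × ℂ) (ha : a ≠ 0) :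
    pt k (z : Fin m → ℂ) (by simpa using hz) a ha = ptOver k p z hz a ha := by
  have hz' : (z : Fin m → ℂ) ≠ 0 := by simpa using hz
  suffices h : Projectivization.mk ℂ (z : Fin m → ℂ) hz' = p from
    ptOver_congr h (subtype_mk_ne_zero hz' (mem_mk_submodule _ hz')) hz rfl ha
  have hle : p.submodule ≤ Submodule.span ℂ {p.rep} := (Projectivization.submodule_eq p).le
  obtain ⟨c, hc⟩ := Submodule.mem_span_singleton.1 (hle z.2)
  conv_rhs => rw [← Projectivization.mk_rep p]
  rw [Projectivization.mk_eq_mk_iff']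
  exact ⟨c, by rw [hc]⟩

lemma exists_pt (x : TautCompact m k) : ∃ z hz a ha, x = pt k z hz a ha := by
  obtain ⟨p, q⟩ := x
  have hmem : p.rep ∈ p.submodule := by
    rw [Projectivization.submodule_eq]; exact Submodule.mem_span_singleton_self _
  set z : p.submodule := ⟨p.rep, hmem⟩ with hzdef
  have hz : z ≠ 0 := by simpa [hzdef] using p.rep_nonzero
  have hspan : ∀ t : ⨂[ℂ]^k p.submodule, ∃ u : ℂ, t = u • PiTensorProduct.tprod ℂ fun _ => z := by
    intro t
    induction t using PiTensorProduct.induction_on with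
    | smul_tprod r f =>
      have : ∀ j, ∃ c : ℂ, f j = c • z := by
        intro j
        have hle : p.submodule ≤ Submodule.span ℂ {p.rep} := (Projectivization.submodule_eq p).le
        obtain ⟨c, hc⟩ := Submodule.mem_span_singleton.1 (hle (f j).2)
        exact ⟨c, Subtype.ext hc.symm⟩
      choose c hc using this
      refine ⟨r * ∏ j, c j, ?_⟩
      rw [show f = fun j => c j • z from funext hc, MultilinearMap.map_smul_univ, smul_smul]
    | add x y hx hy =>
      obtain ⟨u, rfl⟩ := hx
      obtain ⟨v, rfl⟩ := hy
      exact ⟨u + v, (add_smul _ _ _).symm⟩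
  induction q using Projectivization.ind with
  | h w hw =>
    obtain ⟨t, v⟩ := w
    obtain ⟨u, rfl⟩ := hspan t
    refine ⟨z, by simpa using hz, (u, v), ?_, ?_⟩
    · rintro h
      rw [Prod.mk_eq_zero] at h
      exact hw (by simp [h.1, h.2])
    · rw [pt_eq_ptOver p z hz]; rfl

lemma pt_eq_pt {z z' : Fin m → ℂ} (hz : z ≠ 0) (hz' : z' ≠ 0) {a a' : ℂ × ℂ} (ha : a ≠ 0)
    (ha' : a' ≠ 0) (l μ : ℂ) (h : z' = l • z) (h1 : μ * (a'.1 * l ^ k) = a.1)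
    (h2 : μ * a'.2 = a.2) : pt k z hz a ha = pt k z' hz' a' ha' := by
  have hmem : z' ∈ (Projectivization.mk ℂ z hz).submodule := by
    rw [h]; exact Submodule.smul_mem _ _ (mem_mk_submodule z hz)
  have e := pt_eq_ptOver (k := k) (Projectivization.mk ℂ z hz) ⟨z', hmem⟩
    (subtype_mk_ne_zero hz' _) a' ha'
  refine Eq.trans ?_ e.symm
  unfold pt ptOver
  congr 1
  rw [Projectivization.mk_eq_mk_iff']
  refine ⟨μ, ?_⟩
  have : (⟨z', hmem⟩ : (Projectivization.mk ℂ z hz).submodule) = l • ⟨z, mem_mk_submodule z hz⟩ :=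
    Subtype.ext h
  refine Prod.ext ?_ h2
  simp only [Prod.smul_fst]
  rw [this, show (PiTensorProduct.tprod ℂ fun _ : Fin k =>
      l • (⟨z, mem_mk_submodule z hz⟩ : (Projectivization.mk ℂ z hz).submodule)) = l ^ k •
      PiTensorProduct.tprod ℂ fun _ : Fin k =>
        (⟨z, mem_mk_submodule z hz⟩ : (Projectivization.mk ℂ z hz).submodule) by
    rw [MultilinearMap.map_smul_univ]; simp, smul_smul, smul_smul, mul_assoc, h1]

/-- The domain of the chart with index `(i, b)`: the `i`-th homogeneous coordinate of the base point
is nonzero and the point of the fibre `ℙ(L^{⊗k} ⊕ 1)` is not at infinity (`b = false`), or not on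
the zero section (`b = true`). -/
def chartSource (i : Fin m) (b : Bool) : Set (TautCompact m k) :=
  {x | x.1.rep i ≠ 0 ∧ bif b then powCoord k x.1 i x.2.rep.1 ≠ 0 else x.2.rep.2 ≠ 0}

/-- The coordinates of the chart with index `(i, b)`: the affine coordinates `z_j / z_i`, `j ≠ i`,
of the base point and, in the `i`-th slot, the coordinate `ζ` of the point
`[ζ (z / z_i)^{⊗k} : 1]` of the fibre (`b = false`) or `1 / ζ` (`b = true`). -/
def chartFun (i : Fin m) (b : Bool) (x : TautCompact m k) : Fin m → ℂ :=
  update (fun j => x.1.rep j / x.1.rep i) i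
    (bif b then x.2.rep.2 / powCoord k x.1 i x.2.rep.1 else powCoord k x.1 i x.2.rep.1 / x.2.rep.2)

/-- The homogeneous coordinates on the base and on the fibre of the point with given chart
coordinates. -/
def baseVec (i : Fin m) (c : Fin m → ℂ) : Fin m → ℂ := update c i 1

/-- See `baseVec`. -/
def fibreVec (i : Fin m) (b : Bool) (c : Fin m → ℂ) : ℂ × ℂ := bif b then (1, c i) else (c i, 1)

lemma baseVec_ne_zero (i : Fin m) (c : Fin m → ℂ) : baseVec i c ≠ 0 := by
  intro h; have := congrFun h i; simp [baseVec] at this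

lemma fibreVec_ne_zero (i : Fin m) (b : Bool) (c : Fin m → ℂ) : fibreVec i b c ≠ 0 := by
  cases b <;> simp [fibreVec]

/-- The point with given chart coordinates. -/
def chartInv (i : Fin m) (b : Bool) (c : Fin m → ℂ) : TautCompact m k :=
  pt k (baseVec i c) (baseVec_ne_zero i c) (fibreVec i b c) (fibreVec_ne_zero i b c)

lemma rep_pt (z : Fin m → ℂ) (hz : z ≠ 0) (a : ℂ × ℂ) (ha : a ≠ 0) :
    (∃ l : ℂ, l ≠ 0 ∧ (pt k z hz a ha).1.rep = l • z) ∧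
    (∃ μ : ℂ, μ ≠ 0 ∧ (∀ i, powCoord k (pt k z hz a ha).1 i (pt k z hz a ha).2.rep.1 =
      μ * (a.1 * z i ^ k)) ∧ (pt k z hz a ha).2.rep.2 = μ * a.2) := by
  constructor
  · obtain ⟨l, hl⟩ := Projectivization.exists_smul_eq_mk_rep ℂ z hz
    exact ⟨l, l.ne_zero, hl.symm⟩
  · obtain ⟨μ, hμ⟩ := Projectivization.exists_smul_eq_mk_rep ℂ _
      (fibre_ne_zero (k := k) (Projectivization.mk ℂ z hz) ⟨z, mem_mk_submodule z hz⟩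
        (subtype_mk_ne_zero hz _) a ha)
    have hμ' : (pt k z hz a ha).2.rep = (μ : ℂ) •
      ((a.1 • PiTensorProduct.tprod ℂ fun _ => ⟨z, mem_mk_submodule z hz⟩, a.2) :
        (⨂[ℂ]^k (Projectivization.mk ℂ z hz).submodule) × ℂ) := hμ.symm
    refine ⟨μ, μ.ne_zero, fun i => ?_, by rw [hμ']; rfl⟩
    have h1 : (pt k z hz a ha).2.rep.1 = (μ : ℂ) •
      (a.1 • PiTensorProduct.tprod ℂ fun _ => ⟨z, mem_mk_submodule z hz⟩) := by rw [hμ']; rfl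
    rw [h1, map_smul, map_smul]
    have := powCoord_tprod (k := k) (Projectivization.mk ℂ z hz) i ⟨z, mem_mk_submodule z hz⟩
    simp only [smul_eq_mul]
    congr 2

lemma pt_mem_chartSource (i : Fin m) (b : Bool) (z : Fin m → ℂ) (hz : z ≠ 0) (a : ℂ × ℂ)
    (ha : a ≠ 0) : pt k z hz a ha ∈ chartSource i b ↔ z i ≠ 0 ∧ bif b then a.1 ≠ 0 else a.2 ≠ 0 := by
  obtain ⟨⟨l, hl, hl'⟩, μ, hμ, h1, h2⟩ := rep_pt (k := k) z hz a ha
  simp only [chartSource, mem_ofPred_eq, hl', h1, h2]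
  cases b
  · simp [hl, hμ]
  · simp only [cond_true, Pi.smul_apply, smul_eq_mul]
    constructor
    · rintro ⟨h, h'⟩
      exact ⟨right_ne_zero_of_mul h, left_ne_zero_of_mul (right_ne_zero_of_mul h')⟩
    · rintro ⟨h, h'⟩
      exact ⟨mul_ne_zero hl h, mul_ne_zero hμ (mul_ne_zero h' (pow_ne_zero _ h))⟩

lemma chartFun_pt (i : Fin m) (b : Bool) (z : Fin m → ℂ) (hz : z ≠ 0) (a : ℂ × ℂ) (ha : a ≠ 0) :
    chartFun i b (pt k z hz a ha) = update (fun j => z j / z i) i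
      (bif b then a.2 / (a.1 * z i ^ k) else a.1 * z i ^ k / a.2) := by
  obtain ⟨⟨l, hl, hl'⟩, μ, hμ, h1, h2⟩ := rep_pt (k := k) z hz a ha
  simp only [chartFun, hl', h1, h2, Pi.smul_apply, smul_eq_mul]
  congr 1
  · funext j; rw [mul_div_mul_left _ _ hl]
  · rw [mul_div_mul_left _ _ hμ, mul_div_mul_left _ _ hμ]

/-- The chart with index `(i, b)`, a bijection between its domain and `ℂ^m`. -/
def chart (m k : ℕ) (i : Fin m) (b : Bool) : PartialEquiv (TautCompact m k) (Fin m → ℂ) where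
  toFun := chartFun i b
  invFun := chartInv i b
  source := chartSource i b
  target := univ
  map_source' _ _ := mem_univ _
  map_target' c _ := by
    rw [chartInv, pt_mem_chartSource]
    cases b <;> simp [baseVec, fibreVec]
  left_inv' x hx := by
    obtain ⟨z, hz, a, ha, rfl⟩ := exists_pt x
    rw [pt_mem_chartSource] at hx
    obtain ⟨hi, hb⟩ := hx
    rw [chartFun_pt]
    symm
    have hbase : baseVec i (update (fun j => z j / z i) i
        (bif b then a.2 / (a.1 * z i ^ k) else a.1 * z i ^ k / a.2)) = (z i)⁻¹ • z := by
      funext j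
      rcases eq_or_ne j i with rfl | hj
      · simp [baseVec, hi]
      · simp [baseVec, hj, div_eq_inv_mul]
    have hz0 : z i ^ k ≠ 0 := pow_ne_zero _ hi
    cases b
    · simp only [cond_false] at hb
      refine pt_eq_pt _ _ _ _ (z i)⁻¹ a.2 hbase ?_ ?_
      · simp [fibreVec]; field_simp
      · simp [fibreVec]
    · simp only [cond_true] at hb
      refine pt_eq_pt _ _ _ _ (z i)⁻¹ (a.1 * z i ^ k) hbase ?_ ?_
      · simp [fibreVec, hz0]
      · simp [fibreVec]; field_simp
  right_inv' c _ := by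
    rw [chartInv, chartFun_pt]
    funext j
    rcases eq_or_ne j i with rfl | hj
    · cases b <;> simp [baseVec, fibreVec]
    · simp [baseVec, hj]

lemma exists_mem_chart (x : TautCompact m k) : ∃ ib : Fin m × Bool, x ∈ (chart m k ib.1 ib.2).source := by
  obtain ⟨z, hz, a, ha, rfl⟩ := exists_pt x
  obtain ⟨i, hi⟩ := Function.ne_iff.1 hz
  by_cases h : a.2 = 0
  · exact ⟨(i, true), (pt_mem_chartSource i true z hz a ha).2
      ⟨hi, fun h' => ha (Prod.ext h' h)⟩⟩
  · exact ⟨(i, false), (pt_mem_chartSource i false z hz a ha).2 ⟨hi, h⟩⟩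

lemma chart_trans_source (i i' : Fin m) (b b' : Bool) :
    ((chart m k i b).symm.trans (chart m k i' b')).source =
      {c | baseVec i c i' ≠ 0 ∧ bif b' then (fibreVec i b c).1 ≠ 0 else (fibreVec i b c).2 ≠ 0} := by
  ext c
  rw [PartialEquiv.trans_source]
  simp only [PartialEquiv.symm_source, mem_inter_iff, mem_preimage, mem_ofPred_eq]
  rw [← pt_mem_chartSource (k := k) i' b' _ (baseVec_ne_zero i c) _ (fibreVec_ne_zero i b c)]
  exact ⟨fun h => h.2, fun h => ⟨mem_univ _, h⟩⟩

lemma contDiff_baseVec (i j : Fin m) : ContDiff ℂ ω fun c : Fin m → ℂ => baseVec i c j := by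
  rcases eq_or_ne j i with rfl | hj
  · simpa [baseVec] using contDiff_const
  · simpa [baseVec, hj] using contDiff_apply ℂ ℂ j

lemma contDiff_fibreVec (i : Fin m) (b : Bool) : ContDiff ℂ ω (fibreVec (m := m) i b) := by
  cases b
  · exact (contDiff_apply ℂ ℂ i).prodMk contDiff_const
  · exact contDiff_const.prodMk (contDiff_apply ℂ ℂ i)

lemma contDiffOn_chart_trans (i i' : Fin m) (b b' : Bool) :
    ContDiffOn ℂ ω ((chart m k i b).symm.trans (chart m k i' b'))
      ((chart m k i b).symm.trans (chart m k i' b')).source := by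
  rw [chart_trans_source]
  have key : ∀ c, (chart m k i b).symm.trans (chart m k i' b') c =
      update (fun j => baseVec i c j / baseVec i c i') i'
        (bif b' then (fibreVec i b c).2 / ((fibreVec i b c).1 * baseVec i c i' ^ k)
          else (fibreVec i b c).1 * baseVec i c i' ^ k / (fibreVec i b c).2) :=
    fun c => chartFun_pt i' b' _ (baseVec_ne_zero i c) _ (fibreVec_ne_zero i b c)
  refine ContDiffOn.congr ?_ fun c _ => key c
  rw [contDiffOn_pi]
  have hb := fun j => (contDiff_baseVec (m := m) i j)
  have h1 : ContDiff ℂ ω fun c : Fin m → ℂ => (fibreVec i b c).1 := (contDiff_fibreVec i b).fst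
  have h2 : ContDiff ℂ ω fun c : Fin m → ℂ => (fibreVec i b c).2 := (contDiff_fibreVec i b).snd
  intro j
  rcases eq_or_ne j i' with rfl | hj
  · cases b'
    · simp only [update_self, cond_false]
      exact ContDiffOn.div (h1.mul ((hb j).pow k)).contDiffOn h2.contDiffOn fun c hc => hc.2
    · simp only [update_self, cond_true]
      exact ContDiffOn.div h2.contDiffOn (h1.mul ((hb j).pow k)).contDiffOn
        fun c hc => mul_ne_zero hc.2 (pow_ne_zero _ hc.1)
  · simp only [update_of_ne hj]
    exact ContDiffOn.div (hb j).contDiffOn (hb i').contDiffOn fun c hc => hc.1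

/-- The charts define a topology and an atlas on `M^m_k`. -/
def core (m k : ℕ) : ChartedSpaceCore (Fin m → ℂ) (TautCompact m k) where
  atlas := range fun ib : Fin m × Bool => chart m k ib.1 ib.2
  chartAt x := chart m k (exists_mem_chart x).choose.1 (exists_mem_chart x).choose.2
  mem_chart_source x := (exists_mem_chart x).choose_spec
  chart_mem_atlas x := ⟨_, rfl⟩
  open_source := by
    rintro _ _ ⟨⟨i, b⟩, rfl⟩ ⟨⟨i', b'⟩, rfl⟩
    simp only
    rw [chart_trans_source]
    have hb : Continuous fun c : Fin m → ℂ => baseVec i c i' := (contDiff_baseVec i i').continuous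
    have hf := (contDiff_fibreVec (m := m) i b).continuous
    refine (isOpen_ne_fun hb continuous_const).inter ?_
    cases b'
    · exact isOpen_ne_fun hf.snd continuous_const
    · exact isOpen_ne_fun hf.fst continuous_const
  continuousOn_toFun := by
    rintro _ _ ⟨⟨i, b⟩, rfl⟩ ⟨⟨i', b'⟩, rfl⟩
    exact (contDiffOn_chart_trans i i' b b').continuousOn

instance : TopologicalSpace (TautCompact m k) := (core m k).toTopologicalSpace

instance : ChartedSpace (Fin m → ℂ) (TautCompact m k) := (core m k).toChartedSpace

lemma contDiffOn_trans_atlas {e e' : OpenPartialHomeomorph (TautCompact m k) (Fin m → ℂ)}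
    (he : e ∈ atlas (Fin m → ℂ) (TautCompact m k))
    (he' : e' ∈ atlas (Fin m → ℂ) (TautCompact m k)) :
    ContDiffOn ℂ ω (e.symm.trans e') (e.symm.trans e').source := by
  change e ∈ ⋃ (e : PartialEquiv _ _) (he : e ∈ (core m k).atlas), {(core m k).openPartialHomeomorph e he} at he
  change e' ∈ ⋃ (e : PartialEquiv _ _) (he : e ∈ (core m k).atlas), {(core m k).openPartialHomeomorph e he} at he'
  simp only [mem_iUnion, mem_singleton_iff] at he he'
  obtain ⟨_, ⟨⟨i, b⟩, rfl⟩, rfl⟩ := he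
  obtain ⟨_, ⟨⟨i', b'⟩, rfl⟩, rfl⟩ := he'
  exact contDiffOn_chart_trans i i' b b'

/-- `M^m_k` is a complex manifold. -/
instance : IsManifold 𝓘(ℂ, Fin m → ℂ) ω (TautCompact m k) :=
  isManifold_of_contDiffOn _ _ _ fun e e' he he' => by
    simpa using contDiffOn_trans_atlas he he'

/-- `M^m_k` as a real manifold. -/
instance : IsManifold 𝓘(ℝ, Fin m → ℂ) ∞ (TautCompact m k) :=
  isManifold_of_contDiffOn _ _ _ fun e e' he he' => by
    simpa using ((contDiffOn_trans_atlas he he').of_le le_top).restrict_scalars ℝ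

end TautCompact

/-! ## Riemannian geometry in a coordinate domain

`V` is a real vector space and `G` is a Riemannian metric on an open subset of `V`. -/

namespace Coord

variable {V : Type*} [NormedAddCommGroup V] [NormedSpace ℝ V]

/-- The 3-linear form `(u, v, w) ↦ ½ ((D_u G)(v, w) + (D_v G)(u, w) - (D_w G)(u, v))` of
Christoffel symbols of the first kind at `x`. -/
def christoffelFirst (G : V → V →L[ℝ] V →L[ℝ] ℝ) (x : V) : V →L[ℝ] V →L[ℝ] V →L[ℝ] ℝ :=
  (1 / 2 : ℝ) • (fderiv ℝ G x + (fderiv ℝ G x).flip -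
    (((ContinuousLinearMap.flipₗᵢ ℝ V V ℝ : (V →L[ℝ] V →L[ℝ] ℝ) ≃L[ℝ] (V →L[ℝ] V →L[ℝ] ℝ)) :
      (V →L[ℝ] V →L[ℝ] ℝ) →L[ℝ] (V →L[ℝ] V →L[ℝ] ℝ)).comp (fderiv ℝ G x).flip :
      V →L[ℝ] V →L[ℝ] V →L[ℝ] ℝ))

lemma christoffelFirst_apply (G : V → V →L[ℝ] V →L[ℝ] ℝ) (x u v w : V) :
    christoffelFirst G x u v w =
      1 / 2 * (fderiv ℝ G x u v w + fderiv ℝ G x v u w - fderiv ℝ G x w u v) := by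
  simp [christoffelFirst]

/-- The Christoffel symbols `Γ(u, v)` at `x` of the Levi-Civita connection of `G`. -/
def christoffel (G : V → V →L[ℝ] V →L[ℝ] ℝ) (x : V) : V →L[ℝ] V →L[ℝ] V :=
  (ContinuousLinearMap.compL ℝ V (V →L[ℝ] ℝ) V (G x).inverse).comp (christoffelFirst G x)

lemma christoffel_apply (G : V → V →L[ℝ] V →L[ℝ] ℝ) (x u v : V) :
    christoffel G x u v = (G x).inverse (christoffelFirst G x u v) := rfl

/-- The covariant derivative `∇_u W` at `x` of a vector field `W`. -/
def covDeriv (G : V → V →L[ℝ] V →L[ℝ] ℝ) (x u : V) (W : V → V) : V :=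
  fderiv ℝ W x u + christoffel G x u (W x)

/-- The endomorphism `u ↦ R(u, v) w` at `x`, where `R(u, v) = [∇_u, ∇_v] - ∇_[u, v]`. -/
def curvature (G : V → V →L[ℝ] V →L[ℝ] ℝ) (x v w : V) : V →L[ℝ] V :=
  ((fderiv ℝ (christoffel G) x).flip v).flip w - (fderiv ℝ (christoffel G) x v).flip w +
    (christoffel G x).flip (christoffel G x v w) - (christoffel G x v).comp ((christoffel G x).flip w)

lemma curvature_apply (G : V → V →L[ℝ] V →L[ℝ] ℝ) (x u v w : V) :
    curvature G x v w u = fderiv ℝ (christoffel G) x u v w - fderiv ℝ (christoffel G) x v u w +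
      christoffel G x u (christoffel G x v w) - christoffel G x v (christoffel G x u w) := rfl

/-- The Ricci tensor `Ric(v, w) = tr (u ↦ R(u, v) w)` at `x`. -/
def ricci [FiniteDimensional ℝ V] (G : V → V →L[ℝ] V →L[ℝ] ℝ) (x : V) : V →L[ℝ] V →L[ℝ] ℝ :=
  (LinearMap.mk₂ ℝ (fun v w => LinearMap.trace ℝ V (curvature G x v w))
    (fun v v' w => by
      rw [← map_add]; congr 1; ext u; simp [curvature_apply]; abel)
    (fun c v w => by
      rw [← map_smul]; congr 1; ext u; simp [curvature_apply, smul_sub, smul_add])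
    (fun v w w' => by
      rw [← map_add]; congr 1; ext u; simp [curvature_apply]; abel)
    (fun c v w => by
      rw [← map_smul]; congr 1; ext u
      simp [curvature_apply, smul_sub, smul_add])).toContinuousBilinearMap

/-- The Hessian `∇dF` at `x`, that is, `(∇dF)(u, v) = D²F(u, v) - DF(Γ(u, v))`. -/
def hessian (G : V → V →L[ℝ] V →L[ℝ] ℝ) (F : V → ℝ) (x : V) : V →L[ℝ] V →L[ℝ] ℝ :=
  fderiv ℝ (fderiv ℝ F) x -
    (ContinuousLinearMap.compL ℝ V V ℝ (fderiv ℝ F x)).comp (christoffel G x)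

/-- The Lie derivative `£_W G` at `x`. -/
def lieDeriv (G : V → V →L[ℝ] V →L[ℝ] ℝ) (W : V → V) (x u v : V) : ℝ :=
  fderiv ℝ G x (W x) u v + G x (fderiv ℝ W x u) v + G x u (fderiv ℝ W x v)

end Coord

/-! ## Riemannian geometry on a manifold

The tangent space `TangentSpace 𝓘(ℝ, V) p` is a copy of the model space `V`, identified with it by
the differential of the chart `chartAt V p`. Accordingly, tensors at `p` are computed in that
chart. -/

namespace Riem

variable {V : Type*} [NormedAddCommGroup V] [NormedSpace ℝ V]
  {M : Type*} [TopologicalSpace M] [ChartedSpace V M] [IsManifold 𝓘(ℝ, V) ∞ M]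

variable (V M) in
/-- Smooth Riemannian metrics on `M`. -/
abbrev Metric : Type _ :=
  Bundle.ContMDiffRiemannianMetric 𝓘(ℝ, V) ∞ V (fun p : M => TangentSpace 𝓘(ℝ, V) p)

/-- Bilinear forms on the tangent space at `p`. -/
abbrev Bilin (V : Type*) [NormedAddCommGroup V] [NormedSpace ℝ V]
    {M : Type*} [TopologicalSpace M] [ChartedSpace V M] (p : M) : Type _ :=
  TangentSpace 𝓘(ℝ, V) p →L[ℝ] TangentSpace 𝓘(ℝ, V) p →L[ℝ] ℝ

/-- The metric `g` in the chart at `p`: its pullback under the inverse of `chartAt V p`. -/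
def inChart (g : Metric V M) (p : M) (y : V) : V →L[ℝ] V →L[ℝ] ℝ :=
  ContinuousLinearMap.bilinearComp (E := V) (F := V) (g.inner ((chartAt V p).symm y))
    (mfderiv 𝓘(ℝ, V) 𝓘(ℝ, V) (chartAt V p).symm y) (mfderiv 𝓘(ℝ, V) 𝓘(ℝ, V) (chartAt V p).symm y)

/-- The Ricci tensor of `g`. -/
def ricci [FiniteDimensional ℝ V] (g : Metric V M) (p : M) : Bilin V p :=
  Coord.ricci (V := V) (inChart g p) (chartAt V p p)

/-- The `g`-Hessian `∇df`. -/
def hessian (g : Metric V M) (f : M → ℝ) (p : M) : Bilin V p :=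
  Coord.hessian (V := V) (inChart g p) (f ∘ (chartAt V p).symm) (chartAt V p p)

/-- The `g`-gradient `∇f`. -/
def grad (g : Metric V M) (f : M → ℝ) (p : M) : TangentSpace 𝓘(ℝ, V) p :=
  (g.inner p).inverse (mfderiv 𝓘(ℝ, V) 𝓘(ℝ, ℝ) f p)

/-- The `g`-trace of `b`: the trace of the endomorphism `B` with `g(Bu, v) = b(u, v)`. -/
def trace (g : Metric V M) (p : M) (b : Bilin V p) : ℝ :=
  LinearMap.trace ℝ (TangentSpace 𝓘(ℝ, V) p)
    ((g.inner p).inverse.comp b : TangentSpace 𝓘(ℝ, V) p →L[ℝ] TangentSpace 𝓘(ℝ, V) p)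

/-- The `g`-traceless part `b - (tr_g b) g / n`, `n = dim M`. -/
def traceless (g : Metric V M) (p : M) (b : Bilin V p) : Bilin V p :=
  b - (trace g p b / Module.finrank ℝ V) • g.inner p

/-- The `g`-Laplacian. -/
def laplacian (g : Metric V M) (f : M → ℝ) (p : M) : ℝ := trace g p (hessian g f p)

/-- The scalar curvature. -/
def scalar [FiniteDimensional ℝ V] (g : Metric V M) (p : M) : ℝ := trace g p (ricci g p)

/-- `g(∇f, ∇f)`. -/
def gradSq (g : Metric V M) (f : M → ℝ) (p : M) : ℝ := g.inner p (grad g f p) (grad g f p)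

/-- The Lie derivative `£_w g`. -/
def lieDeriv (g : Metric V M) (w : ∀ p : M, TangentSpace 𝓘(ℝ, V) p) (p : M)
    (u v : TangentSpace 𝓘(ℝ, V) p) : ℝ :=
  Coord.lieDeriv (inChart g p)
    (VectorField.mpullback 𝓘(ℝ, V) 𝓘(ℝ, V) (chartAt V p).symm w) (chartAt V p p) u v

/-- `g` is a Ricci soliton with soliton constant `c`: for some smooth vector field `w`, one has
`£_w g + Ric = c g`. -/
def IsRicciSoliton [FiniteDimensional ℝ V] (g : Metric V M) (c : ℝ) : Prop :=
  ∃ w : ∀ p : M, TangentSpace 𝓘(ℝ, V) p,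
    ContMDiff 𝓘(ℝ, V) 𝓘(ℝ, V).tangent ∞ (fun p => (⟨p, w p⟩ : TangentBundle 𝓘(ℝ, V) M)) ∧
    ∀ (p : M) (u v : TangentSpace 𝓘(ℝ, V) p),
      lieDeriv g w p u v + ricci g p u v = c * g.inner p u v

/-- The normalized gradient soliton equation: `∇df + Ric = g` and `Δf - g(∇f, ∇f) + 2f = 0`. -/
def IsNormalizedGradientSoliton [FiniteDimensional ℝ V] (g : Metric V M) (f : M → ℝ) : Prop :=
  ContMDiff 𝓘(ℝ, V) 𝓘(ℝ, ℝ) ∞ f ∧ ∀ p, hessian g f p + ricci g p = g.inner p ∧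
    laplacian g f p - gradSq g f p + 2 * f p = 0

/-- The three-equation form, with `n = dim M`, of the normalized gradient soliton equation. -/
def SolitonSystem [FiniteDimensional ℝ V] (g : Metric V M) (f : M → ℝ) : Prop :=
  ∀ p, traceless g p (hessian g f p + ricci g p) = 0 ∧
    laplacian g f p - gradSq g f p + 2 * f p = 0 ∧
    ((Module.finrank ℝ V : ℝ) - 2) * (laplacian g f p + scalar g p - Module.finrank ℝ V) +
      Module.finrank ℝ V * (laplacian g f p - gradSq g f p + 2 * f p) = 0

/-- `g` is a Kähler metric on the complex manifold `M`: multiplication by `i` in the tangent spaces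
preserves `g` and commutes with the covariant derivative of vector fields. (In a chart of the
complex manifold `M`, that multiplication is the multiplication by `i` in `ℂ^m`.) -/
structure IsKahler {m : ℕ} {M : Type*} [TopologicalSpace M] [ChartedSpace (Fin m → ℂ) M]
    [IsManifold 𝓘(ℂ, Fin m → ℂ) ω M] [IsManifold 𝓘(ℝ, Fin m → ℂ) ∞ M]
    (g : Metric (Fin m → ℂ) M) : Prop where
  hermitian : ∀ (p : M) (u v : Fin m → ℂ),
    g.inner p (Complex.I • u : Fin m → ℂ) (Complex.I • v : Fin m → ℂ) = g.inner p u v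
  parallel : ∀ (p : M) (W : (Fin m → ℂ) → Fin m → ℂ), ContDiff ℝ ∞ W → ∀ u : Fin m → ℂ,
    Coord.covDeriv (inChart g p) (chartAt (Fin m → ℂ) p p) u (fun y => Complex.I • W y) =
      Complex.I • Coord.covDeriv (inChart g p) (chartAt (Fin m → ℂ) p p) u W

end Riem

/-! ## The system of ordinary differential equations -/

/-- The derivative with respect to the variable `t ∈ [0, T]`. -/
def dot (T : ℝ) (h : ℝ → ℝ) : ℝ → ℝ := derivWithin h (Icc 0 T)

/-- `(x, y, φ)` is a `C^∞` solution on `[0, T]` of the system of equations. -/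
structure IsSolution (m k : ℕ) (T : ℝ) (x y φ : ℝ → ℝ) : Prop where
  smooth_x : ContDiffOn ℝ ∞ x (Icc 0 T)
  smooth_y : ContDiffOn ℝ ∞ y (Icc 0 T)
  smooth_phi : ContDiffOn ℝ ∞ φ (Icc 0 T)
  eq_x : ∀ t ∈ Icc 0 T, 2 * dot T (dot T x) t = dot T y t ^ 2 - dot T x t ^ 2 + 1
  eq_y : ∀ t ∈ Icc 0 T, φ t * dot T (dot T y) t =
    (m - 1) * φ t * dot T x t * dot T y t - dot T φ t * dot T y t - y t * Real.exp (y t - x t)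
  eq_phi : ∀ t ∈ Icc 0 T, dot T (dot T φ) t = (m - 1) * dot T x t * dot T φ t + m * φ t - m
  eq_int : ∀ t ∈ Icc 0 T, 2 * dot T x t * dot T φ t - (2 * m - 1) * φ t * dot T x t ^ 2 +
    φ t * dot T y t ^ 2 + 2 * (y t - 1) * Real.exp (y t - x t) - φ t + 2 * m = 0
  phi_zero : φ 0 = 0
  phi_T : φ T = 0
  phi_pos : ∀ t ∈ Ioo 0 T, 0 < φ t
  dot_zero : dot T φ 0 = k
  dot_T : -dot T φ T = k

open Riem in
/-- `(g, t)` is a Kähler metric on `M^m_k` with a smooth function `t` onto `[0, T]` having, together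
with `κ = e^t`, the following properties. -/
structure IsAssociated (m k : ℕ) (T : ℝ) (x φ : ℝ → ℝ)
    (g : Riem.Metric (Fin m → ℂ) (TautCompact m k)) (t : TautCompact m k → ℝ) : Prop where
  kahler : IsKahler g
  smooth : ContMDiff 𝓘(ℝ, Fin m → ℂ) 𝓘(ℝ, ℝ) ∞ t
  range_eq : range t = Icc 0 T
  ricciHessian : ∀ p, traceless g p
    (((m - 1) * (dot T x (t p) + 1) * Real.exp (-t p)) • hessian g (fun q => Real.exp (t q)) p +
      ricci g p) = 0
  laplacian_eq : ∀ p, laplacian g (fun q => Real.exp (t q)) p =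
    2 * (dot T φ (t p) + m * φ (t p))
  gradSq_eq : ∀ p, gradSq g (fun q => Real.exp (t q)) p = 2 * Real.exp (t p) * φ (t p)
  scalar_eq : ∀ p, Real.exp (t p) * scalar g p / 2 =
    m * (m - 1) - m * (m - 1) * φ (t p) - (2 * m - 1) * dot T φ (t p) - dot T (dot T φ) (t p)

end

/-! The proof has three independent parts.

*Topology.* The map from homogeneous coordinates `(z, a) ∈ (ℂ^m ∖ 0) × (ℂ² ∖ 0)` to `M^m_k` is
continuous and onto. Hence `M^m_k` is connected, and it is compact because it is already the image
of a product of spheres (`TautCompact.compactSpace`). It is Hausdorff because the entries of the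
orthogonal projections onto the line of the base point and onto the line of the point of the fibre
are continuous functions which separate points (`TautCompact.t2Space`).

*Existence of associated pairs.* In a chart with coordinates `c`, let `z` be the homogeneous
coordinates of the base point with `z_i = 1`, let `ζ` be the fibre coordinate `c i`, and put
`N = |z|²` and `s = |ζ|² N^k` (or `|ζ|² N^{-k}` near the section at infinity). The function `t` is
the solution of `k s dt/ds = ±φ(t)` which maps `s = 0` to an end of `[0, T]`. It is smooth up to
`s = 0` because `φ` has derivative `±k` at the ends of the interval (`Profile.exists_of_boundary`).
Let `h = ∂∂̄ log N` be the Fubini-Study form and `θ = ±dζ/(kζ) + ∂ log N`, so that `∂t = φ(t) θ`.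
The metric is `2e^t Re (h + φ(t) θ ⊗ θ̄)`. It does not depend on the chart, since `t` and `h` do
not and `θ` is determined by `t` (`chartMetric_transMap`). Where `ζ ≠ 0`, its Christoffel symbols
are complex-bilinear (`christoffel_chartMetric`), so that it is Kähler. The curvature is obtained
from the antilinear part of their derivative (`curvature_chartMetric`), and the Ricci tensor from a
complex trace (`ricci_chartMetric`). The Hessian and the gradient of `κ = e^t` are computed in the
same way, and the required identities extend to the points with `ζ = 0` by continuity
(`laplacian_kappaFun`, `gradSq_kappaFun`). The Ricci tensor, the Hessian of `κ` and the metric are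
all of the form `Re (A h + B θ ⊗ θ̄)`, and the second-order equation for `φ` is the linear relation
between them (`ricci_add_hessian`).

*The soliton.* Let `(g, t)` be any associated pair. By the formulas for the Hessian and the Ricci
tensor of a conformally changed metric (`conformal_hessian`, `conformal_ricci`), `∇̄df + Ric̄ - ḡ`
is a combination of `∇dt`, `dt ⊗ dt` and `g`, with coefficients depending on `t` only; those of
`Ric` and of the Laplacian of `t` are given by the assumptions on the pair. The differential
equations say that they vanish, and the equation for `y` is the scalar equation
`Δ̄f - ḡ(∇̄f, ∇̄f) + 2f = 0` (`Riem.soliton_of_associated`). As `£_w ḡ = 2 ∇̄df` for `w = ∇̄f`, the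
soliton vector field is `½ ∇̄f`. -/

noncomputable section

/-! ### Metrics, Christoffel symbols and gradients in a coordinate domain -/

namespace Coord

variable {V : Type*} [NormedAddCommGroup V] [NormedSpace ℝ V]

/-- `G` is a smooth Riemannian metric on the open set `U`; its values outside `U` are arbitrary. -/
structure IsMetricOn (G : V → V →L[ℝ] V →L[ℝ] ℝ) (U : Set V) : Prop where
  isOpen : IsOpen U
  smooth : ContDiffOn ℝ ∞ G U
  symm : ∀ y ∈ U, ∀ u v, G y u v = G y v u
  pos : ∀ y ∈ U, ∀ u, u ≠ 0 → 0 < G y u u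

/-- The covector-to-vector isomorphism of a positive definite form. -/
lemma exists_equiv_of_pos [FiniteDimensional ℝ V] (B : V →L[ℝ] V →L[ℝ] ℝ)
    (h : ∀ u, u ≠ 0 → 0 < B u u) : ∃ e : V ≃L[ℝ] (V →L[ℝ] ℝ), (e : V →L[ℝ] V →L[ℝ] ℝ) = B := by
  have hinj : Injective (B : V →ₗ[ℝ] V →L[ℝ] ℝ) := by
    rw [← LinearMap.ker_eq_bot, LinearMap.ker_eq_bot']
    intro u hu
    by_contra hne
    have := h u hne
    have h0 : B u = 0 := hu
    rw [h0] at this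
    exact lt_irrefl _ this
  have hfin : Module.finrank ℝ V = Module.finrank ℝ (V →L[ℝ] ℝ) := by
    rw [← LinearMap.toContinuousLinearMap.finrank_eq]
    exact (Subspace.dual_finrank_eq (K := ℝ) (V := V)).symm
  refine ⟨(LinearEquiv.ofInjectiveOfFinrankEq _ hinj hfin).toContinuousLinearEquiv, ?_⟩
  ext u v
  rfl

lemma apply_inverse_of_pos [FiniteDimensional ℝ V] {B : V →L[ℝ] V →L[ℝ] ℝ}
    (h : ∀ u, u ≠ 0 → 0 < B u u) (ξ : V →L[ℝ] ℝ) : B (B.inverse ξ) = ξ := by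
  obtain ⟨e, rfl⟩ := exists_equiv_of_pos B h
  simp

lemma inverse_apply_of_pos [FiniteDimensional ℝ V] {B : V →L[ℝ] V →L[ℝ] ℝ}
    (h : ∀ u, u ≠ 0 → 0 < B u u) (u : V) : B.inverse (B u) = u := by
  obtain ⟨e, rfl⟩ := exists_equiv_of_pos B h
  simp

lemma eq_inverse_of_pos [FiniteDimensional ℝ V] {B : V →L[ℝ] V →L[ℝ] ℝ}
    (h : ∀ u, u ≠ 0 → 0 < B u u) {ξ : V →L[ℝ] ℝ} {u : V} (hu : ∀ v, B u v = ξ v) :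
    B.inverse ξ = u := by
  rw [← inverse_apply_of_pos h u]
  congr 1
  exact (ContinuousLinearMap.ext hu).symm

lemma contDiffAt_inverse_of_pos [FiniteDimensional ℝ V] {B : V →L[ℝ] V →L[ℝ] ℝ}
    (h : ∀ u, u ≠ 0 → 0 < B u u) :
    ContDiffAt ℝ ∞ (ContinuousLinearMap.inverse : (V →L[ℝ] V →L[ℝ] ℝ) → _) B := by
  have : CompleteSpace V := FiniteDimensional.complete ℝ V
  obtain ⟨e, rfl⟩ := exists_equiv_of_pos B h
  exact contDiffAt_map_inverse e

section Deriv

variable {W : Type*} [NormedAddCommGroup W] [NormedSpace ℝ W]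

lemma fderiv_bilin_apply {F : V → V →L[ℝ] V →L[ℝ] W} {x : V} (h : DifferentiableAt ℝ F x)
    (u v w : V) : fderiv ℝ F x u v w = fderiv ℝ (fun y => F y v w) x u := by
  have h1 : HasFDerivAt (fun y => F y v w)
      ((ContinuousLinearMap.apply ℝ W w).comp
        ((ContinuousLinearMap.apply ℝ (V →L[ℝ] W) v).comp (fderiv ℝ F x))) x :=
    (ContinuousLinearMap.apply ℝ W w).hasFDerivAt.comp x
      ((ContinuousLinearMap.apply ℝ (V →L[ℝ] W) v).hasFDerivAt.comp x h.hasFDerivAt)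
  rw [h1.fderiv]; rfl

lemma fderiv_lin_apply {F : V → V →L[ℝ] W} {x : V} (h : DifferentiableAt ℝ F x)
    (u v : V) : fderiv ℝ F x u v = fderiv ℝ (fun y => F y v) x u := by
  have h1 : HasFDerivAt (fun y => F y v)
      ((ContinuousLinearMap.apply ℝ W v).comp (fderiv ℝ F x)) x :=
    (ContinuousLinearMap.apply ℝ W v).hasFDerivAt.comp x h.hasFDerivAt
  rw [h1.fderiv]; rfl

lemma fderiv_fderiv_symm {F : V → W} {x : V} (h : ContDiffAt ℝ ∞ F x) (u v : V) :
    fderiv ℝ (fderiv ℝ F) x u v = fderiv ℝ (fderiv ℝ F) x v u :=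
  (h.isSymmSndFDerivAt (by
    rw [minSmoothness_of_isRCLikeNormedField]
    exact WithTop.coe_le_coe.2 (le_top : (2 : ℕ∞) ≤ ⊤))) u v

end Deriv

namespace IsMetricOn

variable {G : V → V →L[ℝ] V →L[ℝ] ℝ} {U : Set V} (h : IsMetricOn G U)
include h

lemma contDiffAt {x : V} (hx : x ∈ U) : ContDiffAt ℝ ∞ G x :=
  h.smooth.contDiffAt (h.isOpen.mem_nhds hx)

lemma differentiableAt {x : V} (hx : x ∈ U) : DifferentiableAt ℝ G x :=
  (h.contDiffAt hx).differentiableAt (by simp)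

lemma fderiv_symm {x : V} (hx : x ∈ U) (u v w : V) :
    fderiv ℝ G x u v w = fderiv ℝ G x u w v := by
  rw [fderiv_bilin_apply (h.differentiableAt hx), fderiv_bilin_apply (h.differentiableAt hx)]
  congr 1
  apply Filter.EventuallyEq.fderiv_eq
  filter_upwards [h.isOpen.mem_nhds hx] with y hy using h.symm y hy v w

lemma christoffel_symm {x : V} (hx : x ∈ U) (u v : V) :
    christoffel G x u v = christoffel G x v u := by
  rw [christoffel_apply, christoffel_apply]
  congr 1
  ext w
  rw [christoffelFirst_apply, christoffelFirst_apply, h.fderiv_symm hx w u v]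
  ring

variable [FiniteDimensional ℝ V]

lemma contDiffOn_inverse : ContDiffOn ℝ ∞ (fun y => (G y).inverse) U := fun y hy =>
  ((contDiffAt_inverse_of_pos (h.pos y hy)).comp y (h.contDiffAt hy)).contDiffWithinAt

lemma apply_christoffel {x : V} (hx : x ∈ U) (u v w : V) :
    G x (christoffel G x u v) w = christoffelFirst G x u v w := by
  rw [christoffel_apply, apply_inverse_of_pos (h.pos x hx)]

/-- The Levi-Civita connection is metric. -/
lemma fderiv_eq {x : V} (hx : x ∈ U) (z u v : V) :
    fderiv ℝ G x z u v = G x (christoffel G x z u) v + G x u (christoffel G x z v) := by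
  rw [h.symm x hx u, h.apply_christoffel hx, h.apply_christoffel hx, christoffelFirst_apply,
    christoffelFirst_apply, h.fderiv_symm hx z v u]
  ring

/-- The Levi-Civita connection is the only torsion-free metric one. -/
lemma christoffel_eq {x : V} (hx : x ∈ U) (Γ : V → V → V) (hs : ∀ u v, Γ u v = Γ v u)
    (hc : ∀ z u v, fderiv ℝ G x z u v = G x (Γ z u) v + G x u (Γ z v)) (u v : V) :
    christoffel G x u v = Γ u v := by
  rw [christoffel_apply]
  refine eq_inverse_of_pos (h.pos x hx) fun w => ?_
  rw [christoffelFirst_apply, hc, hc, hc, hs v u, hs w u, hs w v, h.symm x hx (Γ u w) v,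
    h.symm x hx u (Γ v w)]
  ring

lemma contDiffOn_christoffel : ContDiffOn ℝ ∞ (christoffel G) U := by
  have h1 : ContDiffOn ℝ ∞ (fderiv ℝ G) U := h.smooth.fderiv_of_isOpen h.isOpen (by simp)
  have h2 : ContDiffOn ℝ ∞ (christoffelFirst G) U := by
    unfold christoffelFirst
    refine ContDiffOn.const_smul _ ((h1.add ?_).sub ?_)
    · exact (ContinuousLinearMap.flipₗᵢ ℝ V V (V →L[ℝ] ℝ)).contDiff.comp_contDiffOn h1
    · exact contDiffOn_const.clm_comp
        ((ContinuousLinearMap.flipₗᵢ ℝ V V (V →L[ℝ] ℝ)).contDiff.comp_contDiffOn h1)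
  exact ((ContinuousLinearMap.compL ℝ V (V →L[ℝ] ℝ) V).contDiff.comp_contDiffOn
    h.contDiffOn_inverse).clm_comp h2

lemma differentiableAt_christoffel {x : V} (hx : x ∈ U) :
    DifferentiableAt ℝ (christoffel G) x :=
  (h.contDiffOn_christoffel.contDiffAt (h.isOpen.mem_nhds hx)).differentiableAt (by simp)

end IsMetricOn

/-- The gradient of a function. -/
def grad (G : V → V →L[ℝ] V →L[ℝ] ℝ) (F : V → ℝ) (y : V) : V := (G y).inverse (fderiv ℝ F y)

lemma hessian_apply (G : V → V →L[ℝ] V →L[ℝ] ℝ) (F : V → ℝ) (x u v : V) :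
    hessian G F x u v = fderiv ℝ (fderiv ℝ F) x u v - fderiv ℝ F x (christoffel G x u v) := rfl

lemma ricci_apply [FiniteDimensional ℝ V] (G : V → V →L[ℝ] V →L[ℝ] ℝ) (x v w : V) :
    ricci G x v w = LinearMap.trace ℝ V (curvature G x v w) := rfl

lemma lieDeriv_congr (G : V → V →L[ℝ] V →L[ℝ] ℝ) {W W' : V → V} {x : V} (h : W =ᶠ[𝓝 x] W')
    (u v : V) : lieDeriv G W x u v = lieDeriv G W' x u v := by
  unfold lieDeriv; rw [h.fderiv_eq, h.eq_of_nhds]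

namespace IsMetricOn

variable {G : V → V →L[ℝ] V →L[ℝ] ℝ} {U : Set V} (h : IsMetricOn G U) {F : V → ℝ}
include h

lemma hessian_symm {x : V} (hx : x ∈ U) (hF : ContDiffAt ℝ ∞ F x) (u v : V) :
    hessian G F x u v = hessian G F x v u := by
  rw [hessian_apply, hessian_apply, fderiv_fderiv_symm hF, h.christoffel_symm hx]

variable [FiniteDimensional ℝ V]

lemma apply_grad {x : V} (hx : x ∈ U) (u : V) : G x (grad G F x) u = fderiv ℝ F x u := by
  rw [grad, apply_inverse_of_pos (h.pos x hx)]

lemma contDiffOn_grad (hF : ContDiffOn ℝ ∞ F U) : ContDiffOn ℝ ∞ (grad G F) U :=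
  h.contDiffOn_inverse.clm_apply (hF.fderiv_of_isOpen h.isOpen (by simp))

lemma differentiableAt_grad (hF : ContDiffOn ℝ ∞ F U) {x : V} (hx : x ∈ U) :
    DifferentiableAt ℝ (grad G F) x :=
  ((h.contDiffOn_grad hF).contDiffAt (h.isOpen.mem_nhds hx)).differentiableAt (by simp)

lemma apply_fderiv_grad (hF : ContDiffOn ℝ ∞ F U) {x : V} (hx : x ∈ U) (u w : V) :
    G x (fderiv ℝ (grad G F) x u + christoffel G x u (grad G F x)) w = hessian G F x u w := by
  have h1 : fderiv ℝ (fun y => G y (grad G F y)) x = fderiv ℝ (fderiv ℝ F) x := by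
    apply Filter.EventuallyEq.fderiv_eq
    filter_upwards [h.isOpen.mem_nhds hx] with y hy
    ext u
    exact h.apply_grad hy u
  have h2 := ((h.differentiableAt hx).hasFDerivAt.clm_apply
    (h.differentiableAt_grad hF hx).hasFDerivAt).fderiv
  have h3 := congrArg (fun L => L u w) (h2.symm.trans h1)
  simp only [add_apply, ContinuousLinearMap.comp_apply,
    ContinuousLinearMap.flip_apply] at h3
  rw [hessian_apply, ← h3, h.fderiv_eq hx, map_add, add_apply,
    h.apply_grad hx]
  ring

/-- The covariant derivative of the gradient is the Hessian. -/
lemma fderiv_grad (hF : ContDiffOn ℝ ∞ F U) {x : V} (hx : x ∈ U) (u : V) :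
    fderiv ℝ (grad G F) x u =
      (G x).inverse (hessian G F x u) - christoffel G x u (grad G F x) := by
  rw [eq_sub_iff_add_eq]
  exact (eq_inverse_of_pos (h.pos x hx) fun w => h.apply_fderiv_grad hF hx u w).symm

/-- `£_{∇F} G = 2 ∇dF`. -/
lemma lieDeriv_grad (hF : ContDiffOn ℝ ∞ F U) {x : V} (hx : x ∈ U) (u v : V) :
    lieDeriv G (grad G F) x u v = 2 * hessian G F x u v := by
  have h1 := h.apply_fderiv_grad hF hx u v
  have h2 := h.apply_fderiv_grad hF hx v u
  rw [h.hessian_symm hx (hF.contDiffAt (h.isOpen.mem_nhds hx)) v u] at h2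
  rw [lieDeriv, h.fderiv_eq hx, h.symm x hx u (fderiv ℝ (grad G F) x v)]
  rw [map_add, add_apply] at h1 h2
  rw [h.christoffel_symm hx (grad G F x) u, h.christoffel_symm hx (grad G F x) v,
    h.symm x hx u (christoffel G x v _)]
  linarith

lemma contDiffOn_curvature (v w : V) : ContDiffOn ℝ ∞ (fun y => curvature G y v w) U := by
  have h1 := h.contDiffOn_christoffel
  have h2 : ContDiffOn ℝ ∞ (fderiv ℝ (christoffel G)) U := h1.fderiv_of_isOpen h.isOpen (by simp)
  have hf := (ContinuousLinearMap.flipₗᵢ ℝ V V V).contDiff (n := ∞)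
  have hf' := (ContinuousLinearMap.flipₗᵢ ℝ V V (V →L[ℝ] V)).contDiff (n := ∞)
  have hv : ContDiffOn ℝ ∞ (fun _ : V => v) U := contDiffOn_const
  have hw : ContDiffOn ℝ ∞ (fun _ : V => w) U := contDiffOn_const
  unfold curvature
  refine ((ContDiffOn.sub ?_ ?_).add ?_).sub ?_
  · exact (hf.comp_contDiffOn ((hf'.comp_contDiffOn h2).clm_apply hv)).clm_apply hw
  · exact (hf.comp_contDiffOn (h2.clm_apply hv)).clm_apply hw
  · exact (hf.comp_contDiffOn h1).clm_apply ((h1.clm_apply hv).clm_apply hw)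
  · exact (h1.clm_apply hv).clm_comp ((hf.comp_contDiffOn h1).clm_apply hw)

lemma continuousOn_ricci (v w : V) : ContinuousOn (fun y => ricci G y v w) U := by
  have : ContinuousOn (fun y => curvature G y v w) U := (h.contDiffOn_curvature v w).continuousOn
  have ht : Continuous fun A : V →L[ℝ] V => LinearMap.trace ℝ V (A : V →ₗ[ℝ] V) :=
    LinearMap.continuous_of_finiteDimensional
      ((LinearMap.trace ℝ V).comp (ContinuousLinearMap.coeLM ℝ))
  exact ht.comp_continuousOn this

lemma contDiffOn_hessian (hF : ContDiffOn ℝ ∞ F U) : ContDiffOn ℝ ∞ (hessian G F) U := by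
  have h1 : ContDiffOn ℝ ∞ (fderiv ℝ F) U := hF.fderiv_of_isOpen h.isOpen (by simp)
  have h2 : ContDiffOn ℝ ∞ (fderiv ℝ (fderiv ℝ F)) U := h1.fderiv_of_isOpen h.isOpen (by simp)
  exact h2.sub (((ContinuousLinearMap.compL ℝ V V ℝ).contDiff.comp_contDiffOn h1).clm_comp
    h.contDiffOn_christoffel)

end IsMetricOn

end Coord

/-! ### Traces and conformal changes of the metric -/

namespace Coord

variable {V : Type*} [NormedAddCommGroup V] [NormedSpace ℝ V] [FiniteDimensional ℝ V]

/-- The trace of a bilinear form with respect to a positive definite one. -/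
def trace (B b : V →L[ℝ] V →L[ℝ] ℝ) : ℝ :=
  LinearMap.trace ℝ V (B.inverse.comp b : V →L[ℝ] V)

omit [FiniteDimensional ℝ V] in
lemma trace_add (B b b' : V →L[ℝ] V →L[ℝ] ℝ) : trace B (b + b') = trace B b + trace B b' := by
  simp [trace]

omit [FiniteDimensional ℝ V] in
lemma trace_smul (B b : V →L[ℝ] V →L[ℝ] ℝ) (c : ℝ) : trace B (c • b) = c * trace B b := by
  simp [trace]

lemma trace_self {B : V →L[ℝ] V →L[ℝ] ℝ} (h : ∀ u, u ≠ 0 → 0 < B u u) :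
    trace B B = Module.finrank ℝ V := by
  have : (B.inverse.comp B : V →L[ℝ] V) = ContinuousLinearMap.id ℝ V := by
    ext u; exact inverse_apply_of_pos h u
  rw [trace, this]
  exact LinearMap.trace_id ℝ V

/-- The tensor product `ξ ⊗ η`, that is, the bilinear form `(u, v) ↦ ξ u * η v`. -/
def tmul (ξ η : V →L[ℝ] ℝ) : V →L[ℝ] V →L[ℝ] ℝ := ξ.smulRight η

omit [FiniteDimensional ℝ V] in
lemma tmul_apply (ξ η : V →L[ℝ] ℝ) (u v : V) : tmul ξ η u v = ξ u * η v := rfl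

lemma trace_tmul (B : V →L[ℝ] V →L[ℝ] ℝ) (ξ η : V →L[ℝ] ℝ) :
    trace B (tmul ξ η) = ξ (B.inverse η) := by
  have : ((B.inverse.comp (tmul ξ η) : V →L[ℝ] V) : V →ₗ[ℝ] V) =
      (ξ : V →ₗ[ℝ] ℝ).smulRight (B.inverse η) := by
    ext u
    change B.inverse (ξ u • η) = ξ u • B.inverse η
    rw [map_smul]
  rw [trace, this, LinearMap.trace_smulRight]
  rfl

lemma inverse_smul (B : V →L[ℝ] V →L[ℝ] ℝ) (h : ∀ u, u ≠ 0 → 0 < B u u) {c : ℝ} (hc : 0 < c)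
    (ξ : V →L[ℝ] ℝ) : (c • B).inverse ξ = c⁻¹ • B.inverse ξ := by
  refine eq_inverse_of_pos (fun u hu => mul_pos hc (h u hu)) fun v => ?_
  rw [map_smul, smul_apply, smul_apply,
    smul_apply, apply_inverse_of_pos h, smul_smul, inv_mul_cancel₀ hc.ne',
    one_smul]

lemma trace_smul_left (B b : V →L[ℝ] V →L[ℝ] ℝ) (h : ∀ u, u ≠ 0 → 0 < B u u) {c : ℝ}
    (hc : 0 < c) : trace (c • B) b = c⁻¹ * trace B b := by
  have : ((c • B).inverse.comp b : V →L[ℝ] V) = c⁻¹ • (B.inverse.comp b) := by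
    ext u; exact inverse_smul B h hc (b u)
  rw [trace, this, trace, ContinuousLinearMap.toLinearMap_smul, map_smul, smul_eq_mul]

namespace IsMetricOn

variable {G : V → V →L[ℝ] V →L[ℝ] ℝ} {U : Set V} (h : IsMetricOn G U) {ψ : V → ℝ}
include h

omit [FiniteDimensional ℝ V] in
/-- The conformally changed metric `e^{2ψ} G` is again a metric. -/
lemma conformal (hψ : ContDiffOn ℝ ∞ ψ U) :
    IsMetricOn (fun y => Real.exp (2 * ψ y) • G y) U where
  isOpen := h.isOpen
  smooth := (Real.contDiff_exp.comp_contDiffOn (contDiffOn_const.mul hψ)).smul h.smooth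
  symm y hy u v := by simp [h.symm y hy u v]
  pos y hy u hu := mul_pos (Real.exp_pos _) (h.pos y hy u hu)

omit [FiniteDimensional ℝ V] in
lemma conformal_fderiv (hψ : ContDiffOn ℝ ∞ ψ U) {x : V} (hx : x ∈ U) (z u v : V) :
    fderiv ℝ (fun y => Real.exp (2 * ψ y) • G y) x z u v =
      Real.exp (2 * ψ x) * (2 * fderiv ℝ ψ x z * G x u v + fderiv ℝ G x z u v) := by
  have h1 : DifferentiableAt ℝ ψ x :=
    (hψ.contDiffAt (h.isOpen.mem_nhds hx)).differentiableAt (by simp)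
  have h2 := ((h1.hasFDerivAt.const_mul 2).exp.smul (h.differentiableAt hx).hasFDerivAt).fderiv
  change fderiv ℝ ((fun y => Real.exp (2 * ψ y)) • G) x z u v = _
  rw [h2]
  simp only [add_apply, smul_apply, ContinuousLinearMap.smulRight_apply,
    smul_eq_mul]
  ring

/-- The Levi-Civita connection of `e^{2ψ} G`. -/
lemma conformal_christoffel (hψ : ContDiffOn ℝ ∞ ψ U) {x : V} (hx : x ∈ U) (u v : V) :
    christoffel (fun y => Real.exp (2 * ψ y) • G y) x u v =
      christoffel G x u v + fderiv ℝ ψ x u • v + fderiv ℝ ψ x v • u - G x u v • grad G ψ x := by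
  refine (h.conformal hψ).christoffel_eq hx (fun u v => christoffel G x u v +
    fderiv ℝ ψ x u • v + fderiv ℝ ψ x v • u - G x u v • grad G ψ x) ?_ ?_ u v
  · intro u v
    rw [h.christoffel_symm hx u v, h.symm x hx u v]
    abel
  · intro z u v
    rw [h.conformal_fderiv hψ hx, h.fderiv_eq hx]
    simp only [map_add, map_sub, map_smul, add_apply, sub_apply,
      smul_apply, smul_eq_mul, h.apply_grad hx, h.symm x hx _ (grad G ψ x)]
    rw [h.symm x hx u z]
    ring

/-- The Hessian with respect to `e^{2ψ} G`. -/
lemma conformal_hessian (hψ : ContDiffOn ℝ ∞ ψ U) (F : V → ℝ) {x : V} (hx : x ∈ U) :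
    hessian (fun y => Real.exp (2 * ψ y) • G y) F x = hessian G F x -
      (tmul (fderiv ℝ F x) (fderiv ℝ ψ x) + tmul (fderiv ℝ ψ x) (fderiv ℝ F x)) +
      fderiv ℝ F x (grad G ψ x) • G x := by
  ext u v
  simp only [hessian_apply, h.conformal_christoffel hψ hx, sub_apply, add_apply, tmul_apply,
    smul_apply, map_add, map_sub, map_smul, smul_eq_mul]
  ring

/-- The derivative of the connection of `e^{2ψ} G`. -/
lemma conformal_fderiv_christoffel (hψ : ContDiffOn ℝ ∞ ψ U) {x : V} (hx : x ∈ U) (u v w : V) :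
    fderiv ℝ (christoffel (fun y => Real.exp (2 * ψ y) • G y)) x u v w =
      fderiv ℝ (christoffel G) x u v w + fderiv ℝ (fderiv ℝ ψ) x u v • w +
        fderiv ℝ (fderiv ℝ ψ) x u w • v - fderiv ℝ G x u v w • grad G ψ x -
        G x v w • fderiv ℝ (grad G ψ) x u := by
  have hΓ := h.differentiableAt_christoffel hx
  have hdψ : DifferentiableAt ℝ (fderiv ℝ ψ) x :=
    ((hψ.fderiv_of_isOpen (m := ∞) h.isOpen (by simp)).contDiffAt
      (h.isOpen.mem_nhds hx)).differentiableAt (by simp)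
  have hP := h.differentiableAt_grad hψ hx
  have hG := h.differentiableAt hx
  rw [fderiv_bilin_apply ((h.conformal hψ).differentiableAt_christoffel hx)]
  have h1 : (fun y => christoffel (fun y => Real.exp (2 * ψ y) • G y) y v w) =ᶠ[𝓝 x]
      fun y => christoffel G y v w + fderiv ℝ ψ y v • w + fderiv ℝ ψ y w • v -
        G y v w • grad G ψ y := by
    filter_upwards [h.isOpen.mem_nhds hx] with y hy using h.conformal_christoffel hψ hy v w
  rw [h1.fderiv_eq]
  have e1 : HasFDerivAt (fun y => christoffel G y v w)
      (fderiv ℝ (fun y => christoffel G y v w) x) x :=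
    ((hΓ.clm_apply (differentiableAt_const v)).clm_apply (differentiableAt_const w)).hasFDerivAt
  have e2 : ∀ v, HasFDerivAt (fun y => fderiv ℝ ψ y v) (fderiv ℝ (fun y => fderiv ℝ ψ y v) x) x :=
    fun v => (hdψ.clm_apply (differentiableAt_const v)).hasFDerivAt
  have e3 : HasFDerivAt (fun y => G y v w) (fderiv ℝ (fun y => G y v w) x) x :=
    ((hG.clm_apply (differentiableAt_const v)).clm_apply (differentiableAt_const w)).hasFDerivAt
  have e4 := ((e1.add ((e2 v).smul_const w)).add ((e2 w).smul_const v)).sub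
    (e3.smul hP.hasFDerivAt)
  have e5 : fderiv ℝ (fun y => christoffel G y v w + fderiv ℝ ψ y v • w + fderiv ℝ ψ y w • v -
        G y v w • grad G ψ y) x = _ := e4.fderiv
  rw [e5]
  simp only [add_apply, sub_apply, smul_apply,
    ContinuousLinearMap.smulRight_apply, fderiv_bilin_apply hΓ, fderiv_lin_apply hdψ,
    fderiv_bilin_apply hG]
  abel

/-- The curvature of `e^{2ψ} G`, in terms of the form
`L = ∇dψ - dψ ⊗ dψ + ½ |∇ψ|² G`. -/
lemma conformal_curvature (hψ : ContDiffOn ℝ ∞ ψ U) {x : V} (hx : x ∈ U)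
    {L : V →L[ℝ] V →L[ℝ] ℝ} (hL : L = hessian G ψ x - tmul (fderiv ℝ ψ x) (fderiv ℝ ψ x) +
      (1 / 2 * fderiv ℝ ψ x (grad G ψ x)) • G x) (u v w : V) :
    curvature (fun y => Real.exp (2 * ψ y) • G y) x v w u =
      curvature G x v w u - L v w • u + L u w • v - G x v w • (G x).inverse (L u) +
        G x u w • (G x).inverse (L v) := by
  have hi : ∀ u, (G x).inverse (L u) = (G x).inverse (hessian G ψ x u) -
      fderiv ℝ ψ x u • grad G ψ x + (1 / 2 * fderiv ℝ ψ x (grad G ψ x)) • u := by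
    intro u
    have : L u = hessian G ψ x u - fderiv ℝ ψ x u • fderiv ℝ ψ x +
        (1 / 2 * fderiv ℝ ψ x (grad G ψ x)) • G x u := by rw [hL]; rfl
    rw [this, map_add, map_sub, map_smul, map_smul, inverse_apply_of_pos (h.pos x hx)]
    rfl
  have hA := fderiv_fderiv_symm (hψ.contDiffAt (h.isOpen.mem_nhds hx)) u v
  rw [hi, hi, hL, curvature_apply, curvature_apply]
  simp only [h.conformal_fderiv_christoffel hψ hx, h.conformal_christoffel hψ hx,
    h.fderiv_grad hψ hx, h.fderiv_eq hx, map_add, map_sub, map_smul, add_apply, sub_apply,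
    smul_apply, smul_eq_mul, hessian_apply, tmul_apply, h.apply_grad hx,
    h.symm x hx _ (grad G ψ x)]
  rw [hA, h.christoffel_symm hx v u, h.symm x hx v u]
  simp only [h.symm x hx _ (christoffel G x _ _)]
  module

/-- The Ricci tensor of `e^{2ψ} G`. -/
lemma conformal_ricci (hψ : ContDiffOn ℝ ∞ ψ U) {x : V} (hx : x ∈ U) :
    ricci (fun y => Real.exp (2 * ψ y) • G y) x = ricci G x -
      ((Module.finrank ℝ V : ℝ) - 2) • (hessian G ψ x - tmul (fderiv ℝ ψ x) (fderiv ℝ ψ x)) -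
      (trace (G x) (hessian G ψ x) +
        ((Module.finrank ℝ V : ℝ) - 2) * fderiv ℝ ψ x (grad G ψ x)) • G x := by
  set L : V →L[ℝ] V →L[ℝ] ℝ := hessian G ψ x - tmul (fderiv ℝ ψ x) (fderiv ℝ ψ x) +
      (1 / 2 * fderiv ℝ ψ x (grad G ψ x)) • G x with hL
  have hLs : ∀ u v, L u v = L v u := by
    intro u v
    simp only [hL, add_apply, sub_apply, smul_apply, tmul_apply, smul_eq_mul]
    rw [h.hessian_symm hx (hψ.contDiffAt (h.isOpen.mem_nhds hx)) u v, h.symm x hx u v]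
    ring
  have htr : trace (G x) L = trace (G x) (hessian G ψ x) - fderiv ℝ ψ x (grad G ψ x) +
      1 / 2 * fderiv ℝ ψ x (grad G ψ x) * Module.finrank ℝ V := by
    have : L = hessian G ψ x + (-1 : ℝ) • tmul (fderiv ℝ ψ x) (fderiv ℝ ψ x) +
      (1 / 2 * fderiv ℝ ψ x (grad G ψ x)) • G x := by rw [hL]; module
    rw [this, trace_add, trace_add, trace_smul, trace_smul, trace_tmul, trace_self (h.pos x hx)]
    simp only [grad]
    ring
  ext v w
  have hc : (curvature (fun y => Real.exp (2 * ψ y) • G y) x v w : V →ₗ[ℝ] V) =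
      (curvature G x v w : V →ₗ[ℝ] V) - L v w • LinearMap.id +
      ((L w : V →L[ℝ] ℝ) : V →ₗ[ℝ] ℝ).smulRight v -
      G x v w • (((G x).inverse.comp L : V →L[ℝ] V) : V →ₗ[ℝ] V) +
      ((G x w : V →L[ℝ] ℝ) : V →ₗ[ℝ] ℝ).smulRight ((G x).inverse (L v)) := by
    ext u
    have := h.conformal_curvature hψ hx hL u v w
    rw [hLs u w, h.symm x hx u w] at this
    exact this
  rw [ricci_apply, hc]
  simp only [map_add, map_sub, map_smul, LinearMap.trace_smulRight, LinearMap.trace_id,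
    smul_eq_mul, ContinuousLinearMap.coe_coe]
  have h1 : G x w ((G x).inverse (L v)) = L v w := by
    rw [h.symm x hx, apply_inverse_of_pos (h.pos x hx)]
  rw [h1, hLs w v, ← trace, htr, ← ricci_apply]
  simp only [hL, add_apply, sub_apply, smul_apply, tmul_apply, smul_eq_mul]
  ring

end IsMetricOn
end Coord

/-! ### From the manifold to a chart -/

namespace Riem

variable {V : Type*} [NormedAddCommGroup V] [NormedSpace ℝ V]
  {M : Type*} [TopologicalSpace M] [ChartedSpace V M] [IsManifold 𝓘(ℝ, V) ∞ M]

/-- The facts about the tangent bundle ask for a manifold of class `C^1`. -/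
instance isManifold_one : IsManifold 𝓘(ℝ, V) 1 M := IsManifold.of_le (n := ∞) (by simp)

/-- The differential at `y` of the inverse of the chart at `p`. -/
def frame (p : M) (y : V) : V →L[ℝ] V := mfderiv 𝓘(ℝ, V) 𝓘(ℝ, V) (chartAt V p).symm y

lemma frame_eq {p : M} {y : V} (hy : y ∈ (chartAt V p).target) :
    frame p y =
      (trivializationAt V (TangentSpace 𝓘(ℝ, V) : M → Type _) p).symmL ℝ ((chartAt V p).symm y) := by
  have := TangentBundle.symmL_trivializationAt (I := 𝓘(ℝ, V)) (x₀ := p)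
    ((chartAt V p).map_target hy)
  rw [this]
  have h2 : extChartAt 𝓘(ℝ, V) p ((chartAt V p).symm y) = y := by
    simpa using (chartAt V p).right_inv hy
  rw [h2]
  simp [frame]
  rfl

/-- Tangent vectors at `p` are identified with vectors of `V` by the chart at `p`. -/
lemma frame_self (p : M) : frame p (chartAt V p p) = ContinuousLinearMap.id ℝ V := by
  rw [frame_eq (mem_chart_target V p)]
  have h := (chartAt V p).left_inv (mem_chart_source V p)
  have := TangentBundle.symmL_trivializationAt_eq_core (I := 𝓘(ℝ, V)) (mem_chart_source V p)
  rw [h, this]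
  ext v
  exact (tangentBundleCore 𝓘(ℝ, V) M).coordChange_self _ _ (mem_chart_source V p) _

lemma inChart_apply (g : Metric V M) (p : M) (y u v : V) :
    inChart g p y u v = g.inner ((chartAt V p).symm y) (frame p y u) (frame p y v) := rfl

lemma inChart_self (g : Metric V M) (p : M) : inChart g p (chartAt V p p) = g.inner p := by
  have h : ∀ u v : V, inChart g p (chartAt V p p) u v = g.inner p u v := by
    intro u v
    rw [inChart_apply, frame_self]
    have := (chartAt V p).left_inv (mem_chart_source V p)
    rw [this]; rfl
  exact ContinuousLinearMap.ext fun u => ContinuousLinearMap.ext fun v => h u v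

/-- A field of bilinear forms on the tangent spaces, read in the chart at `p`. -/
def bilinInChart (b : ∀ q : M, Bilin V q) (p : M) (y : V) : V →L[ℝ] V →L[ℝ] ℝ :=
  ContinuousLinearMap.bilinearComp (E := V) (F := V) (b ((chartAt V p).symm y))
    (frame p y) (frame p y)

/-- The bundle of bilinear forms is trivialized by reading the forms in the chart. -/
lemma trivializationAt_bilin (b : ∀ q : M, Bilin V q) {p q : M} (hq : q ∈ (chartAt V p).source) :
    (trivializationAt (V →L[ℝ] V →L[ℝ] ℝ) (fun q : M => TangentSpace 𝓘(ℝ, V) q →L[ℝ]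
      TangentSpace 𝓘(ℝ, V) q →L[ℝ] ℝ) p ⟨q, b q⟩).2 = bilinInChart b p (chartAt V p q) := by
  have hf := frame_eq ((chartAt V p).map_source hq)
  rw [(chartAt V p).left_inv hq] at hf
  ext u v
  have hl := (chartAt V p).left_inv hq
  simp only [hom_trivializationAt_apply, ContinuousLinearMap.inCoordinates]
  unfold bilinInChart
  rw [hl, hf]
  have hmem : q ∈ (trivializationAt (V →L[ℝ] ℝ)
      (fun x : M => TangentSpace 𝓘(ℝ, V) x →L[ℝ] ℝ) p).baseSet := by
    rw [hom_trivializationAt_baseSet]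
    exact ⟨by simpa using hq, by simp⟩
  simp only [ContinuousLinearMap.comp_apply, Bundle.Trivialization.continuousLinearMapAt_apply,
    Bundle.Trivialization.coe_linearMapAt_of_mem _ hmem, hom_trivializationAt_apply,
    ContinuousLinearMap.inCoordinates]
  simp
  rfl

lemma contMDiffOn_comp_chartAt_iff {F : Type*} [NormedAddCommGroup F] [NormedSpace ℝ F] (p : M)
    (f : V → F) : ContMDiffOn 𝓘(ℝ, V) 𝓘(ℝ, F) ∞ (fun q => f (chartAt V p q)) (chartAt V p).source ↔
      ContDiffOn ℝ ∞ f (chartAt V p).target := by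
  rw [← contMDiffOn_iff_contDiffOn]
  constructor
  · intro h
    refine (h.comp (contMDiffOn_chart_symm (x := p)) fun y hy => (chartAt V p).map_target hy).congr
      fun y hy => ?_
    simp [(chartAt V p).right_inv hy]
  · intro h
    exact h.comp (contMDiffOn_chart (x := p)) fun y hy => (chartAt V p).map_source hy

/-- A field of bilinear forms is a smooth section if and only if it is smooth in the charts. -/
lemma contMDiff_bilin_iff (b : ∀ q : M, Bilin V q) :
    ContMDiff 𝓘(ℝ, V) (𝓘(ℝ, V).prod 𝓘(ℝ, V →L[ℝ] V →L[ℝ] ℝ)) ∞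
      (fun q => (⟨q, b q⟩ : Bundle.TotalSpace (V →L[ℝ] V →L[ℝ] ℝ)
        (fun q : M => TangentSpace 𝓘(ℝ, V) q →L[ℝ] TangentSpace 𝓘(ℝ, V) q →L[ℝ] ℝ))) ↔
    ∀ p : M, ContDiffOn ℝ ∞ (bilinInChart b p) (chartAt V p).target := by
  have : ContMDiffVectorBundle ∞ V (TangentSpace 𝓘(ℝ, V) : M → Type _) 𝓘(ℝ, V) :=
    have : IsManifold 𝓘(ℝ, V) (∞ + 1) M := ‹IsManifold 𝓘(ℝ, V) ∞ M›
    TangentBundle.contMDiffVectorBundle (n := ∞)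
  have key : ∀ p : M, (ContMDiffOn 𝓘(ℝ, V) (𝓘(ℝ, V).prod 𝓘(ℝ, V →L[ℝ] V →L[ℝ] ℝ)) ∞
      (fun q => (⟨q, b q⟩ : Bundle.TotalSpace (V →L[ℝ] V →L[ℝ] ℝ)
        (fun q : M => TangentSpace 𝓘(ℝ, V) q →L[ℝ] TangentSpace 𝓘(ℝ, V) q →L[ℝ] ℝ)))
        (chartAt V p).source ↔ ContDiffOn ℝ ∞ (bilinInChart b p) (chartAt V p).target) := by
    intro p
    have h1 := (trivializationAt (V →L[ℝ] V →L[ℝ] ℝ) (fun q : M => TangentSpace 𝓘(ℝ, V) q →L[ℝ]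
      TangentSpace 𝓘(ℝ, V) q →L[ℝ] ℝ) p).contMDiffOn_section_baseSet_iff (IB := 𝓘(ℝ, V)) (n := ∞)
      (s := b)
    have hb : (trivializationAt (V →L[ℝ] V →L[ℝ] ℝ) (fun q : M => TangentSpace 𝓘(ℝ, V) q →L[ℝ]
      TangentSpace 𝓘(ℝ, V) q →L[ℝ] ℝ) p).baseSet = (chartAt V p).source := by
      simp [hom_trivializationAt_baseSet]
    rw [hb] at h1
    rw [h1, ← contMDiffOn_comp_chartAt_iff p (bilinInChart b p)]
    exact contMDiffOn_congr fun q hq => trivializationAt_bilin b hq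
  constructor
  · exact fun h p => (key p).1 h.contMDiffOn
  · intro h q
    exact ((key q).2 (h q)).contMDiffAt ((chartAt V q).open_source.mem_nhds (mem_chart_source V q))

lemma contDiffOn_comp_symm {F : Type*} [NormedAddCommGroup F] [NormedSpace ℝ F] {f : M → F}
    (hf : ContMDiff 𝓘(ℝ, V) 𝓘(ℝ, F) ∞ f) (p : M) :
    ContDiffOn ℝ ∞ (f ∘ (chartAt V p).symm) (chartAt V p).target := by
  rw [← contMDiffOn_iff_contDiffOn]
  exact hf.comp_contMDiffOn (contMDiffOn_chart_symm (x := p))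

lemma frame_injective {p : M} {y : V} (hy : y ∈ (chartAt V p).target) : Injective (frame p y) := by
  have hq : (chartAt V p).symm y ∈
      (trivializationAt V (TangentSpace 𝓘(ℝ, V) : M → Type _) p).baseSet := by
    simpa using (chartAt V p).map_target hy
  rw [frame_eq hy]
  intro u v huv
  have h := congrArg ((trivializationAt V (TangentSpace 𝓘(ℝ, V) : M → Type _) p).continuousLinearMapAt
    ℝ ((chartAt V p).symm y)) huv
  have e := fun u : V => Bundle.Trivialization.continuousLinearMapAt_symmL (R := ℝ)
    (trivializationAt V (TangentSpace 𝓘(ℝ, V) : M → Type _) p) hq u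
  exact (e u).symm.trans (h.trans (e v))

lemma isMetricOn_inChart (g : Metric V M) (p : M) :
    Coord.IsMetricOn (inChart g p) (chartAt V p).target where
  isOpen := (chartAt V p).open_target
  smooth := (contMDiff_bilin_iff g.inner).1 g.contMDiff p
  symm y _ u v := by
    rw [inChart_apply, inChart_apply]
    exact g.symm _ _ _
  pos y hy u hu := by
    rw [inChart_apply]
    exact g.pos _ _ fun h => hu (frame_injective hy (h.trans (map_zero (frame p y)).symm))

/-- The unit ball of a positive definite form is bounded, since the form has a positive minimum on
the unit sphere. -/
lemma isVonNBounded_of_pos [FiniteDimensional ℝ V] (B : V →L[ℝ] V →L[ℝ] ℝ)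
    (h : ∀ u, u ≠ 0 → 0 < B u u) : Bornology.IsVonNBounded ℝ {u | B u u < 1} := by
  rw [NormedSpace.isVonNBounded_iff]
  have : ProperSpace V := FiniteDimensional.proper ℝ V
  rcases (Metric.sphere (0 : V) 1).eq_empty_or_nonempty with he | hne
  · refine (Bornology.IsBounded.subset (Bornology.isBounded_singleton (x := (0 : V)))) fun u _ => ?_
    by_contra hu
    have hu : u ≠ 0 := hu
    have : ‖u‖⁻¹ • u ∈ Metric.sphere (0 : V) 1 := by
      simp [norm_smul, inv_mul_cancel₀ (norm_ne_zero_iff.2 hu)]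
    rw [he] at this
    exact this
  · obtain ⟨w, hw, hmin⟩ := (isCompact_sphere (0 : V) 1).exists_isMinOn hne
      (f := fun u => B u u) (by fun_prop)
    have hw0 : w ≠ 0 := by rintro rfl; simp at hw
    have hc := h w hw0
    refine isBounded_iff_forall_norm_le.2 ⟨1 + (B w w)⁻¹, fun u hu => ?_⟩
    have hu : B u u < 1 := hu
    by_cases hu0 : u = 0
    · rw [hu0, norm_zero]; positivity
    have hn : 0 < ‖u‖ := norm_pos_iff.2 hu0
    have h1 : ‖u‖⁻¹ • u ∈ Metric.sphere (0 : V) 1 := by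
      simp [norm_smul, inv_mul_cancel₀ (norm_ne_zero_iff.2 hu0)]
    have h2 : B w w ≤ B (‖u‖⁻¹ • u) (‖u‖⁻¹ • u) := hmin h1
    simp only [map_smul, smul_apply, smul_eq_mul] at h2
    have h3 : B w w * ‖u‖ ^ 2 ≤ B u u := by
      have := mul_le_mul_of_nonneg_right h2 (sq_nonneg ‖u‖)
      field_simp at this
      linarith
    by_contra! hlt
    have h4 : 1 ≤ ‖u‖ := by
      have : 0 < (B w w)⁻¹ := inv_pos.2 hc
      linarith
    have h5 : 1 < B w w * ‖u‖ := by
      have h6 : (B w w)⁻¹ < ‖u‖ := by linarith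
      have := mul_lt_mul_of_pos_left h6 hc
      rwa [mul_inv_cancel₀ hc.ne'] at this
    nlinarith

/-- The Riemannian metric given by positive definite symmetric forms on the tangent spaces which are
smooth when read in the charts. -/
def mkMetric [FiniteDimensional ℝ V] (b : ∀ q : M, Bilin V q) (hs : ∀ q u v, b q u v = b q v u)
    (hp : ∀ q u, u ≠ 0 → 0 < b q u u)
    (hb : ∀ p : M, ContDiffOn ℝ ∞ (bilinInChart b p) (chartAt V p).target) : Metric V M where
  inner := b
  symm := hs
  pos := hp
  isVonNBounded q := isVonNBounded_of_pos (V := V) (b q) (hp q)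
  contMDiff := (contMDiff_bilin_iff b).2 hb

omit [IsManifold 𝓘(ℝ, V) ∞ M] in
lemma mfderiv_eq {f : M → ℝ} (hf : ContMDiff 𝓘(ℝ, V) 𝓘(ℝ, ℝ) ∞ f) (p : M) :
    (mfderiv 𝓘(ℝ, V) 𝓘(ℝ, ℝ) f p : V →L[ℝ] ℝ) =
      fderiv ℝ (f ∘ (chartAt V p).symm) (chartAt V p p) := by
  have h : MDifferentiableAt 𝓘(ℝ, V) 𝓘(ℝ, ℝ) f p := hf.mdifferentiableAt (by simp)
  simp [mfderiv, h, writtenInExtChartAt]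
  rfl

lemma grad_eq (g : Metric V M) {f : M → ℝ} (hf : ContMDiff 𝓘(ℝ, V) 𝓘(ℝ, ℝ) ∞ f) (p : M) :
    (grad g f p : V) = Coord.grad (inChart g p) (f ∘ (chartAt V p).symm) (chartAt V p p) := by
  rw [Coord.grad, inChart_self, ← mfderiv_eq hf]
  rfl

variable [FiniteDimensional ℝ V]

omit [FiniteDimensional ℝ V] in
lemma trace_eq (g : Metric V M) (p : M) (b : Bilin V p) :
    trace g p b = Coord.trace (V := V) (g.inner p) b := rfl

lemma gradSq_eq (g : Metric V M) {f : M → ℝ} (hf : ContMDiff 𝓘(ℝ, V) 𝓘(ℝ, ℝ) ∞ f) (p : M) :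
    gradSq g f p = fderiv ℝ (f ∘ (chartAt V p).symm) (chartAt V p p)
      (Coord.grad (inChart g p) (f ∘ (chartAt V p).symm) (chartAt V p p)) := by
  rw [← (isMetricOn_inChart g p).apply_grad (mem_chart_target V p), inChart_self, gradSq,
    grad_eq g hf]
  rfl

/-- The gradient, read in a chart. -/
lemma frame_grad (g : Metric V M) {f : M → ℝ} (hf : ContMDiff 𝓘(ℝ, V) 𝓘(ℝ, ℝ) ∞ f) (p : M)
    {y : V} (hy : y ∈ (chartAt V p).target) :
    frame p y (Coord.grad (inChart g p) (f ∘ (chartAt V p).symm) y) =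
      grad g f ((chartAt V p).symm y) := by
  set q := (chartAt V p).symm y with hq
  refine (Coord.eq_inverse_of_pos (V := V) (B := g.inner q) (g.pos q) fun v => ?_).symm
  obtain ⟨v, rfl⟩ := (LinearMap.injective_iff_surjective (f := (frame p y : V →ₗ[ℝ] V))).1
    (frame_injective hy) v
  have h1 := (isMetricOn_inChart g p).apply_grad (F := f ∘ (chartAt V p).symm) hy v
  rw [inChart_apply] at h1
  refine h1.trans ?_
  have h2 : MDifferentiableAt 𝓘(ℝ, V) 𝓘(ℝ, V) (chartAt V p).symm y :=
    mdifferentiableAt_atlas_symm (ChartedSpace.chart_mem_atlas p) hy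
  have h3 : MDifferentiableAt 𝓘(ℝ, V) 𝓘(ℝ, ℝ) f ((chartAt V p).symm y) :=
    hf.mdifferentiableAt (by simp)
  rw [← mfderiv_eq_fderiv, mfderiv_comp y h3 h2]
  rfl

/-- The gradient of a smooth function is a smooth vector field. -/
lemma contMDiff_grad (g : Metric V M) {f : M → ℝ} (hf : ContMDiff 𝓘(ℝ, V) 𝓘(ℝ, ℝ) ∞ f) :
    ContMDiff 𝓘(ℝ, V) 𝓘(ℝ, V).tangent ∞
      (fun p => (⟨p, grad g f p⟩ : TangentBundle 𝓘(ℝ, V) M)) := by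
  have : ContMDiffVectorBundle ∞ V (TangentSpace 𝓘(ℝ, V) : M → Type _) 𝓘(ℝ, V) :=
    have : IsManifold 𝓘(ℝ, V) (∞ + 1) M := ‹IsManifold 𝓘(ℝ, V) ∞ M›
    TangentBundle.contMDiffVectorBundle (n := ∞)
  intro p
  have hb : (trivializationAt V (TangentSpace 𝓘(ℝ, V) : M → Type _) p).baseSet =
      (chartAt V p).source := by simp
  have h1 := (trivializationAt V (TangentSpace 𝓘(ℝ, V) : M → Type _)
    p).contMDiffOn_section_baseSet_iff (IB := 𝓘(ℝ, V)) (n := ∞) (s := grad g f)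
  rw [hb] at h1
  refine (h1.2 ?_).contMDiffAt ((chartAt V p).open_source.mem_nhds (mem_chart_source V p))
  have h2 := (contMDiffOn_comp_chartAt_iff p _).2
    ((isMetricOn_inChart g p).contDiffOn_grad (contDiffOn_comp_symm hf p))
  refine h2.congr fun q hq => ?_
  have h3 := frame_grad g hf p ((chartAt V p).map_source hq)
  rw [frame_eq ((chartAt V p).map_source hq), (chartAt V p).left_inv hq] at h3
  rw [← h3]
  have h4 := Bundle.Trivialization.continuousLinearMapAt_symmL (R := ℝ)
    (trivializationAt V (TangentSpace 𝓘(ℝ, V) : M → Type _) p) (b := q) (by simpa using hq)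
    (Coord.grad (inChart g p) (f ∘ (chartAt V p).symm) (chartAt V p q))
  rw [Bundle.Trivialization.continuousLinearMapAt_apply,
    Bundle.Trivialization.coe_linearMapAt_of_mem _ (by simpa using hq)] at h4
  exact h4

/-- `£_{∇f} g = 2 ∇df`. -/
lemma lieDeriv_grad (g : Metric V M) {f : M → ℝ} (hf : ContMDiff 𝓘(ℝ, V) 𝓘(ℝ, ℝ) ∞ f) (p : M)
    (u v : TangentSpace 𝓘(ℝ, V) p) :
    lieDeriv g (grad g f) p u v = 2 * hessian g f p u v := by
  have hx := mem_chart_target V p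
  have h1 : VectorField.mpullback 𝓘(ℝ, V) 𝓘(ℝ, V) (chartAt V p).symm (grad g f) =ᶠ[𝓝 (chartAt V p p)]
      Coord.grad (inChart g p) (f ∘ (chartAt V p).symm) := by
    filter_upwards [(chartAt V p).open_target.mem_nhds hx] with y hy
    have hbij : Bijective (frame p y : V →ₗ[ℝ] V) :=
      ⟨frame_injective hy, (LinearMap.injective_iff_surjective).1 (frame_injective hy)⟩
    have he : frame p y =
        (LinearEquiv.ofBijective _ hbij).toContinuousLinearEquiv := rfl
    rw [VectorField.mpullback_apply, ← frame_grad g hf p hy]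
    change (frame p y).inverse (frame p y _) = _
    rw [he, ContinuousLinearMap.inverse_equiv]
    exact (LinearEquiv.ofBijective _ hbij).symm_apply_apply _
  have h2 := (isMetricOn_inChart g p).lieDeriv_grad (contDiffOn_comp_symm hf p) hx u v
  exact (Coord.lieDeriv_congr (V := V) (inChart g p) h1 u v).trans h2

omit [FiniteDimensional ℝ V] in
lemma hessian_const_mul (g : Metric V M) {f : M → ℝ} (hf : ContMDiff 𝓘(ℝ, V) 𝓘(ℝ, ℝ) ∞ f) (c : ℝ)
    (p : M) : hessian g (fun q => c * f q) p = c • hessian g f p := by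
  have hx := mem_chart_target V p
  have hF := contDiffOn_comp_symm hf p
  have h1 : fderiv ℝ ((fun q => c * f q) ∘ (chartAt V p).symm) =ᶠ[𝓝 (chartAt V p p)]
      fun y => c • fderiv ℝ (f ∘ (chartAt V p).symm) y := by
    filter_upwards [(chartAt V p).open_target.mem_nhds hx] with y hy
    exact (((hF.contDiffAt ((chartAt V p).open_target.mem_nhds hy)).differentiableAt
      (by simp)).hasFDerivAt.const_mul c).fderiv
  have hd : DifferentiableAt ℝ (fderiv ℝ (f ∘ (chartAt V p).symm)) (chartAt V p p) :=
    ((hF.fderiv_of_isOpen (m := ∞) (chartAt V p).open_target (by simp)).contDiffAt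
      ((chartAt V p).open_target.mem_nhds hx)).differentiableAt (by simp)
  have h2 : ∀ u v : V, Coord.hessian (inChart g p) ((fun q => c * f q) ∘ (chartAt V p).symm)
      (chartAt V p p) u v =
      c * Coord.hessian (inChart g p) (f ∘ (chartAt V p).symm) (chartAt V p p) u v := by
    intro u v
    rw [Coord.hessian_apply, Coord.hessian_apply, h1.fderiv_eq, h1.eq_of_nhds,
      fderiv_fun_const_smul hd c]
    simp only [smul_apply, smul_eq_mul]
    ring
  exact ContinuousLinearMap.ext fun u => ContinuousLinearMap.ext fun v => h2 u v

end Riem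

/-! ### Functions of one variable on `[0, T]` -/

lemma contDiffOn_dot {T : ℝ} (hT : 0 < T) {h : ℝ → ℝ} (hh : ContDiffOn ℝ ∞ h (Icc 0 T)) :
    ContDiffOn ℝ ∞ (dot T h) (Icc 0 T) :=
  hh.derivWithin (uniqueDiffOn_Icc hT) (by simp)

lemma hasDerivWithinAt_dot {T : ℝ} {h : ℝ → ℝ} (hh : ContDiffOn ℝ ∞ h (Icc 0 T)) {t : ℝ}
    (ht : t ∈ Icc 0 T) : HasDerivWithinAt h (dot T h t) (Icc 0 T) t :=
  ((hh t ht).differentiableWithinAt (by simp)).hasDerivWithinAt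

lemma dot_eq {T : ℝ} (hT : 0 < T) {h : ℝ → ℝ} {t d : ℝ} (ht : t ∈ Icc 0 T)
    (hd : HasDerivWithinAt h d (Icc 0 T) t) : dot T h t = d :=
  hd.derivWithin (uniqueDiffOn_Icc hT t ht)

lemma dot_congr {T : ℝ} {h h' : ℝ → ℝ} {t : ℝ} (ht : t ∈ Icc 0 T)
    (he : ∀ s ∈ Icc 0 T, h s = h' s) : dot T h t = dot T h' t :=
  derivWithin_congr he (he t ht)

namespace Coord

variable {V : Type*} [NormedAddCommGroup V] [NormedSpace ℝ V]

section Comp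

variable {U : Set V} {τ : V → ℝ} {T : ℝ} {h : ℝ → ℝ}

/-- The chain rule for a function `h` which is smooth only on `[0, T]`: one-sided derivatives
suffice, since `τ` takes values in `[0, T]` on an open set. -/
lemma fderiv_comp_of_mapsTo (hU : IsOpen U) (hτ : ContDiffOn ℝ ∞ τ U) (hm : ∀ y ∈ U, τ y ∈ Icc 0 T)
    (hh : ContDiffOn ℝ ∞ h (Icc 0 T)) {y : V} (hy : y ∈ U) :
    fderiv ℝ (fun y => h (τ y)) y = dot T h (τ y) • fderiv ℝ τ y := by
  have h1 : HasFDerivAt τ (fderiv ℝ τ y) y :=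
    ((hτ.contDiffAt (hU.mem_nhds hy)).differentiableAt (by simp)).hasFDerivAt
  have h2 := (hasDerivWithinAt_dot hh (hm y hy)).comp_hasFDerivWithinAt y
    (h1.hasFDerivWithinAt (s := U)) hm
  exact (h2.hasFDerivAt (hU.mem_nhds hy)).fderiv

lemma grad_comp (G : V → V →L[ℝ] V →L[ℝ] ℝ) (hU : IsOpen U) (hτ : ContDiffOn ℝ ∞ τ U)
    (hm : ∀ y ∈ U, τ y ∈ Icc 0 T)
    (hh : ContDiffOn ℝ ∞ h (Icc 0 T)) {y : V} (hy : y ∈ U) :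
    grad G (fun y => h (τ y)) y = dot T h (τ y) • grad G τ y := by
  rw [grad, fderiv_comp_of_mapsTo hU hτ hm hh hy, map_smul]; rfl

/-- `∇d(h ∘ τ) = h' ∇dτ + h'' dτ ⊗ dτ`. -/
lemma hessian_comp (G : V → V →L[ℝ] V →L[ℝ] ℝ) (hT : 0 < T) (hU : IsOpen U)
    (hτ : ContDiffOn ℝ ∞ τ U) (hm : ∀ y ∈ U, τ y ∈ Icc 0 T)
    (hh : ContDiffOn ℝ ∞ h (Icc 0 T)) {y : V} (hy : y ∈ U) :
    hessian G (fun y => h (τ y)) y = dot T h (τ y) • hessian G τ y +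
      dot T (dot T h) (τ y) • tmul (fderiv ℝ τ y) (fderiv ℝ τ y) := by
  have h1 : fderiv ℝ (fun y => h (τ y)) =ᶠ[𝓝 y] fun y => dot T h (τ y) • fderiv ℝ τ y := by
    filter_upwards [hU.mem_nhds hy] with z hz using fderiv_comp_of_mapsTo hU hτ hm hh hz
  have h2 : DifferentiableAt ℝ (fderiv ℝ τ) y :=
    ((hτ.fderiv_of_isOpen (m := ∞) hU (by simp)).contDiffAt (hU.mem_nhds hy)).differentiableAt
      (by simp)
  have hd := contDiffOn_dot hT hh
  have h3 : DifferentiableAt ℝ (fun y => dot T h (τ y)) y :=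
    (((hd.comp hτ hm).contDiffAt (hU.mem_nhds hy)).differentiableAt (by simp) :)
  have h4 : fderiv ℝ (fun y => dot T h (τ y) • fderiv ℝ τ y) y = _ :=
    (h3.hasFDerivAt.smul h2.hasFDerivAt).fderiv
  ext u v
  rw [hessian_apply, h1.fderiv_eq, h1.eq_of_nhds, h4,
    fderiv_comp_of_mapsTo hU hτ hm hd hy]
  simp only [add_apply, smul_apply, ContinuousLinearMap.smulRight_apply, smul_eq_mul,
    hessian_apply, tmul_apply]
  ring

end Comp

end Coord

/-! ### The soliton equations for the conformally changed metric -/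

namespace Riem

variable {V : Type*} [NormedAddCommGroup V] [NormedSpace ℝ V] [FiniteDimensional ℝ V]
  {M : Type*} [TopologicalSpace M] [ChartedSpace V M] [IsManifold 𝓘(ℝ, V) ∞ M]

omit [FiniteDimensional ℝ V] [IsManifold 𝓘(ℝ, V) ∞ M] in
lemma contMDiff_comp {T : ℝ} {t : M → ℝ} (ht : ContMDiff 𝓘(ℝ, V) 𝓘(ℝ, ℝ) ∞ t)
    (hm : ∀ p, t p ∈ Icc 0 T) {h : ℝ → ℝ} (hh : ContDiffOn ℝ ∞ h (Icc 0 T)) :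
    ContMDiff 𝓘(ℝ, V) 𝓘(ℝ, ℝ) ∞ (fun p => h (t p)) :=
  (contMDiffOn_iff_contDiffOn.2 hh).comp_contMDiff ht hm

/-- The metric `e^{2ψ} g`. -/
def conformalMetric (g : Metric V M) (ψ : M → ℝ) (hψ : ContMDiff 𝓘(ℝ, V) 𝓘(ℝ, ℝ) ∞ ψ) :
    Metric V M :=
  mkMetric (fun p => Real.exp (2 * ψ p) • g.inner p)
    (fun q u v => congrArg (Real.exp (2 * ψ q) * ·) (g.symm q u v))
    (fun q u hu => mul_pos (Real.exp_pos _) (g.pos q u hu))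
    (fun p => ((isMetricOn_inChart g p).conformal (contDiffOn_comp_symm hψ p)).smooth)

section Soliton

variable {m k : ℕ} {T : ℝ} {x y φ : ℝ → ℝ}

/-- The function `ψ = -(x - y + t) / 2` of `t`, so that `e^{2ψ} = σ⁻²` for `σ = e^{(x - y + t)/2}`.
-/
def confExp (x y : ℝ → ℝ) (t : ℝ) : ℝ := -(x t - y t + t) / 2

lemma exp_two_mul_confExp (t : ℝ) :
    Real.exp (2 * confExp x y t) = (Real.exp ((x t - y t + t) / 2) ^ 2)⁻¹ := by
  rw [← Real.exp_nat_mul, ← Real.exp_neg]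
  congr 1
  simp only [confExp]
  push_cast
  ring

lemma contDiffOn_confExp (hsol : IsSolution m k T x y φ) :
    ContDiffOn ℝ ∞ (confExp x y) (Icc 0 T) :=
  (((hsol.smooth_x.sub hsol.smooth_y).add contDiffOn_id).neg).div_const 2

lemma dot_confExp (hT : 0 < T) (hsol : IsSolution m k T x y φ) {t : ℝ} (ht : t ∈ Icc 0 T) :
    dot T (confExp x y) t = -(dot T x t - dot T y t + 1) / 2 :=
  dot_eq hT ht ((((hasDerivWithinAt_dot hsol.smooth_x ht).sub
    (hasDerivWithinAt_dot hsol.smooth_y ht)).add (hasDerivWithinAt_id t _)).neg.div_const 2)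

lemma dot_dot_confExp (hT : 0 < T) (hsol : IsSolution m k T x y φ) {t : ℝ} (ht : t ∈ Icc 0 T) :
    dot T (dot T (confExp x y)) t = -(dot T (dot T x) t - dot T (dot T y) t) / 2 := by
  rw [dot_congr ht fun s hs => dot_confExp hT hsol hs]
  refine dot_eq hT ht ((((hasDerivWithinAt_dot (contDiffOn_dot hT hsol.smooth_x) ht).sub
    (hasDerivWithinAt_dot (contDiffOn_dot hT hsol.smooth_y) ht)).add_const 1).neg.div_const 2)

lemma dot_const_mul (hT : 0 < T) {h : ℝ → ℝ} (hh : ContDiffOn ℝ ∞ h (Icc 0 T)) (c : ℝ) {t : ℝ}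
    (ht : t ∈ Icc 0 T) : dot T (fun t => c * h t) t = c * dot T h t :=
  dot_eq hT ht ((hasDerivWithinAt_dot hh ht).const_mul c)

lemma dot_dot_const_mul (hT : 0 < T) {h : ℝ → ℝ} (hh : ContDiffOn ℝ ∞ h (Icc 0 T)) (c : ℝ) {t : ℝ}
    (ht : t ∈ Icc 0 T) : dot T (dot T (fun t => c * h t)) t = c * dot T (dot T h) t := by
  rw [dot_congr ht fun s hs => dot_const_mul hT hh c hs, dot_const_mul hT (contDiffOn_dot hT hh) c ht]

lemma dot_exp (hT : 0 < T) {t : ℝ} (ht : t ∈ Icc 0 T) : dot T Real.exp t = Real.exp t :=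
  dot_eq hT ht (Real.hasDerivAt_exp t).hasDerivWithinAt

lemma dot_dot_exp (hT : 0 < T) {t : ℝ} (ht : t ∈ Icc 0 T) : dot T (dot T Real.exp) t = Real.exp t := by
  rw [dot_congr ht fun s hs => dot_exp hT hs, dot_exp hT ht]

/-- The normalized gradient soliton equation for the conformally changed metric. At a given point,
every tensor is a combination of `∇dt`, `dt ⊗ dt` and `g`. In `∇̄df + Ric̄ - ḡ` the coefficient of
`∇dt` vanishes by the choice of `f` and of the conformal factor, that of `dt ⊗ dt` by the equation
for `x`, and that of `g` by a combination of all four equations. The scalar equation is the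
equation for `y`. -/
theorem soliton_of_associated (hm : 1 < m) (hT : 0 < T) (hsol : IsSolution m k T x y φ)
    (hdim : Module.finrank ℝ V = 2 * m) (g : Metric V M) (t : M → ℝ)
    (ht : ContMDiff 𝓘(ℝ, V) 𝓘(ℝ, ℝ) ∞ t) (hmem : ∀ p, t p ∈ Icc 0 T)
    (hric : ∀ p, traceless g p
      (((m - 1) * (dot T x (t p) + 1) * Real.exp (-t p)) • hessian g (fun q => Real.exp (t q)) p +
        ricci g p) = 0)
    (hlap : ∀ p, laplacian g (fun q => Real.exp (t q)) p = 2 * (dot T φ (t p) + m * φ (t p)))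
    (hgrad : ∀ p, gradSq g (fun q => Real.exp (t q)) p = 2 * Real.exp (t p) * φ (t p))
    (hscal : ∀ p, Real.exp (t p) * scalar g p / 2 =
      m * (m - 1) - m * (m - 1) * φ (t p) - (2 * m - 1) * dot T φ (t p) - dot T (dot T φ) (t p))
    (gbar : Metric V M) (hgbar : gbar = conformalMetric g (fun p => confExp x y (t p))
      (contMDiff_comp ht hmem (contDiffOn_confExp hsol))) (p : M) :
    hessian gbar (fun p => (m - 1) * y (t p)) p + ricci gbar p = gbar.inner p ∧
    laplacian gbar (fun p => (m - 1) * y (t p)) p - gradSq gbar (fun p => (m - 1) * y (t p)) p +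
      2 * ((m - 1) * y (t p)) = 0 := by
  set U := (chartAt V p).target with hU
  set x₀ := chartAt V p p with hx₀
  set τ : V → ℝ := t ∘ (chartAt V p).symm with hτ
  set G := inChart g p with hG
  have hx : x₀ ∈ U := mem_chart_target V p
  have hGU : Coord.IsMetricOn G U := isMetricOn_inChart g p
  have hτs : ContDiffOn ℝ ∞ τ U := contDiffOn_comp_symm ht p
  have hτm : ∀ z ∈ U, τ z ∈ Icc 0 T := fun z _ => hmem _
  have hτx : τ x₀ = t p := by simp [hτ, hx₀]
  have hGx : G x₀ = g.inner p := inChart_self g p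
  have hpos := hGU.pos x₀ hx
  have htp := hmem p
  have hyf : ContDiffOn ℝ ∞ (fun t => ((m : ℝ) - 1) * y t) (Icc 0 T) :=
    contDiffOn_const.mul hsol.smooth_y
  have hψ := contDiffOn_confExp hsol
  -- the data at the point `p`
  set H := Coord.hessian G τ x₀ with hH
  set a := fderiv ℝ τ x₀ with ha
  set D := Coord.trace (G x₀) H with hD
  set N := a (Coord.grad G τ x₀) with hN
  have hraw : ∀ {h : ℝ → ℝ}, ContDiffOn ℝ ∞ h (Icc 0 T) →
      Coord.hessian G (fun z => h (τ z)) x₀ =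
        dot T h (t p) • H + dot T (dot T h) (t p) • Coord.tmul a a := by
    intro h hh
    rw [Coord.hessian_comp G hT hGU.isOpen hτs hτm hh hx, hτx]
  have hfd : ∀ {h : ℝ → ℝ}, ContDiffOn ℝ ∞ h (Icc 0 T) →
      fderiv ℝ (fun z => h (τ z)) x₀ = dot T h (t p) • a := by
    intro h hh
    rw [Coord.fderiv_comp_of_mapsTo hGU.isOpen hτs hτm hh hx, hτx]
  have hgr : ∀ {h : ℝ → ℝ}, ContDiffOn ℝ ∞ h (Icc 0 T) →
      Coord.grad G (fun z => h (τ z)) x₀ = dot T h (t p) • Coord.grad G τ x₀ := by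
    intro h hh
    rw [Coord.grad_comp G hGU.isOpen hτs hτm hh hx, hτx]
  have htaa : Coord.trace (G x₀) (Coord.tmul a a) = N := Coord.trace_tmul _ _ _
  have hexp : ContDiffOn ℝ ∞ Real.exp (Icc 0 T) := Real.contDiff_exp.contDiffOn
  have hκ : hessian g (fun q => Real.exp (t q)) p =
      Real.exp (t p) • (H + Coord.tmul a a) := by
    have := hraw hexp
    rw [dot_exp hT htp, dot_dot_exp hT htp, ← smul_add] at this
    exact this
  have hlap' : Real.exp (t p) * (D + N) = 2 * (dot T φ (t p) + m * φ (t p)) := by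
    rw [← hlap p, laplacian, trace_eq, hκ, ← hGx, Coord.trace_smul, Coord.trace_add, htaa]
  have hgrad' : Real.exp (t p) ^ 2 * N = 2 * Real.exp (t p) * φ (t p) := by
    rw [← hgrad p, gradSq_eq g (contMDiff_comp ht hmem hexp)]
    have e1 := hfd hexp
    have e2 := hgr hexp
    rw [dot_exp hT htp] at e1 e2
    have e3 : (fun q => Real.exp (t q)) ∘ (chartAt V p).symm = fun z => Real.exp (τ z) := rfl
    rw [e3, ← hx₀, ← hG, e1, e2]
    simp only [smul_apply, map_smul, smul_eq_mul]
    ring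
  set X := dot T x (t p) with hX
  set Y := dot T y (t p) with hY
  set S := scalar g p with hS
  set c : ℝ := (m - 1) * (X + 1) * Real.exp (-t p) with hc
  have hce : c * Real.exp (t p) = (m - 1) * (X + 1) := by
    rw [hc, mul_assoc, ← Real.exp_add, neg_add_cancel, Real.exp_zero, mul_one]
  have hcdim : (Module.finrank ℝ V : ℝ) = 2 * m := by rw [hdim]; push_cast; ring
  have hκ' : Coord.hessian G (fun z => Real.exp (τ z)) x₀ =
      Real.exp (t p) • (H + Coord.tmul a a) := hκ
  -- the vanishing of a traceless part, solved for the Ricci tensor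
  have hricg : Coord.ricci G x₀ = (((m - 1) * (X + 1) * (D + N) + S) / (2 * m)) • G x₀ -
      ((m - 1) * (X + 1)) • (H + Coord.tmul a a) := by
    have h0 : ∀ B : V →L[ℝ] V →L[ℝ] ℝ, B = g.inner p →
        (c • Coord.hessian G (fun z => Real.exp (τ z)) x₀ + Coord.ricci G x₀) -
        (Coord.trace B (c • Coord.hessian G (fun z => Real.exp (τ z)) x₀ + Coord.ricci G x₀) /
          Module.finrank ℝ V) • B = 0 := by
      rintro _ rfl
      exact hric p
    have h1 : ∀ B : V →L[ℝ] V →L[ℝ] ℝ, B = g.inner p → Coord.trace B (Coord.ricci G x₀) = S := by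
      rintro _ rfl
      rfl
    have h2 := h0 _ hGx
    rw [hκ', smul_smul, hce, Coord.trace_add, Coord.trace_smul, Coord.trace_add, htaa,
      h1 _ hGx, hcdim, sub_eq_zero] at h2
    rw [← h2, add_sub_cancel_left]
  -- the tensors of the conformally changed metric
  set ψ' := dot T (confExp x y) (t p) with hψ'
  set ψ'' := dot T (dot T (confExp x y)) (t p) with hψ''
  have hψU : ContDiffOn ℝ ∞ (fun z => confExp x y (τ z)) U := hψ.comp hτs hτm
  have hGb : inChart gbar p = fun z => Real.exp (2 * confExp x y (τ z)) • G z := by rw [hgbar]; rfl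
  set E := Real.exp (2 * confExp x y (t p)) with hE
  have hEpos : 0 < E := Real.exp_pos _
  have hgb : (gbar.inner p : V →L[ℝ] V →L[ℝ] ℝ) = E • G x₀ := by rw [hgbar, hGx]; rfl
  have hf1 := dot_const_mul hT hsol.smooth_y ((m : ℝ) - 1) htp
  have hf2 := dot_dot_const_mul hT hsol.smooth_y ((m : ℝ) - 1) htp
  have hhess : Coord.hessian (inChart gbar p) (fun z => (m - 1) * y (τ z)) x₀ =
      ((m - 1) * Y) • H + ((m - 1) * (dot T (dot T y) (t p) - 2 * Y * ψ')) • Coord.tmul a a +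
        ((m - 1) * Y * ψ' * N) • G x₀ := by
    rw [hGb, hGU.conformal_hessian hψU _ hx, hraw hyf, hfd hyf, hfd hψ, hgr hψ, hf1, hf2]
    ext u v
    simp only [add_apply, sub_apply, smul_apply, Coord.tmul_apply, smul_eq_mul, map_smul]
    ring
  have hricb : Coord.ricci (inChart gbar p) x₀ = Coord.ricci G x₀ -
      (2 * (m - 1) * ψ') • H - (2 * (m - 1) * (ψ'' - ψ' ^ 2)) • Coord.tmul a a -
      (ψ' * D + ψ'' * N + 2 * (m - 1) * ψ' ^ 2 * N) • G x₀ := by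
    rw [hGb, hGU.conformal_ricci hψU hx, hraw hψ, hfd hψ, hgr hψ, hcdim, Coord.trace_add,
      Coord.trace_smul, Coord.trace_smul, htaa]
    ext u v
    simp only [add_apply, sub_apply, smul_apply, Coord.tmul_apply, smul_eq_mul, map_smul]
    ring
  -- the differential equations
  have hψ1 : ψ' = -(X - Y + 1) / 2 := dot_confExp hT hsol htp
  have hψ2 : ψ'' = -(dot T (dot T x) (t p) - dot T (dot T y) (t p)) / 2 :=
    dot_dot_confExp hT hsol htp
  have e1 := hsol.eq_x (t p) htp
  have e2 := hsol.eq_y (t p) htp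
  have e3 := hsol.eq_phi (t p) htp
  have e4 := hsol.eq_int (t p) htp
  have hs := hscal p
  rw [← hX, ← hY] at e1 e2 e4
  rw [← hX] at e3
  rw [← hS] at hs
  set w := Real.exp (y (t p) - x (t p)) with hw
  set q := Real.exp (t p) with hq
  have hq0 : 0 < q := Real.exp_pos _
  have hEw : E * q = w := by
    rw [hE, hq, hw, ← Real.exp_add]; congr 1; simp only [confExp]; ring
  have hm0 : (m : ℝ) ≠ 0 := by
    have : m ≠ 0 := by omega
    exact_mod_cast this
  have hNv : q * N = 2 * φ (t p) := by
    have : q * (q * N) = q * (2 * φ (t p)) := by linear_combination hgrad'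
    exact mul_left_cancel₀ hq0.ne' this
  have hDv : q * D = 2 * (dot T φ (t p) + (m - 1) * φ (t p)) := by
    linear_combination hlap' - hNv
  have hSv : q * S = 2 * (m * (m - 1) - m * (m - 1) * φ (t p) - (2 * m - 1) * dot T φ (t p) -
    dot T (dot T φ) (t p)) := by linear_combination 2 * hs
  -- the coefficient of `g` in `∇̄df + Ric̄` is the conformal factor
  have hfinal : ((m - 1) * (X + 1) * (D + N) + S) / (2 * m) + (m - 1) * Y * ψ' * N -
      (ψ' * D + ψ'' * N + 2 * (m - 1) * ψ' ^ 2 * N) = E := by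
    apply mul_left_cancel₀ hq0.ne'
    have h1 : q * (((m - 1) * (X + 1) * (D + N) + S) / (2 * m) + (m - 1) * Y * ψ' * N -
      (ψ' * D + ψ'' * N + 2 * (m - 1) * ψ' ^ 2 * N)) =
      ((m - 1) * (X + 1) * (q * D + q * N) + q * S) / (2 * m) + (m - 1) * Y * ψ' * (q * N) -
      (ψ' * (q * D) + ψ'' * (q * N) + 2 * (m - 1) * ψ' ^ 2 * (q * N)) := by ring
    rw [h1, mul_comm q E, hEw, hNv, hDv, hSv, hψ1, hψ2]
    field_simp
    linear_combination (m * φ (t p) / 2) * e1 - m * e2 - e3 + m / 2 * e4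
  -- the coefficients of `dt ⊗ dt` and of `∇dt` in `∇̄df + Ric̄` cancel those coming from `Ric`
  have hcoef : (m - 1) * (dot T (dot T y) (t p) - 2 * Y * ψ') - 2 * (m - 1) * (ψ'' - ψ' ^ 2) =
      ((m : ℝ) - 1) * (X + 1) := by
    rw [hψ1, hψ2]
    linear_combination ((m : ℝ) - 1) / 2 * e1
  have hcoef' : ((m : ℝ) - 1) * Y - 2 * (m - 1) * ψ' = (m - 1) * (X + 1) := by
    rw [hψ1]; ring
  refine ⟨?_, ?_⟩
  · have key : Coord.hessian (inChart gbar p) (fun z => (m - 1) * y (τ z)) x₀ +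
        Coord.ricci (inChart gbar p) x₀ = E • G x₀ := by
      rw [hhess, hricb, hricg, ← hfinal]
      ext u v
      simp only [add_apply, sub_apply, smul_apply, Coord.tmul_apply, smul_eq_mul]
      linear_combination (H u v) * hcoef' + (a u * a v) * hcoef
    exact key.trans hgb.symm
  · have hlapb : laplacian gbar (fun p => (m - 1) * y (t p)) p =
        E⁻¹ * ((m - 1) * Y * D + (m - 1) * (dot T (dot T y) (t p) - 2 * Y * ψ') * N +
          (m - 1) * Y * ψ' * N * (2 * m)) := by
      have h1 : ∀ B : V →L[ℝ] V →L[ℝ] ℝ, gbar.inner p = B →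
          laplacian gbar (fun p => (m - 1) * y (t p)) p =
            Coord.trace B (Coord.hessian (inChart gbar p) (fun z => (m - 1) * y (τ z)) x₀) := by
        rintro _ rfl
        rfl
      rw [h1 _ hgb, hhess, Coord.trace_smul_left _ _ hpos hEpos, Coord.trace_add, Coord.trace_add,
        Coord.trace_smul, Coord.trace_smul, Coord.trace_smul, htaa, Coord.trace_self hpos, hcdim]
    have hgradb : gradSq gbar (fun p => (m - 1) * y (t p)) p = E⁻¹ * (((m - 1) * Y) ^ 2 * N) := by
      rw [gradSq_eq gbar (contMDiff_comp ht hmem hyf)]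
      change fderiv ℝ (fun z => (m - 1) * y (τ z)) x₀
        (Coord.grad (inChart gbar p) (fun z => (m - 1) * y (τ z)) x₀) = _
      rw [hGb, Coord.grad, hτx, Coord.inverse_smul _ hpos hEpos, hfd hyf, hf1]
      simp only [map_smul, smul_apply, smul_eq_mul, hN, Coord.grad]
      ring
    -- the scalar equation, multiplied by `e^t`, is the equation for `y`
    have hy1 : q * (((m - 1) * Y * D + (m - 1) * (dot T (dot T y) (t p) - 2 * Y * ψ') * N +
          (m - 1) * Y * ψ' * N * (2 * m)) - ((m - 1) * Y) ^ 2 * N) =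
          -(2 * (m - 1) * y (t p) * w) := by
      have h1 : q * (((m - 1) * Y * D + (m - 1) * (dot T (dot T y) (t p) - 2 * Y * ψ') * N +
          (m - 1) * Y * ψ' * N * (2 * m)) - ((m - 1) * Y) ^ 2 * N) =
          ((m - 1) * Y * (q * D) + (m - 1) * (dot T (dot T y) (t p) - 2 * Y * ψ') * (q * N) +
          (m - 1) * Y * ψ' * (q * N) * (2 * m)) - ((m - 1) * Y) ^ 2 * (q * N) := by ring
      rw [h1, hNv, hDv, hψ1]
      linear_combination 2 * ((m : ℝ) - 1) * e2
    rw [hlapb, hgradb, ← mul_sub]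
    rw [← hEw] at hy1
    have hy2 : ((m - 1) * Y * D + (m - 1) * (dot T (dot T y) (t p) - 2 * Y * ψ') * N +
          (m - 1) * Y * ψ' * N * (2 * m)) - ((m - 1) * Y) ^ 2 * N =
          -(2 * (m - 1) * y (t p) * E) := by
      apply mul_left_cancel₀ hq0.ne'
      rw [hy1]
      ring
    rw [hy2]
    field_simp
    ring

end Soliton

end Riem

/-! ### Gradient solitons -/

namespace Riem

variable {V : Type*} [NormedAddCommGroup V] [NormedSpace ℝ V] [FiniteDimensional ℝ V]
  {M : Type*} [TopologicalSpace M] [ChartedSpace V M] [IsManifold 𝓘(ℝ, V) ∞ M]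

/-- A gradient soliton is a soliton: the vector field is `½ ∇f`. -/
lemma IsNormalizedGradientSoliton.isRicciSoliton {g : Metric V M} {f : M → ℝ}
    (h : IsNormalizedGradientSoliton g f) : IsRicciSoliton g 1 := by
  have hf : ContMDiff 𝓘(ℝ, V) 𝓘(ℝ, ℝ) ∞ (fun p => 1 / 2 * f p) := contMDiff_const.mul h.1
  refine ⟨grad g (fun p => 1 / 2 * f p), contMDiff_grad g hf, fun p u v => ?_⟩
  rw [lieDeriv_grad g hf, hessian_const_mul g h.1, ← (h.2 p).1]
  change 2 * (1 / 2 * (hessian g f p u v)) + ricci g p u v = 1 * (hessian g f p u v + ricci g p u v)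
  ring

lemma trace_inner (g : Metric V M) (p : M) : trace g p (g.inner p) = Module.finrank ℝ V := by
  rw [trace_eq]
  exact Coord.trace_self (V := V) (g.pos p)

/-- The third equation of the system follows from the trace of `∇df + Ric = g`. -/
lemma IsNormalizedGradientSoliton.solitonSystem {g : Metric V M} {f : M → ℝ}
    (h : IsNormalizedGradientSoliton g f) (hV : Module.finrank ℝ V ≠ 0) : SolitonSystem g f := by
  intro p
  obtain ⟨h1, h2⟩ := h.2 p
  have hV' : (Module.finrank ℝ V : ℝ) ≠ 0 := by exact_mod_cast hV
  have h3 : laplacian g f p + scalar g p = Module.finrank ℝ V := by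
    rw [← trace_inner g p, ← h1, laplacian, scalar, trace_eq, trace_eq, trace_eq]
    exact (Coord.trace_add (V := V) _ _ _).symm
  refine ⟨?_, h2, ?_⟩
  · rw [h1, traceless, trace_inner, div_self hV', one_smul, sub_self]
  · rw [h2, h3]; ring

end Riem

lemma TautCompact.finrank_real_pi (m : ℕ) : Module.finrank ℝ (Fin m → ℂ) = 2 * m := by
  rw [Module.finrank_pi_fintype]; simp [mul_comm]

/-- Every associated pair gives rise to a soliton. -/
theorem TautCompact.soliton_of_isAssociated {m k : ℕ} (hm : 1 < m) {T : ℝ} (hT : 0 < T)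
    {x y φ : ℝ → ℝ} (hsol : IsSolution m k T x y φ)
    (g : Riem.Metric (Fin m → ℂ) (TautCompact m k)) (t : TautCompact m k → ℝ)
    (h : IsAssociated m k T x φ g t) :
      ∃ gbar : Riem.Metric (Fin m → ℂ) (TautCompact m k),
        (∀ p, gbar.inner p = (Real.exp ((x (t p) - y (t p) + t p) / 2) ^ 2)⁻¹ • g.inner p) ∧
        Riem.IsRicciSoliton gbar 1 ∧
        Riem.IsNormalizedGradientSoliton gbar (fun p => (m - 1) * y (t p)) ∧
        Riem.SolitonSystem gbar (fun p => (m - 1) * y (t p)) := by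
  have hmem : ∀ p, t p ∈ Icc 0 T := fun p => h.range_eq ▸ mem_range_self p
  have key := Riem.soliton_of_associated hm hT hsol (finrank_real_pi m) g t h.smooth hmem h.ricciHessian
    h.laplacian_eq h.gradSq_eq h.scalar_eq _ rfl
  have hs := Riem.contMDiff_comp h.smooth hmem (h := fun t => ((m : ℝ) - 1) * y t)
    (contDiffOn_const.mul hsol.smooth_y)
  have hn : Riem.IsNormalizedGradientSoliton _ (fun p => ((m : ℝ) - 1) * y (t p)) := ⟨hs, key⟩
  exact ⟨_, fun p => by rw [← Riem.exp_two_mul_confExp]; rfl, hn.isRicciSoliton, hn,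
    hn.solitonSystem (by rw [finrank_real_pi]; omega)⟩

/-! ### Topology of the manifold -/

namespace TautCompact

variable {m k : ℕ}

/-- The chart with index `(i, b)`, as a homeomorphism between open sets. -/
def ochart (m k : ℕ) (i : Fin m) (b : Bool) :
    OpenPartialHomeomorph (TautCompact m k) (Fin m → ℂ) :=
  (core m k).openPartialHomeomorph (chart m k i b) ⟨(i, b), rfl⟩

lemma exists_mem_ochart (x : TautCompact m k) : ∃ i b, x ∈ (ochart m k i b).source := by
  obtain ⟨ib, h⟩ := exists_mem_chart x
  exact ⟨ib.1, ib.2, h⟩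

/-- Continuity can be checked in the charts. -/
lemma continuous_of_comp_chartInv {Y : Type*} [TopologicalSpace Y] {f : TautCompact m k → Y}
    (h : ∀ i b, Continuous fun c => f (chartInv i b c)) : Continuous f := by
  rw [continuous_iff_continuousAt]
  intro x
  obtain ⟨i, b, hx⟩ := exists_mem_ochart x
  rw [(ochart m k i b).symm.continuousAt_iff_continuousAt_comp_right (f := f) (x := x) hx]
  exact (h i b).continuousAt

/-- The map from homogeneous coordinates, nonzero in `ℂ^m` and in `ℂ²`, onto `M^m_k`. -/
def ptMap (m k : ℕ) (w : {z : Fin m → ℂ // z ≠ 0} × {a : ℂ × ℂ // a ≠ 0}) : TautCompact m k :=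
  pt k w.1.1 w.1.2 w.2.1 w.2.2

lemma continuous_ptMap : Continuous (ptMap m k) := by
  rw [continuous_iff_continuousAt]
  rintro ⟨⟨z, hz⟩, ⟨a, ha⟩⟩
  obtain ⟨i, b, hx⟩ := exists_mem_ochart (pt k z hz a ha)
  have hpre : ptMap m k ⁻¹' (ochart m k i b).source =
      {w | w.1.1 i ≠ 0 ∧ bif b then w.2.1.1 ≠ 0 else w.2.1.2 ≠ 0} := by
    ext w
    exact pt_mem_chartSource i b _ w.1.2 _ w.2.2
  have c1 : ∀ j, Continuous fun w : {z : Fin m → ℂ // z ≠ 0} × {a : ℂ × ℂ // a ≠ 0} => w.1.1 j :=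
    fun j => (continuous_apply j).comp (continuous_subtype_val.comp continuous_fst)
  have c2 : Continuous fun w : {z : Fin m → ℂ // z ≠ 0} × {a : ℂ × ℂ // a ≠ 0} => w.2.1.1 :=
    continuous_fst.comp (continuous_subtype_val.comp continuous_snd)
  have c3 : Continuous fun w : {z : Fin m → ℂ // z ≠ 0} × {a : ℂ × ℂ // a ≠ 0} => w.2.1.2 :=
    continuous_snd.comp (continuous_subtype_val.comp continuous_snd)
  have hopen : IsOpen (ptMap m k ⁻¹' (ochart m k i b).source) := by
    rw [hpre]
    refine IsOpen.inter (isOpen_ne_fun (c1 i) continuous_const) ?_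
    cases b
    · exact isOpen_ne_fun c3 continuous_const
    · exact isOpen_ne_fun c2 continuous_const
  rw [(ochart m k i b).continuousAt_iff_continuousAt_comp_left (hopen.mem_nhds hx)]
  have hx' := (pt_mem_chartSource i b z hz a ha).1 hx
  have : (ochart m k i b) ∘ ptMap m k = fun w => update (fun j => w.1.1 j / w.1.1 i) i
      (bif b then w.2.1.2 / (w.2.1.1 * w.1.1 i ^ k) else w.2.1.1 * w.1.1 i ^ k / w.2.1.2) := by
    funext w
    exact chartFun_pt i b _ w.1.2 _ w.2.2
  rw [this]
  refine ContinuousAt.update ?_ i ?_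
  · rw [continuousAt_pi]
    intro j
    exact (c1 j).continuousAt.div (c1 i).continuousAt hx'.1
  · cases b
    · exact (c2.mul ((c1 i).pow k)).continuousAt.div c3.continuousAt hx'.2
    · exact c3.continuousAt.div (c2.mul ((c1 i).pow k)).continuousAt
        (mul_ne_zero hx'.2 (pow_ne_zero _ hx'.1))

lemma surjective_ptMap : Surjective (ptMap m k) := fun x => by
  obtain ⟨z, hz, a, ha, rfl⟩ := exists_pt x
  exact ⟨⟨⟨z, hz⟩, ⟨a, ha⟩⟩, rfl⟩

/-- `M^m_k` is the image of a product of two spheres under the map from homogeneous coordinates. -/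
lemma compactSpace : CompactSpace (TautCompact m k) := by
  let F : Metric.sphere (0 : Fin m → ℂ) 1 × Metric.sphere (0 : ℂ × ℂ) 1 → TautCompact m k := fun w =>
    ptMap m k (⟨w.1.1, ne_zero_of_mem_unit_sphere w.1⟩, ⟨w.2.1, ne_zero_of_mem_unit_sphere w.2⟩)
  have hF : Continuous F := continuous_ptMap.comp
    (((continuous_subtype_val.comp continuous_fst).subtype_mk _).prodMk
      ((continuous_subtype_val.comp continuous_snd).subtype_mk _))
  have hs : Surjective F := by
    intro x
    obtain ⟨z, hz, a, ha, rfl⟩ := exists_pt x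
    have hn : ‖z‖ ≠ 0 := norm_ne_zero_iff.2 hz
    set a' : ℂ × ℂ := (a.1 * (‖z‖ : ℂ) ^ k, a.2) with ha'
    have ha'0 : a' ≠ 0 := by
      intro h
      rw [ha', Prod.mk_eq_zero] at h
      refine ha (Prod.ext ((mul_eq_zero.1 h.1).resolve_right (pow_ne_zero _ ?_)) h.2)
      exact_mod_cast hn
    have hn' : ‖a'‖ ≠ 0 := norm_ne_zero_iff.2 ha'0
    refine ⟨(⟨((‖z‖ : ℂ)⁻¹) • z, ?_⟩, ⟨((‖a'‖ : ℂ)⁻¹) • a', ?_⟩), ?_⟩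
    · simp [norm_smul, hn]
    · simp only [mem_sphere_iff_norm, sub_zero, norm_smul, norm_inv, Complex.norm_real, norm_norm]
      exact inv_mul_cancel₀ hn'
    · refine (pt_eq_pt _ _ _ _ (‖z‖ : ℂ)⁻¹ (‖a'‖ : ℂ) rfl ?_ ?_).symm
      · have h1 : (‖z‖ : ℂ) ≠ 0 := by exact_mod_cast hn
        have h2 : (‖a'‖ : ℂ) ≠ 0 := by exact_mod_cast hn'
        simp only [Prod.smul_fst, smul_eq_mul]
        rw [show a'.1 = a.1 * (‖z‖ : ℂ) ^ k from rfl, inv_pow]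
        field_simp
      · have h2 : (‖a'‖ : ℂ) ≠ 0 := by exact_mod_cast hn'
        simp only [Prod.smul_snd, smul_eq_mul]
        rw [show a'.2 = a.2 from rfl]
        field_simp
  exact hs.compactSpace hF

lemma connectedSpace (hm : 1 ≤ m) : ConnectedSpace (TautCompact m k) := by
  have h1 : IsConnected {z : Fin m → ℂ | z ≠ 0} := by
    refine isConnected_compl_singleton_of_one_lt_rank ?_ 0
    rw [← Module.finrank_eq_rank, Module.finrank_pi_fintype]
    simp only [Complex.finrank_real_complex, Finset.sum_const, Finset.card_univ, Fintype.card_fin,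
      smul_eq_mul]
    exact_mod_cast (by omega : 1 < m * 2)
  have h2 : IsConnected {a : ℂ × ℂ | a ≠ 0} := by
    refine isConnected_compl_singleton_of_one_lt_rank ?_ 0
    rw [← Module.finrank_eq_rank, Module.finrank_prod]
    simp only [Complex.finrank_real_complex]
    exact_mod_cast (by omega : 1 < 2 + 2)
  have h3 : ConnectedSpace {z : Fin m → ℂ // z ≠ 0} := isConnected_iff_connectedSpace.1 h1
  have h4 : ConnectedSpace {a : ℂ × ℂ // a ≠ 0} := isConnected_iff_connectedSpace.1 h2
  exact surjective_ptMap.connectedSpace (continuous_ptMap (m := m) (k := k))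

/-- The entries of the orthogonal projection of `ℂ^m` onto the line of the base point. -/
def sepBase (i j : Fin m) (x : TautCompact m k) : ℂ :=
  x.1.rep i * star (x.1.rep j) / ((∑ l, ‖x.1.rep l‖ ^ 2 : ℝ) : ℂ)

/-- The square of a Hermitian norm on `L^{⊗k} ⊕ ℂ`, evaluated at the representative of the point of
the fibre. -/
def sepDen (x : TautCompact m k) : ℝ := ∑ l, ‖powCoord k x.1 l x.2.rep.1‖ ^ 2 + ‖x.2.rep.2‖ ^ 2

/-- The off-diagonal entries of the orthogonal projection onto the line in `L^{⊗k} ⊕ ℂ` which is the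
point of the fibre, where `L^{⊗k}` is embedded in `ℂ^m` by the `k`-th powers of the coordinates. -/
def sepFibre (i : Fin m) (x : TautCompact m k) : ℂ :=
  powCoord k x.1 i x.2.rep.1 * star x.2.rep.2 / (sepDen x : ℂ)

/-- The last diagonal entry of the same projection. -/
def sepDiag (x : TautCompact m k) : ℝ := ‖x.2.rep.2‖ ^ 2 / sepDen x

lemma sepBase_pt (i j : Fin m) (z : Fin m → ℂ) (hz : z ≠ 0) (a : ℂ × ℂ) (ha : a ≠ 0) :
    sepBase i j (pt k z hz a ha) = z i * star (z j) / ((∑ l, ‖z l‖ ^ 2 : ℝ) : ℂ) := by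
  obtain ⟨⟨l, hl, hl'⟩, -⟩ := rep_pt (k := k) z hz a ha
  have hn : (‖l‖ ^ 2 : ℂ) ≠ 0 := by
    exact_mod_cast pow_ne_zero 2 (norm_ne_zero_iff.2 hl)
  have h1 : l * star l = (‖l‖ ^ 2 : ℂ) := by
    rw [Complex.star_def, Complex.mul_conj, Complex.normSq_eq_norm_sq]; push_cast; rfl
  simp only [sepBase, hl', Pi.smul_apply, smul_eq_mul, norm_mul, mul_pow, ← Finset.mul_sum,
    star_mul']
  rw [show l * z i * (star l * star (z j)) = (l * star l) * (z i * star (z j)) by ring, h1]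
  push_cast
  rw [mul_div_mul_left _ _ hn]

/-- The norm and the entries of the projection in homogeneous coordinates. The unknown scalar factor
`μ` of the representative does not enter in the entries. -/
lemma sepDen_pt (z : Fin m → ℂ) (hz : z ≠ 0) (a : ℂ × ℂ) (ha : a ≠ 0) :
    ∃ μ : ℂ, μ ≠ 0 ∧
      sepDen (pt k z hz a ha) = ‖μ‖ ^ 2 * (‖a.1‖ ^ 2 * ∑ l, ‖z l ^ k‖ ^ 2 + ‖a.2‖ ^ 2) ∧
      (∀ i, sepFibre i (pt k z hz a ha) = (a.1 * z i ^ k) * star a.2 /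
        ((‖a.1‖ ^ 2 * ∑ l, ‖z l ^ k‖ ^ 2 + ‖a.2‖ ^ 2 : ℝ) : ℂ)) ∧
      sepDiag (pt k z hz a ha) = ‖a.2‖ ^ 2 / (‖a.1‖ ^ 2 * ∑ l, ‖z l ^ k‖ ^ 2 + ‖a.2‖ ^ 2) := by
  obtain ⟨-, μ, hμ, h1, h2⟩ := rep_pt (k := k) z hz a ha
  have hn : ‖μ‖ ^ 2 ≠ 0 := pow_ne_zero 2 (norm_ne_zero_iff.2 hμ)
  have h3 : μ * star μ = ((‖μ‖ ^ 2 : ℝ) : ℂ) := by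
    rw [Complex.star_def, Complex.mul_conj, Complex.normSq_eq_norm_sq]
  have hden : sepDen (pt k z hz a ha) =
      ‖μ‖ ^ 2 * (‖a.1‖ ^ 2 * ∑ l, ‖z l ^ k‖ ^ 2 + ‖a.2‖ ^ 2) := by
    simp only [sepDen, h1, h2, norm_mul, mul_pow, ← Finset.mul_sum]
    ring
  refine ⟨μ, hμ, hden, fun i => ?_, ?_⟩
  · rw [sepFibre, hden, h1, h2, star_mul',
      show μ * (a.1 * z i ^ k) * (star μ * star a.2) = (μ * star μ) * (a.1 * z i ^ k * star a.2) by
        ring, h3, Complex.ofReal_mul, mul_div_mul_left _ _ (by exact_mod_cast hn)]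
  · rw [sepDiag, hden, h2, norm_mul, mul_pow, mul_div_mul_left _ _ hn]

lemma den_pos (z : Fin m → ℂ) (hz : z ≠ 0) (a : ℂ × ℂ) (ha : a ≠ 0) :
    0 < ‖a.1‖ ^ 2 * ∑ l, ‖z l ^ k‖ ^ 2 + ‖a.2‖ ^ 2 := by
  obtain ⟨i, hi⟩ := Function.ne_iff.1 hz
  have h1 : 0 < ∑ l, ‖z l ^ k‖ ^ 2 := by
    refine Finset.sum_pos' (fun l _ => by positivity) ⟨i, Finset.mem_univ _, ?_⟩
    have : z i ^ k ≠ 0 := pow_ne_zero _ hi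
    positivity
  by_cases h : a.1 = 0
  · have h2 : a.2 ≠ 0 := fun h2 => ha (Prod.ext h h2)
    have := norm_pos_iff.2 h2
    positivity
  · have := norm_pos_iff.2 h
    positivity

lemma sumSq_pos {z : Fin m → ℂ} (hz : z ≠ 0) : 0 < ∑ l, ‖z l‖ ^ 2 := by
  obtain ⟨i, hi⟩ := Function.ne_iff.1 hz
  have hi : z i ≠ 0 := hi
  exact Finset.sum_pos' (fun l _ => by positivity) ⟨i, Finset.mem_univ _, by positivity⟩

lemma continuous_sepBase (i j : Fin m) : Continuous (sepBase (k := k) i j) := by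
  refine continuous_of_comp_chartInv fun i' b => ?_
  simp only [chartInv, sepBase_pt]
  have hb : ∀ j, Continuous fun c : Fin m → ℂ => baseVec i' c j :=
    fun j => (contDiff_baseVec i' j).continuous
  refine ((hb i).mul (hb j).star).div (Complex.continuous_ofReal.comp
    (continuous_finsetSum _ fun l _ => (hb l).norm.pow 2)) fun c => ?_
  exact_mod_cast (sumSq_pos (baseVec_ne_zero i' c)).ne'

lemma continuous_den (i : Fin m) (b : Bool) : Continuous fun c : Fin m → ℂ =>
    ‖(fibreVec i b c).1‖ ^ 2 * ∑ l, ‖baseVec i c l ^ k‖ ^ 2 + ‖(fibreVec i b c).2‖ ^ 2 := by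
  have hb : ∀ j, Continuous fun c : Fin m → ℂ => baseVec i c j :=
    fun j => (contDiff_baseVec i j).continuous
  have hf := (contDiff_fibreVec (m := m) i b).continuous
  exact ((hf.fst.norm.pow 2).mul (continuous_finsetSum _ fun l _ => ((hb l).pow k).norm.pow 2)).add
    (hf.snd.norm.pow 2)

lemma continuous_sepFibre (i : Fin m) : Continuous (sepFibre (k := k) i) := by
  refine continuous_of_comp_chartInv fun i' b => ?_
  have h := fun c => (sepDen_pt (k := k) _ (baseVec_ne_zero i' c) _
    (fibreVec_ne_zero i' b c)).choose_spec.2.2.1 i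
  have e : (fun c => sepFibre i (chartInv i' b c : TautCompact m k)) = _ := funext h
  rw [e]
  have hf := (contDiff_fibreVec (m := m) i' b).continuous
  refine ((hf.fst.mul ((contDiff_baseVec i' i).continuous.pow k)).mul hf.snd.star).div
    (Complex.continuous_ofReal.comp (continuous_den i' b)) fun c => ?_
  exact_mod_cast (den_pos _ (baseVec_ne_zero i' c) _ (fibreVec_ne_zero i' b c)).ne'

lemma continuous_sepDiag : Continuous (sepDiag (m := m) (k := k)) := by
  refine continuous_of_comp_chartInv fun i' b => ?_
  have h := fun c => (sepDen_pt (k := k) _ (baseVec_ne_zero i' c) _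
    (fibreVec_ne_zero i' b c)).choose_spec.2.2.2
  have e : (fun c => sepDiag (chartInv i' b c : TautCompact m k)) = _ := funext h
  rw [e]
  have hf := (contDiff_fibreVec (m := m) i' b).continuous
  exact (hf.snd.norm.pow 2).div (continuous_den i' b) fun c =>
    (den_pos _ (baseVec_ne_zero i' c) _ (fibreVec_ne_zero i' b c)).ne'

/-- The entries of the two projections determine the point. -/
lemma eq_of_sep_eq {x x' : TautCompact m k} (h1 : ∀ i j, sepBase i j x = sepBase i j x')
    (h2 : ∀ i, sepFibre i x = sepFibre i x') (h3 : sepDiag x = sepDiag x') : x = x' := by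
  obtain ⟨z, hz, a, ha, rfl⟩ := exists_pt x
  obtain ⟨z', hz', a', ha', rfl⟩ := exists_pt x'
  obtain ⟨-, -, -, e2, e3⟩ := sepDen_pt (k := k) z hz a ha
  obtain ⟨-, -, -, e2', e3'⟩ := sepDen_pt (k := k) z' hz' a' ha'
  obtain ⟨i, hi⟩ := Function.ne_iff.1 hz
  have hi : z i ≠ 0 := hi
  have hN : ((∑ l, ‖z l‖ ^ 2 : ℝ) : ℂ) ≠ 0 := by exact_mod_cast (sumSq_pos hz).ne'
  have hN' : ((∑ l, ‖z' l‖ ^ 2 : ℝ) : ℂ) ≠ 0 := by exact_mod_cast (sumSq_pos hz').ne'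
  simp only [sepBase_pt] at h1
  have hi' : z' i ≠ 0 := by
    intro h0
    have := h1 i i
    rw [h0, zero_mul, zero_div, div_eq_zero_iff] at this
    rcases this with h | h
    · exact (mul_ne_zero hi (star_ne_zero.2 hi)) h
    · exact hN h
  have hzz : z' = (z' i / z i) • z := by
    funext j
    have e1 := h1 j i
    have e2 := h1 i i
    have hs : star (z i) ≠ 0 := star_ne_zero.2 hi
    have hs' : star (z' i) ≠ 0 := star_ne_zero.2 hi'
    rw [div_eq_div_iff hN hN'] at e1 e2
    simp only [Pi.smul_apply, smul_eq_mul]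
    rw [div_mul_eq_mul_div, eq_div_iff hi]
    apply mul_right_cancel₀ (mul_ne_zero hs' hN)
    apply mul_right_cancel₀ (mul_ne_zero hs hN')
    linear_combination (-(z i * star (z i)) * ((∑ l, ‖z' l‖ ^ 2 : ℝ) : ℂ)) * e1 +
      (z j * star (z i) * ((∑ l, ‖z' l‖ ^ 2 : ℝ) : ℂ)) * e2
  have hl : z' i / z i ≠ 0 := div_ne_zero hi' hi
  set l := z' i / z i with hldef
  have hzi' : z' i = l * z i := by rw [hldef]; field_simp
  have hD := den_pos (k := k) z hz a ha
  have hD' := den_pos (k := k) z' hz' a' ha'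
  set D := ‖a.1‖ ^ 2 * ∑ l, ‖z l ^ k‖ ^ 2 + ‖a.2‖ ^ 2 with hDdef
  set D' := ‖a'.1‖ ^ 2 * ∑ l, ‖z' l ^ k‖ ^ 2 + ‖a'.2‖ ^ 2 with hDdef'
  have hDc : (D : ℂ) ≠ 0 := by exact_mod_cast hD.ne'
  have hDc' : (D' : ℂ) ≠ 0 := by exact_mod_cast hD'.ne'
  rw [e3, e3', div_eq_div_iff hD.ne' hD'.ne'] at h3
  have h2i := h2 i
  rw [e2, e2', div_eq_div_iff hDc hDc', hzi', mul_pow] at h2i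
  have hzk : z i ^ k ≠ 0 := pow_ne_zero _ hi
  have hlk : l ^ k ≠ 0 := pow_ne_zero _ hl
  by_cases h0 : a.2 = 0
  · have h0' : a'.2 = 0 := by
      rw [h0, norm_zero] at h3
      have : ‖a'.2‖ ^ 2 * D = 0 := by rw [← h3]; ring
      simpa [hD.ne'] using this
    have ha1 : a'.1 ≠ 0 := fun h => ha' (Prod.ext h h0')
    refine pt_eq_pt _ _ _ _ l (a.1 / (a'.1 * l ^ k)) hzz ?_ ?_
    · field_simp
    · rw [h0, h0', mul_zero]
  · have h0' : a'.2 ≠ 0 := by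
      intro h
      rw [h, norm_zero] at h3
      have : ‖a.2‖ ^ 2 * D' = 0 := by rw [h3]; ring
      simp [hD'.ne', h0] at this
    refine pt_eq_pt _ _ _ _ l (a.2 / a'.2) hzz ?_ ?_
    · have h3c : (a.2 * star a.2) * (D' : ℂ) = (a'.2 * star a'.2) * D := by
        rw [Complex.star_def, Complex.mul_conj, Complex.mul_conj, Complex.normSq_eq_norm_sq,
          Complex.normSq_eq_norm_sq]
        exact_mod_cast h3
      have hs' : star a'.2 ≠ 0 := star_ne_zero.2 h0'
      have hs : star a.2 ≠ 0 := star_ne_zero.2 h0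
      rw [div_mul_eq_mul_div, div_eq_iff h0']
      apply mul_right_cancel₀ (mul_ne_zero (mul_ne_zero hs hzk) hDc')
      apply mul_right_cancel₀ (mul_ne_zero hs' hDc)
      linear_combination (a'.1 * l ^ k * z i ^ k * star a'.2 * D) * h3c -
        (a'.2 * star a'.2 * D) * h2i
    · field_simp

/-- The entries of the two projections are continuous functions which separate points. -/
lemma t2Space : T2Space (TautCompact m k) := by
  refine T2Space.of_injective_continuous (f := fun x : TautCompact m k =>
    ((fun i j => sepBase i j x, fun i => sepFibre i x, sepDiag x) :
      (Fin m → Fin m → ℂ) × (Fin m → ℂ) × ℝ)) ?_ ?_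
  · intro x x' h
    simp only [Prod.mk.injEq] at h
    exact eq_of_sep_eq (fun i j => congrFun (congrFun h.1 i) j) (fun i => congrFun h.2.1 i) h.2.2
  · exact (continuous_pi fun i => continuous_pi fun j => continuous_sepBase i j).prodMk
      ((continuous_pi fun i => continuous_sepFibre i).prodMk continuous_sepDiag)

end TautCompact

/-! ### Averages and division by t on `[0, T]` -/

section OneSided

/-- The nearest point of `[0, T]`. -/
def clampTo (T t : ℝ) : ℝ := max 0 (min t T)

lemma continuous_clampTo (T : ℝ) : Continuous (clampTo T) := by unfold clampTo; fun_prop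

lemma clampTo_mem {T : ℝ} (hT : 0 ≤ T) (t : ℝ) : clampTo T t ∈ Icc 0 T :=
  ⟨le_max_left _ _, max_le hT (min_le_right _ _)⟩

lemma clampTo_of_mem {T t : ℝ} (ht : t ∈ Icc 0 T) : clampTo T t = t := by
  simp [clampTo, ht.1, ht.2]

lemma continuous_comp_clampTo {T : ℝ} (hT : 0 ≤ T) {g : ℝ → ℝ} (hg : ContinuousOn g (Icc 0 T)) :
    Continuous fun t => g (clampTo T t) :=
  hg.comp_continuous (continuous_clampTo T) (clampTo_mem hT)

lemma hasDerivWithinAt_primitive {T : ℝ} {g : ℝ → ℝ} (hg : ContinuousOn g (Icc 0 T))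
    {t : ℝ} (ht : t ∈ Icc 0 T) :
    HasDerivWithinAt (fun t => ∫ u in (0 : ℝ)..t, g u) (g t) (Icc 0 T) t := by
  have hT : 0 ≤ T := ht.1.trans ht.2
  have h1 := ((continuous_comp_clampTo hT hg).integral_hasStrictDerivAt 0 t).hasDerivAt
  rw [clampTo_of_mem ht] at h1
  refine h1.hasDerivWithinAt.congr_of_mem (fun s hs => ?_) ht
  refine intervalIntegral.integral_congr fun u hu => ?_
  rw [uIcc_of_le hs.1] at hu
  rw [clampTo_of_mem ⟨hu.1, hu.2.trans hs.2⟩]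

/-- The weighted average `∫₀¹ vⁿ h(tv) dv`. These averages are closed under differentiation, the
derivative of `average n h` being `average (n + 1) h'`, so that they are smooth up to the ends of
the interval if `h` is. -/
def average (n : ℕ) (h : ℝ → ℝ) (t : ℝ) : ℝ := ∫ v in (0 : ℝ)..1, v ^ n * h (t * v)

lemma average_congr {T : ℝ} {n : ℕ} {h h' : ℝ → ℝ} (he : ∀ s ∈ Icc 0 T, h s = h' s) {t : ℝ}
    (ht : t ∈ Icc 0 T) : average n h t = average n h' t := by
  refine intervalIntegral.integral_congr fun v hv => ?_
  rw [uIcc_of_le zero_le_one] at hv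
  rw [he _ ⟨mul_nonneg ht.1 hv.1, (mul_le_of_le_one_right ht.1 hv.2).trans ht.2⟩]

lemma hasDerivAt_average {f f' : ℝ → ℝ} (hf : ∀ t, HasDerivAt f (f' t) t) (hf' : Continuous f')
    (n : ℕ) (t : ℝ) : HasDerivAt (average n f) (average (n + 1) f' t) t := by
  have hfc : Continuous f := continuous_iff_continuousAt.2 fun t => (hf t).continuousAt
  obtain ⟨C, hC⟩ := ((isCompact_Icc (a := -(|t| + 1)) (b := |t| + 1)).image_of_continuousOn
    hf'.norm.continuousOn).bddAbove
  refine (intervalIntegral.hasDerivAt_integral_of_dominated_loc_of_deriv_le (bound := fun _ => C)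
    (F := fun t v => v ^ n * f (t * v)) (F' := fun t v => v ^ (n + 1) * f' (t * v))
    (Metric.ball_mem_nhds t one_pos) ?_ ?_ ?_ ?_ ?_ ?_).2
  · exact Filter.Eventually.of_forall fun s =>
      (by fun_prop : Continuous fun v => v ^ n * f (s * v)).aestronglyMeasurable
  · exact (by fun_prop : Continuous fun v => v ^ n * f (t * v)).intervalIntegrable _ _
  · exact (by fun_prop : Continuous fun v => v ^ (n + 1) * f' (t * v)).aestronglyMeasurable
  · refine Filter.Eventually.of_forall fun v hv s hs => ?_
    rw [uIoc_of_le zero_le_one] at hv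
    have h1 : |s| ≤ |t| + 1 := by
      have := abs_sub_abs_le_abs_sub s t
      rw [Metric.mem_ball, Real.dist_eq] at hs
      linarith
    have h2 : |s * v| ≤ |t| + 1 := by
      rw [abs_mul, abs_of_pos hv.1]
      exact (mul_le_of_le_one_right (abs_nonneg s) hv.2).trans h1
    have h3 : ‖f' (s * v)‖ ≤ C := hC ⟨s * v, abs_le.1 h2, rfl⟩
    rw [norm_mul, norm_pow, Real.norm_of_nonneg hv.1.le]
    exact (mul_le_of_le_one_left (norm_nonneg _) (pow_le_one₀ hv.1.le hv.2)).trans h3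
  · exact intervalIntegrable_const
  · refine Filter.Eventually.of_forall fun v _ s _ => ?_
    have h1 : HasDerivAt (fun s => s * v) v s := by simpa using (hasDerivAt_id s).mul_const v
    have h2 := ((hf (s * v)).comp s h1).const_mul (v ^ n)
    exact h2.congr_deriv (by ring)

/-- On `[0, T]`, a smooth function agrees with a function of class `C^1` on the real line. -/
lemma eq_primitive {T : ℝ} (hT : 0 < T) {h : ℝ → ℝ} (hh : ContDiffOn ℝ ∞ h (Icc 0 T)) {t : ℝ}
    (ht : t ∈ Icc 0 T) : h t = h 0 + ∫ u in (0 : ℝ)..t, dot T h (clampTo T u) := by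
  have hc := (contDiffOn_dot hT hh).continuousOn
  have hcc := continuous_comp_clampTo hT.le hc
  have h1 : ∀ s ∈ Icc 0 T, HasDerivWithinAt
      (fun s => h s - ∫ u in (0 : ℝ)..s, dot T h (clampTo T u)) 0 (Icc 0 T) s := by
    intro s hs
    have h2 := (hcc.integral_hasStrictDerivAt 0 s).hasDerivAt.hasDerivWithinAt (s := Icc 0 T)
    rw [clampTo_of_mem hs] at h2
    have h4 := (hasDerivWithinAt_dot hh hs).sub h2
    rw [sub_self] at h4
    exact h4
  have h3 := constant_of_derivWithin_zero (fun s hs => (h1 s hs).differentiableWithinAt)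
    (fun s hs => (h1 s ⟨hs.1, hs.2.le⟩).derivWithin
      (uniqueDiffOn_Icc hT s ⟨hs.1, hs.2.le⟩)) t ht
  simp only [intervalIntegral.integral_same, sub_zero] at h3
  linarith

lemma hasDerivWithinAt_average {T : ℝ} (hT : 0 < T) {h : ℝ → ℝ} (hh : ContDiffOn ℝ ∞ h (Icc 0 T))
    (n : ℕ) {t : ℝ} (ht : t ∈ Icc 0 T) :
    HasDerivWithinAt (average n h) (average (n + 1) (dot T h) t) (Icc 0 T) t := by
  have hc := (contDiffOn_dot hT hh).continuousOn
  have hcc := continuous_comp_clampTo hT.le hc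
  have h1 : ∀ t, HasDerivAt (fun t => h 0 + ∫ u in (0 : ℝ)..t, dot T h (clampTo T u))
      (dot T h (clampTo T t)) t := fun t =>
    ((hcc.integral_hasStrictDerivAt 0 t).hasDerivAt).const_add _
  have h2 := (hasDerivAt_average h1 hcc n t).hasDerivWithinAt (s := Icc 0 T)
  rw [average_congr (T := T) (h' := dot T h) (fun s hs => by rw [clampTo_of_mem hs]) ht] at h2
  exact h2.congr_of_mem (fun s hs => average_congr (fun u hu => eq_primitive hT hh hu) hs) ht

lemma contDiffOn_average {T : ℝ} (hT : 0 < T) {h : ℝ → ℝ} (hh : ContDiffOn ℝ ∞ h (Icc 0 T))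
    (n : ℕ) : ContDiffOn ℝ ∞ (average n h) (Icc 0 T) := by
  rw [contDiffOn_infty]
  intro N
  induction N generalizing n h with
  | zero =>
    rw [Nat.cast_zero, contDiffOn_zero]
    exact fun t ht => (hasDerivWithinAt_average hT hh n ht).continuousWithinAt
  | succ N ih =>
    rw [Nat.cast_succ, contDiffOn_succ_iff_derivWithin (uniqueDiffOn_Icc hT)]
    refine ⟨fun t ht => (hasDerivWithinAt_average hT hh n ht).differentiableWithinAt, by simp, ?_⟩
    refine (ih (contDiffOn_dot hT hh) (n + 1)).congr fun t ht => ?_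
    exact (hasDerivWithinAt_average hT hh n ht).derivWithin (uniqueDiffOn_Icc hT t ht)

/-- Hadamard's lemma on `[0, T]`: the difference quotient at `0` of a smooth function is smooth. -/
lemma eq_add_mul_average {T : ℝ} (hT : 0 < T) {h : ℝ → ℝ} (hh : ContDiffOn ℝ ∞ h (Icc 0 T)) {t : ℝ}
    (ht : t ∈ Icc 0 T) : h t = h 0 + t * average 0 (dot T h) t := by
  rw [eq_primitive hT hh ht, average_congr (T := T) (h' := fun u => dot T h (clampTo T u))
    (fun s hs => by rw [clampTo_of_mem hs]) ht, average]
  simp only [pow_zero, one_mul]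
  rw [intervalIntegral.mul_integral_comp_mul_left (f := fun u => dot T h (clampTo T u)), mul_zero,
    mul_one]

lemma average_zero_apply_zero (h : ℝ → ℝ) : average 0 h 0 = h 0 := by simp [average]

end OneSided

/-! ### The profile of t along the fibres -/

lemma Ico_mem_nhdsWithin {T t : ℝ} (ht : t ∈ Ico 0 T) :
    Icc 0 ((t + T) / 2) ∈ 𝓝[Ico 0 T] t := by
  have h1 : Iio ((t + T) / 2) ∈ 𝓝 t := Iio_mem_nhds (by linarith [ht.2])
  filter_upwards [self_mem_nhdsWithin, mem_nhdsWithin_of_mem_nhds h1] with s hs hs'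
  exact ⟨hs.1, (mem_Iio.1 hs').le⟩

/-- The solution `σ` of `φ σ' = k σ` on `[0, T)` which vanishes to first order at `0`. Writing
`φ(t) = t b(t)` and `b(t) = k + t b₁(t)`, one has `k / φ = 1 / t - b₁ / b`, so that
`σ(t) = t exp (-∫ b₁ / b)`; this is where the boundary condition `φ'(0) = k` enters. -/
lemma exists_sigma {T k : ℝ} (hT : 0 < T) (hk : 0 < k) {φ : ℝ → ℝ}
    (hφ : ContDiffOn ℝ ∞ φ (Icc 0 T)) (h0 : φ 0 = 0) (hk0 : dot T φ 0 = k)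
    (hpos : ∀ t ∈ Ioo 0 T, 0 < φ t) :
    ∃ σ d : ℝ → ℝ, σ 0 = 0 ∧ ContDiffOn ℝ ∞ d (Ico 0 T) ∧
      ∀ t ∈ Ico 0 T, HasDerivWithinAt σ (d t) (Ico 0 T) t ∧ 0 < d t ∧ k * σ t = φ t * d t := by
  set b := average 0 (dot T φ) with hb
  have hbs : ContDiffOn ℝ ∞ b (Icc 0 T) := contDiffOn_average hT (contDiffOn_dot hT hφ) 0
  have hφb : ∀ t ∈ Icc 0 T, φ t = t * b t := fun t ht => by
    rw [eq_add_mul_average hT hφ ht, h0, zero_add]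
  have hb0 : b 0 = k := by rw [hb, average_zero_apply_zero, hk0]
  have hbpos : ∀ t ∈ Ico 0 T, 0 < b t := by
    intro t ht
    rcases eq_or_lt_of_le ht.1 with h | h
    · rw [← h, hb0]; exact hk
    · have h1 := hpos t ⟨h, ht.2⟩
      rw [hφb t ⟨ht.1, ht.2.le⟩] at h1
      exact pos_of_mul_pos_right h1 h.le
  set b₁ := average 0 (dot T b)
  have hb₁s : ContDiffOn ℝ ∞ b₁ (Icc 0 T) := contDiffOn_average hT (contDiffOn_dot hT hbs) 0
  have hbb : ∀ t ∈ Icc 0 T, b t = k + t * b₁ t := fun t ht => by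
    rw [eq_add_mul_average hT hbs ht, hb0]
  have hsub : Ico 0 T ⊆ Icc 0 T := Ico_subset_Icc_self
  set q : ℝ → ℝ := fun t => -b₁ t / b t with hq
  have hqs : ContDiffOn ℝ ∞ q (Ico 0 T) :=
    (hb₁s.mono hsub).neg.div (hbs.mono hsub) fun t ht => (hbpos t ht).ne'
  set B : ℝ → ℝ := fun t => ∫ u in (0 : ℝ)..t, q u with hB
  have hBd : ∀ t ∈ Ico 0 T, HasDerivWithinAt B (q t) (Ico 0 T) t := by
    intro t ht
    have h1 : ContinuousOn q (Icc 0 ((t + T) / 2)) := hqs.continuousOn.mono fun s hs =>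
      ⟨hs.1, hs.2.trans_lt (by linarith [ht.2])⟩
    exact (hasDerivWithinAt_primitive h1 ⟨ht.1, by linarith [ht.2]⟩).mono_of_mem_nhdsWithin
      (Ico_mem_nhdsWithin ht)
  have hu : UniqueDiffOn ℝ (Ico 0 T) := uniqueDiffOn_Ico 0 T
  have hBs : ContDiffOn ℝ ∞ B (Ico 0 T) := by
    rw [contDiffOn_infty_iff_derivWithin hu]
    exact ⟨fun t ht => (hBd t ht).differentiableWithinAt,
      hqs.congr fun t ht => (hBd t ht).derivWithin (hu t ht)⟩
  refine ⟨fun t => t * Real.exp (B t), fun t => Real.exp (B t) * (k / b t), by simp, ?_, ?_⟩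
  · exact (Real.contDiff_exp.comp_contDiffOn hBs).mul
      (contDiffOn_const.div (hbs.mono hsub) fun t ht => (hbpos t ht).ne')
  · intro t ht
    have hbt := hbpos t ht
    refine ⟨?_, by positivity, ?_⟩
    · have h1 := (hasDerivWithinAt_id t (Ico 0 T)).mul (hBd t ht).exp
      refine h1.congr_deriv ?_
      have h2 := hbb t (hsub ht)
      simp only [hq, id]
      field_simp
      linear_combination h2
    · rw [hφb t (hsub ht)]
      field_simp

lemma reverse_mem {T t : ℝ} (ht : t ∈ Ioo 0 T) : T - t ∈ Ioo 0 T :=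
  ⟨by linarith [ht.2], by linarith [ht.1]⟩

lemma sigma_strictMonoOn {T : ℝ} {σ d : ℝ → ℝ}
    (h : ∀ t ∈ Ico 0 T, HasDerivWithinAt σ (d t) (Ico 0 T) t ∧ 0 < d t) :
    StrictMonoOn σ (Ico 0 T) := by
  refine strictMonoOn_of_deriv_pos (convex_Ico 0 T)
    (fun t ht => (h t ht).1.continuousWithinAt) fun t ht => ?_
  rw [interior_Ico] at ht
  have ht' : t ∈ Ico 0 T := ⟨ht.1.le, ht.2⟩
  rw [((h t ht').1.hasDerivAt (Ico_mem_nhds ht.1 ht.2)).deriv]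
  exact (h t ht').2

/-- If `σ` and `σ'` solve the equation with zeros at the two ends of `[0, T]`, then
`σ(t) σ'(T - t)` is constant, because the logarithmic derivatives `±k / φ` cancel. -/
lemma exists_sigma_mul_reverse {T k : ℝ} (hT : 0 < T) {φ σ d σ' d' : ℝ → ℝ}
    (hpos : ∀ t ∈ Ioo 0 T, 0 < φ t) (h0 : σ 0 = 0) (h0' : σ' 0 = 0)
    (h : ∀ t ∈ Ico 0 T, HasDerivWithinAt σ (d t) (Ico 0 T) t ∧ 0 < d t ∧ k * σ t = φ t * d t)
    (h' : ∀ t ∈ Ico 0 T, HasDerivWithinAt σ' (d' t) (Ico 0 T) t ∧ 0 < d' t ∧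
      k * σ' t = φ (T - t) * d' t) :
    ∃ c : ℝ, 0 < c ∧ ∀ t ∈ Ioo 0 T, σ t * σ' (T - t) = c := by
  have hd : ∀ t ∈ Ioo 0 T, HasDerivAt (fun t => σ t * σ' (T - t)) 0 t := by
    intro t ht
    have hr := reverse_mem ht
    obtain ⟨h1, -, h2⟩ := h t ⟨ht.1.le, ht.2⟩
    obtain ⟨h3, -, h4⟩ := h' (T - t) ⟨hr.1.le, hr.2⟩
    have h5 : HasDerivAt (fun t => T - t) (-1) t := by
      simpa using (hasDerivAt_id t).const_sub T
    have h6 := (h1.hasDerivAt (Ico_mem_nhds ht.1 ht.2)).mul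
      ((h3.hasDerivAt (Ico_mem_nhds hr.1 hr.2)).comp t h5)
    refine h6.congr_deriv ?_
    rw [sub_sub_cancel] at h4
    have h7 := hpos t ht
    refine mul_left_cancel₀ h7.ne' ?_
    simp only [comp]
    linear_combination σ t * h4 - σ' (T - t) * h2
  obtain ⟨c, hc⟩ := isOpen_Ioo.exists_is_const_of_deriv_eq_zero isPreconnected_Ioo
    (fun t ht => (hd t ht).differentiableAt.differentiableWithinAt) fun t ht => (hd t ht).deriv
  refine ⟨c, ?_, hc⟩
  have hm : T / 2 ∈ Ioo 0 T := ⟨by linarith, by linarith⟩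
  rw [← hc _ hm]
  have hz : (0 : ℝ) ∈ Ico 0 T := ⟨le_rfl, hT⟩
  have hr := reverse_mem hm
  have h1 := sigma_strictMonoOn (fun t ht => ⟨(h t ht).1, (h t ht).2.1⟩) hz ⟨hm.1.le, hm.2⟩ hm.1
  have h2 := sigma_strictMonoOn (fun t ht => ⟨(h' t ht).1, (h' t ht).2.1⟩) hz ⟨hr.1.le, hr.2⟩ hr.1
  rw [h0] at h1
  rw [h0'] at h2
  exact mul_pos h1 h2

/-- The inverse function theorem for increasing functions on half-open intervals, with one-sided
derivatives of all orders at the end point. -/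
lemma exists_inverse {T : ℝ} (hT : 0 < T) {σ d : ℝ → ℝ} (h0 : σ 0 = 0)
    (hd : ContDiffOn ℝ ∞ d (Ico 0 T))
    (h : ∀ t ∈ Ico 0 T, HasDerivWithinAt σ (d t) (Ico 0 T) t ∧ 0 < d t)
    (hunb : ∀ M, ∃ t ∈ Ico 0 T, M ≤ σ t) :
    ∃ S : ℝ → ℝ, ContDiffOn ℝ ∞ S (Ici 0) ∧ (∀ s ∈ Ici 0, S s ∈ Ico 0 T ∧ σ (S s) = s ∧
      HasDerivWithinAt S (d (S s))⁻¹ (Ici 0) s) ∧ ∀ t ∈ Ico 0 T, 0 ≤ σ t ∧ S (σ t) = t := by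
  have hmono := sigma_strictMonoOn h
  have hz : (0 : ℝ) ∈ Ico 0 T := ⟨le_rfl, hT⟩
  have hnn : ∀ t ∈ Ico 0 T, 0 ≤ σ t := fun t ht => by
    rw [← h0]; exact hmono.monotoneOn hz ht ht.1
  have hsurj : ∀ s ∈ Ici (0 : ℝ), ∃ t ∈ Ico 0 T, σ t = s := by
    intro s hs
    obtain ⟨t, ht, hst⟩ := hunb s
    have hc : ContinuousOn σ (Icc 0 t) := fun u hu =>
      ((h u ⟨hu.1, hu.2.trans_lt ht.2⟩).1.continuousWithinAt).mono
        fun v hv => ⟨hv.1, hv.2.trans_lt ht.2⟩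
    obtain ⟨u, hu, rfl⟩ := intermediate_value_Icc ht.1 hc (show s ∈ Icc (σ 0) (σ t) from
      ⟨by rw [h0]; exact hs, hst⟩)
    exact ⟨u, ⟨hu.1, hu.2.trans_lt ht.2⟩, rfl⟩
  choose! S hS hσS using hsurj
  have hSσ : ∀ t ∈ Ico 0 T, S (σ t) = t := fun t ht =>
    hmono.injOn (hS _ (hnn t ht)) ht (hσS _ (hnn t ht))
  have hSm : StrictMonoOn S (Ici 0) := by
    intro s hs s' hs' hlt
    rw [← hmono.lt_iff_lt (hS s hs) (hS s' hs'), hσS s hs, hσS s' hs']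
    exact hlt
  have hcont : ∀ s ∈ Ici (0 : ℝ), ContinuousWithinAt S (Ici 0) s := by
    intro s hs
    refine tendsto_order.2 ⟨fun a ha => ?_, fun a ha => ?_⟩
    · rcases lt_or_ge a 0 with ha0 | ha0
      · filter_upwards [self_mem_nhdsWithin] with u hu using ha0.trans_le (hS u hu).1
      · have ha' : a ∈ Ico 0 T := ⟨ha0, ha.trans (hS s hs).2⟩
        have h1 : σ a < s := by rw [← hσS s hs]; exact hmono ha' (hS s hs) ha
        filter_upwards [self_mem_nhdsWithin, mem_nhdsWithin_of_mem_nhds (Ioi_mem_nhds h1)]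
          with u hu hu'
        rw [← hSσ a ha']
        exact hSm (hnn a ha') hu hu'
    · rcases lt_or_ge a T with haT | haT
      · have ha' : a ∈ Ico 0 T := ⟨(hS s hs).1.trans ha.le, haT⟩
        have h1 : s < σ a := by rw [← hσS s hs]; exact hmono (hS s hs) ha' ha
        filter_upwards [self_mem_nhdsWithin, mem_nhdsWithin_of_mem_nhds (Iio_mem_nhds h1)]
          with u hu hu'
        rw [← hSσ a ha']
        exact hSm hu (hnn a ha') hu'
      · filter_upwards [self_mem_nhdsWithin] with u hu using (hS u hu).2.trans_le haT
  have hder : ∀ s ∈ Ici (0 : ℝ), HasDerivWithinAt S (d (S s))⁻¹ (Ici 0) s := by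
    intro s hs
    rw [hasDerivWithinAt_iff_tendsto_slope]
    have h1 := hasDerivWithinAt_iff_tendsto_slope.1 (h (S s) (hS s hs)).1
    have h2 : Filter.Tendsto S (𝓝[Ici 0 \ {s}] s) (𝓝[Ico 0 T \ {S s}] (S s)) := by
      refine tendsto_nhdsWithin_iff.2 ⟨(hcont s hs).mono_left (nhdsWithin_mono _ sdiff_subset), ?_⟩
      filter_upwards [self_mem_nhdsWithin] with u hu
      exact ⟨hS u hu.1, fun he => hu.2 (hSm.injOn hu.1 hs he)⟩
    refine ((h1.comp h2).inv₀ (h (S s) (hS s hs)).2.ne').congr' ?_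
    filter_upwards [self_mem_nhdsWithin] with u hu
    simp only [comp, slope_def_field, hσS s hs, hσS u hu.1, inv_div]
  have hu : UniqueDiffOn ℝ (Ici (0 : ℝ)) := uniqueDiffOn_Ici 0
  refine ⟨S, ?_, fun s hs => ⟨hS s hs, hσS s hs, hder s hs⟩, fun t ht => ⟨hnn t ht, hSσ t ht⟩⟩
  rw [contDiffOn_infty]
  intro N
  induction N with
  | zero => exact contDiffOn_zero.2 hcont
  | succ N ih =>
    rw [Nat.cast_succ, contDiffOn_succ_iff_derivWithin hu]
    refine ⟨fun s hs => (hder s hs).differentiableWithinAt, by simp, ?_⟩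
    refine ContDiffOn.congr ?_ fun s hs => (hder s hs).derivWithin (hu s hs)
    exact ((contDiffOn_infty.1 hd N).comp ih fun s hs => hS s hs).inv
      fun s hs => (h (S s) (hS s hs)).2.ne'

/-- The sign `1` or `-1` belonging to the charts around the zero section and around the section at
infinity. -/
def sgn (b : Bool) : ℝ := bif b then -1 else 1

lemma sgn_mul_self (b : Bool) : sgn b * sgn b = 1 := by cases b <;> simp [sgn]

/-- The profile of the function `t` along the fibres of `M^m_k`. In the charts around the zero
section (`b = false`) and around the section at infinity (`b = true`), `t` is to be the function
`S b` of the squared fibre norm `s ∈ [0, ∞)`, a solution of `k s dt/ds = ±φ(t)` which is smooth up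
to `s = 0`. The fibre norms in the two kinds of charts are inverse to each other. -/
structure Profile (k T : ℝ) (φ : ℝ → ℝ) (S : Bool → ℝ → ℝ) : Prop where
  smooth : ∀ b, ContDiffOn ℝ ∞ (S b) (Ici 0)
  mem : ∀ b, ∀ s, 0 < s → S b s ∈ Ioo 0 T
  zero_false : S false 0 = 0
  zero_true : S true 0 = T
  inv : ∀ s, 0 < s → S true s⁻¹ = S false s
  deriv_eq : ∀ b, ∀ s, 0 ≤ s → k * (s * derivWithin (S b) (Ici 0) s) = sgn b * φ (S b s)
  deriv_pos : ∀ b, ∀ s, 0 ≤ s → 0 < sgn b * derivWithin (S b) (Ici 0) s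
  surj : ∀ t ∈ Ioo 0 T, ∃ s, 0 < s ∧ S false s = t

/-- The profile is the inverse of the solution `σ` vanishing at `0`, and near `T` the inverse of the
solution vanishing at `T`, scaled by the constant by which the two differ. -/
lemma Profile.exists_of_boundary {T k : ℝ} (hT : 0 < T) (hk : 0 < k) {φ : ℝ → ℝ}
    (hφ : ContDiffOn ℝ ∞ φ (Icc 0 T)) (h0 : φ 0 = 0) (hφT : φ T = 0) (hk0 : dot T φ 0 = k)
    (hkT : -dot T φ T = k) (hpos : ∀ t ∈ Ioo 0 T, 0 < φ t) : ∃ S, Profile k T φ S := by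
  obtain ⟨σ, d, hσ0, hd, hσ⟩ := exists_sigma hT hk hφ h0 hk0 hpos
  have hrev : MapsTo (fun t => T - t) (Icc 0 T) (Icc 0 T) := fun t ht =>
    ⟨by linarith [ht.2], by linarith [ht.1]⟩
  have hk0' : dot T (fun t => φ (T - t)) 0 = k := by
    have h2 := hasDerivWithinAt_dot hφ (show T ∈ Icc 0 T from ⟨hT.le, le_rfl⟩)
    have h5 : HasDerivWithinAt (fun t => T - t) (-1) (Icc 0 T) 0 := by
      simpa using ((hasDerivAt_id (0 : ℝ)).const_sub T).hasDerivWithinAt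
    have h6 := HasDerivWithinAt.scomp (0 : ℝ) (g₁ := φ) (by rw [sub_zero]; exact h2) h5 hrev
    have h7 := h6.derivWithin (uniqueDiffOn_Icc hT 0 ⟨le_rfl, hT.le⟩)
    rw [show dot T (fun t => φ (T - t)) 0 = _ from h7, ← hkT]
    simp
  obtain ⟨σ', d', hσ0', hd', hσ'⟩ := exists_sigma (φ := fun t => φ (T - t)) hT hk
    (hφ.comp (by fun_prop) hrev) (by simpa using hφT) hk0' fun t ht => hpos _ (reverse_mem ht)
  obtain ⟨c, hc, hprod⟩ := exists_sigma_mul_reverse hT hpos hσ0 hσ0' hσ hσ'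
  have hz : (0 : ℝ) ∈ Ico 0 T := ⟨le_rfl, hT⟩
  -- the product `σ(t) σ'(T - t)` being a positive constant, a zero of one factor is a pole of the
  -- other
  have key : ∀ {σ σ' : ℝ → ℝ}, σ' 0 = 0 → (∀ t ∈ Ico 0 T, ContinuousWithinAt σ' (Ico 0 T) t) →
      (∀ t ∈ Ioo 0 T, 0 < σ' t) → (∀ t ∈ Ioo 0 T, σ t * σ' (T - t) = c) →
      ∀ M, ∃ t ∈ Ico 0 T, M ≤ σ t := by
    intro σ σ' h0 hcont hp hprod M
    have h1 : ∀ᶠ u in 𝓝[Ico 0 T] 0, σ' u < c / (|M| + 1) := by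
      have h2 := hcont 0 hz
      rw [ContinuousWithinAt, h0] at h2
      exact h2.eventually (Iio_mem_nhds (by positivity))
    have h3 : ∀ᶠ u in 𝓝[>] (0 : ℝ), σ' u < c / (|M| + 1) ∧ u ∈ Ioo 0 T := by
      have h4 : Ioo 0 T ∈ 𝓝[>] (0 : ℝ) := Ioo_mem_nhdsGT hT
      refine Filter.Eventually.and ?_ h4
      rw [← nhdsWithin_Ioo_eq_nhdsGT hT]
      exact h1.filter_mono (nhdsWithin_mono _ Ioo_subset_Ico_self)
    obtain ⟨u, hu1, hu2⟩ := h3.exists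
    have hr := reverse_mem hu2
    refine ⟨T - u, ⟨hr.1.le, hr.2⟩, ?_⟩
    have h5 := hprod _ hr
    rw [sub_sub_cancel] at h5
    have h6 := hp u hu2
    rw [lt_div_iff₀ (by positivity), ← h5] at hu1
    have h7 : |M| + 1 < σ (T - u) := by
      by_contra! hle
      nlinarith
    linarith [le_abs_self M]
  have hp : ∀ t ∈ Ioo 0 T, 0 < σ t := fun t ht => by
    rw [← hσ0]
    exact sigma_strictMonoOn (fun t ht => ⟨(hσ t ht).1, (hσ t ht).2.1⟩) hz ⟨ht.1.le, ht.2⟩ ht.1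
  have hp' : ∀ t ∈ Ioo 0 T, 0 < σ' t := fun t ht => by
    rw [← hσ0']
    exact sigma_strictMonoOn (fun t ht => ⟨(hσ' t ht).1, (hσ' t ht).2.1⟩) hz ⟨ht.1.le, ht.2⟩ ht.1
  obtain ⟨S, hSs, hS, hSσ⟩ := exists_inverse hT hσ0 hd (fun t ht => ⟨(hσ t ht).1, (hσ t ht).2.1⟩)
    (key hσ0' (fun t ht => (hσ' t ht).1.continuousWithinAt) hp' hprod)
  obtain ⟨S', hSs', hS', hSσ'⟩ := exists_inverse hT hσ0' hd'
    (fun t ht => ⟨(hσ' t ht).1, (hσ' t ht).2.1⟩)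
    (key hσ0 (fun t ht => (hσ t ht).1.continuousWithinAt) hp fun t ht => by
      have := hprod _ (reverse_mem ht)
      rw [sub_sub_cancel] at this
      rw [mul_comm, this])
  have hmul : MapsTo (fun s => c * s) (Ici 0) (Ici (0 : ℝ)) := fun s hs => mul_nonneg hc.le hs
  have hu : UniqueDiffOn ℝ (Ici (0 : ℝ)) := uniqueDiffOn_Ici 0
  have hd1 : ∀ s, 0 ≤ s → derivWithin S (Ici 0) s = (d (S s))⁻¹ := fun s hs =>
    (hS s hs).2.2.derivWithin (hu s hs)
  have hd2 : ∀ s, 0 ≤ s →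
      derivWithin (fun s => T - S' (c * s)) (Ici 0) s = -((d' (S' (c * s)))⁻¹ * c) := fun s hs => by
    have h5 : HasDerivWithinAt (fun s => c * s) c (Ici 0) s := by
      simpa using ((hasDerivAt_id s).const_mul c).hasDerivWithinAt
    exact (((hS' (c * s) (hmul hs)).2.2.comp s h5 hmul).const_sub T).derivWithin (hu s hs)
  have hS0 : S 0 = 0 := by rw [← hσ0, (hSσ 0 hz).2, hσ0]
  have hS0' : S' 0 = 0 := by rw [← hσ0', (hSσ' 0 hz).2, hσ0']
  have hmS : ∀ s, 0 < s → S s ∈ Ioo 0 T := fun s hs =>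
    ⟨lt_of_le_of_ne (hS s hs.le).1.1 fun h => by
      have := (hS s hs.le).2.1; rw [← h, hσ0] at this; exact hs.ne this, (hS s hs.le).1.2⟩
  have hmS' : ∀ s, 0 < s → S' s ∈ Ioo 0 T := fun s hs =>
    ⟨lt_of_le_of_ne (hS' s hs.le).1.1 fun h => by
      have := (hS' s hs.le).2.1; rw [← h, hσ0'] at this; exact hs.ne this, (hS' s hs.le).1.2⟩
  refine ⟨fun b => bif b then fun s => T - S' (c * s) else S, ?_, ?_, ?_, ?_, ?_, ?_, ?_, ?_⟩
  · rintro (_ | _)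
    · exact hSs
    · exact contDiffOn_const.sub (hSs'.comp (by fun_prop) hmul)
  · rintro (_ | _) s hs
    · exact hmS s hs
    · exact reverse_mem (hmS' _ (mul_pos hc hs))
  · exact hS0
  · simp [hS0']
  · intro s hs
    simp only [cond_true, cond_false]
    have h1 := hmS s hs
    have h2 := hprod _ h1
    rw [(hS s hs.le).2.1] at h2
    have hr := reverse_mem h1
    have h3 : c * s⁻¹ = σ' (T - S s) := by rw [← h2]; field_simp
    rw [h3, (hSσ' _ ⟨hr.1.le, hr.2⟩).2, sub_sub_cancel]
  · rintro (_ | _) s hs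
    · simp only [cond_false, sgn, one_mul]
      rw [hd1 s hs]
      obtain ⟨-, h1, h2⟩ := hσ _ (hS s hs).1
      rw [(hS s hs).2.1] at h2
      field_simp
      linear_combination h2
    · simp only [cond_true, sgn]
      rw [hd2 s hs]
      obtain ⟨-, h1, h2⟩ := hσ' _ (hS' _ (hmul hs)).1
      rw [(hS' _ (hmul hs)).2.1] at h2
      simp only [mul_comm c s] at h1 h2 ⊢
      field_simp
      linear_combination -h2
  · rintro (_ | _) s hs
    · simp only [cond_false, sgn, one_mul]
      rw [hd1 s hs]
      exact inv_pos.2 (hσ _ (hS s hs).1).2.1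
    · simp only [cond_true, sgn]
      rw [hd2 s hs]
      have := (hσ' _ (hS' _ (hmul hs)).1).2.1
      rw [neg_one_mul, neg_neg]
      positivity
  · intro t ht
    exact ⟨σ t, hp t ht, (hSσ t ⟨ht.1.le, ht.2⟩).2⟩

open scoped ComplexConjugate

/-! ### Rules for directional derivatives -/

section LineDeriv

variable {V : Type*} [NormedAddCommGroup V] [NormedSpace ℝ V]

lemma fderiv_eq_of_hasLineDerivAt {W : Type*} [NormedAddCommGroup W] [NormedSpace ℝ W] {F : V → W}
    {x u : V} {d : W} (hF : DifferentiableAt ℝ F x) (h : HasLineDerivAt ℝ F d x u) :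
    fderiv ℝ F x u = d := by
  rw [← hF.lineDeriv_eq_fderiv, h.lineDeriv]

variable {F G : V → ℂ} {x u : V} {a b : ℂ}

lemma HasLineDerivAt.add' {W : Type*} [NormedAddCommGroup W] [NormedSpace ℝ W] {F G : V → W}
    {a b : W} (hF : HasLineDerivAt ℝ F a x u) (hG : HasLineDerivAt ℝ G b x u) :
    HasLineDerivAt ℝ (fun y => F y + G y) (a + b) x u := HasDerivAt.add hF hG

lemma HasLineDerivAt.congr_deriv' {W : Type*} [NormedAddCommGroup W] [NormedSpace ℝ W] {F : V → W}
    {a b : W} (hF : HasLineDerivAt ℝ F a x u) (h : a = b) : HasLineDerivAt ℝ F b x u := h ▸ hF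

lemma HasLineDerivAt.sub' (hF : HasLineDerivAt ℝ F a x u) (hG : HasLineDerivAt ℝ G b x u) :
    HasLineDerivAt ℝ (fun y => F y - G y) (a - b) x u := HasDerivAt.sub hF hG

lemma HasLineDerivAt.mul' (hF : HasLineDerivAt ℝ F a x u) (hG : HasLineDerivAt ℝ G b x u) :
    HasLineDerivAt ℝ (fun y => F y * G y) (a * G x + F x * b) x u := by
  have := HasDerivAt.mul hF hG
  simp only [zero_smul, add_zero] at this
  exact this

lemma HasLineDerivAt.const_mul' (c : ℂ) (hF : HasLineDerivAt ℝ F a x u) :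
    HasLineDerivAt ℝ (fun y => c * F y) (c * a) x u := HasDerivAt.const_mul c hF

lemma HasLineDerivAt.inv' (hF : HasLineDerivAt ℝ F a x u) (h0 : F x ≠ 0) :
    HasLineDerivAt ℝ (fun y => (F y)⁻¹) (-a / F x ^ 2) x u := by
  have := HasDerivAt.inv hF (by simpa using h0)
  simp only [zero_smul, add_zero] at this
  exact this

lemma HasLineDerivAt.conj' (hF : HasLineDerivAt ℝ F a x u) :
    HasLineDerivAt ℝ (fun y => conj (F y)) (conj a) x u :=
  (Complex.conjCLE.toContinuousLinearMap.hasFDerivAt.comp_hasDerivAt (0 : ℝ) hF)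

lemma HasLineDerivAt.re' (hF : HasLineDerivAt ℝ F a x u) :
    HasLineDerivAt ℝ (fun y => (F y).re) a.re x u :=
  (Complex.reCLM.hasFDerivAt.comp_hasDerivAt (0 : ℝ) hF)

lemma HasLineDerivAt.ofReal' {F : V → ℝ} {a : ℝ} (hF : HasLineDerivAt ℝ F a x u) :
    HasLineDerivAt ℝ (fun y => (F y : ℂ)) (a : ℂ) x u :=
  (Complex.ofRealCLM.hasFDerivAt.comp_hasDerivAt (0 : ℝ) hF)

lemma HasLineDerivAt.comp_real {F : V → ℝ} {a : ℝ} (hF : HasLineDerivAt ℝ F a x u) {h : ℝ → ℝ}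
    {d : ℝ} (hh : HasDerivAt h d (F x)) : HasLineDerivAt ℝ (fun y => h (F y)) (d * a) x u := by
  have h1 : HasDerivAt h d (F (x + (0 : ℝ) • u)) := by simpa using hh
  exact HasDerivAt.comp (0 : ℝ) h1 hF

lemma HasLineDerivAt.smul' {W : Type*} [NormedAddCommGroup W] [NormedSpace ℝ W] [NormedSpace ℂ W]
    [IsScalarTower ℝ ℂ W] {G : V → W} {b : W}
    (hF : HasLineDerivAt ℝ F a x u) (hG : HasLineDerivAt ℝ G b x u) :
    HasLineDerivAt ℝ (fun y => F y • G y) (F x • b + a • G x) x u := by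
  have := HasDerivAt.smul hF hG
  simp only [zero_smul, add_zero] at this
  exact this

end LineDeriv

/-! ### The Fubini-Study form in affine coordinates -/

namespace TautCompact

variable {m : ℕ}

/-- The Hermitian product of `ℂ^m`. -/
def herm (u v : Fin m → ℂ) : ℂ := ∑ j, u j * conj (v j)

lemma herm_add_left (u u' v : Fin m → ℂ) : herm (u + u') v = herm u v + herm u' v := by
  simp [herm, add_mul, Finset.sum_add_distrib]

lemma herm_smul_left (l : ℂ) (u v : Fin m → ℂ) : herm (l • u) v = l * herm u v := by
  simp [herm, Finset.mul_sum, mul_assoc]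

lemma conj_herm (u v : Fin m → ℂ) : conj (herm u v) = herm v u := by
  simp [herm, mul_comm]

lemma herm_add_right (u v v' : Fin m → ℂ) : herm u (v + v') = herm u v + herm u v' := by
  rw [← conj_herm, herm_add_left, map_add, conj_herm, conj_herm]

lemma herm_smul_right (l : ℂ) (u v : Fin m → ℂ) : herm u (l • v) = conj l * herm u v := by
  rw [← conj_herm, herm_smul_left, map_mul, conj_herm]

/-- The square `|z|²` of the Hermitian norm. -/
def normSqVec (z : Fin m → ℂ) : ℝ := ∑ j, ‖z j‖ ^ 2

lemma herm_self (z : Fin m → ℂ) : herm z z = normSqVec z := by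
  simp [herm, normSqVec, Complex.mul_conj, Complex.normSq_eq_norm_sq]

lemma normSqVec_nonneg (z : Fin m → ℂ) : 0 ≤ normSqVec z :=
  Finset.sum_nonneg fun _ _ => sq_nonneg _

lemma normSqVec_pos {z : Fin m → ℂ} (hz : z ≠ 0) : 0 < normSqVec z := sumSq_pos hz

lemma normSqVec_smul (l : ℂ) (z : Fin m → ℂ) : normSqVec (l • z) = ‖l‖ ^ 2 * normSqVec z := by
  simp [normSqVec, mul_pow, Finset.mul_sum]

/-- The derivative of the affine map `baseVec i`. -/
def baseDir (i : Fin m) : (Fin m → ℂ) →ₗ[ℂ] (Fin m → ℂ) where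
  toFun u := update u i 0
  map_add' u v := by
    funext j; rcases eq_or_ne j i with rfl | hj <;> simp [*]
  map_smul' l u := by
    funext j; rcases eq_or_ne j i with rfl | hj <;> simp [*]

lemma baseDir_apply (i : Fin m) (u : Fin m → ℂ) : baseDir i u = update u i 0 := rfl

lemma baseDir_self (i : Fin m) (u : Fin m → ℂ) : baseDir i u i = 0 := by simp [baseDir_apply]

lemma baseVec_add (i : Fin m) (c u : Fin m → ℂ) (s : ℝ) :
    baseVec i (c + s • u) = baseVec i c + s • baseDir i u := by
  funext j; rcases eq_or_ne j i with rfl | hj <;> simp [baseVec, baseDir_apply, *]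

lemma hasLineDerivAt_baseVec (i j : Fin m) (c u : Fin m → ℂ) :
    HasLineDerivAt ℝ (fun c => baseVec i c j) (baseDir i u j) c u := by
  unfold HasLineDerivAt
  simp only [baseVec_add]
  have := ((hasDerivAt_id (0 : ℝ)).ofReal_comp.mul_const (baseDir i u j)).const_add (baseVec i c j)
  simpa using this

/-- The function `N = |z|²` of the homogeneous coordinates `z = baseVec i c`. -/
def baseSq (i : Fin m) (c : Fin m → ℂ) : ℝ := normSqVec (baseVec i c)

lemma baseSq_pos (i : Fin m) (c : Fin m → ℂ) : 0 < baseSq i c := normSqVec_pos (baseVec_ne_zero i c)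

lemma baseSq_ne_zero (i : Fin m) (c : Fin m → ℂ) : (baseSq i c : ℂ) ≠ 0 :=
  Complex.ofReal_ne_zero.2 (baseSq_pos i c).ne'

/-- The complex-linear form `β = ∂ log N`. -/
def connForm (i : Fin m) (c : Fin m → ℂ) : (Fin m → ℂ) →ₗ[ℂ] ℂ where
  toFun u := herm (baseDir i u) (baseVec i c) / baseSq i c
  map_add' u v := by rw [map_add, herm_add_left, add_div]
  map_smul' l u := by rw [map_smul, herm_smul_left, mul_div_assoc]; rfl

lemma connForm_apply (i : Fin m) (c u : Fin m → ℂ) :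
    connForm i c u = herm (baseDir i u) (baseVec i c) / baseSq i c := rfl

/-- The Fubini-Study form `h = ∂∂̄ log N`, as a Hermitian form, complex-linear in the first
argument. -/
def fsForm (i : Fin m) (c u v : Fin m → ℂ) : ℂ :=
  herm (baseDir i u) (baseDir i v) / baseSq i c - connForm i c u * conj (connForm i c v)

lemma fsForm_add_left (i : Fin m) (c u u' v : Fin m → ℂ) :
    fsForm i c (u + u') v = fsForm i c u v + fsForm i c u' v := by
  simp only [fsForm, map_add, herm_add_left]; ring

lemma fsForm_smul_left (i : Fin m) (c : Fin m → ℂ) (l : ℂ) (u v : Fin m → ℂ) :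
    fsForm i c (l • u) v = l * fsForm i c u v := by
  simp only [fsForm, map_smul, herm_smul_left, smul_eq_mul]; ring

lemma conj_fsForm (i : Fin m) (c u v : Fin m → ℂ) : conj (fsForm i c u v) = fsForm i c v u := by
  simp only [fsForm, map_sub, map_div₀, conj_herm, Complex.conj_ofReal, map_mul, Complex.conj_conj]
  ring

lemma fsForm_add_right (i : Fin m) (c u v v' : Fin m → ℂ) :
    fsForm i c u (v + v') = fsForm i c u v + fsForm i c u v' := by
  rw [← conj_fsForm, fsForm_add_left, map_add, conj_fsForm, conj_fsForm]

lemma fsForm_smul_right (i : Fin m) (c : Fin m → ℂ) (l : ℂ) (u v : Fin m → ℂ) :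
    fsForm i c u (l • v) = conj l * fsForm i c u v := by
  rw [← conj_fsForm, fsForm_smul_left, map_mul, conj_fsForm]

lemma hasLineDerivAt_herm {Z W : (Fin m → ℂ) → Fin m → ℂ} {c u a b : Fin m → ℂ}
    (hZ : ∀ j, HasLineDerivAt ℝ (fun c => Z c j) (a j) c u)
    (hW : ∀ j, HasLineDerivAt ℝ (fun c => W c j) (b j) c u) :
    HasLineDerivAt ℝ (fun c => herm (Z c) (W c)) (herm a (W c) + herm (Z c) b) c u := by
  rw [herm, herm, ← Finset.sum_add_distrib]
  exact HasDerivAt.fun_sum fun j _ => (hZ j).mul' (hW j).conj'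

lemma hasLineDerivAt_const {F : Type*} [NormedAddCommGroup F] [NormedSpace ℝ F] (z : F)
    (c u : Fin m → ℂ) : HasLineDerivAt ℝ (fun _ => z) 0 c u := hasDerivAt_const _ _

lemma herm_baseVec (i : Fin m) (c u : Fin m → ℂ) :
    herm (baseDir i u) (baseVec i c) = baseSq i c * connForm i c u := by
  rw [connForm_apply, mul_div_cancel₀ _ (baseSq_ne_zero i c)]

lemma hasLineDerivAt_baseSq (i : Fin m) (c u : Fin m → ℂ) :
    HasLineDerivAt ℝ (fun c => (baseSq i c : ℂ))
      (baseSq i c * (connForm i c u + conj (connForm i c u))) c u := by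
  have h := hasLineDerivAt_herm (fun j => hasLineDerivAt_baseVec i j c u)
    (fun j => hasLineDerivAt_baseVec i j c u)
  simp only [herm_self] at h
  refine h.congr_deriv' ?_
  rw [← conj_herm (baseDir i u), herm_baseVec, map_mul, Complex.conj_ofReal]
  ring

/-- The derivative of `β = ∂ log N`: its antilinear part is the Fubini-Study form `∂∂̄ log N`, and
its linear part is `-β ⊗ β` because `z` is an affine function of `c`. -/
lemma hasLineDerivAt_connForm (i : Fin m) (c u v : Fin m → ℂ) :
    HasLineDerivAt ℝ (fun c => connForm i c v)
      (-(connForm i c u * connForm i c v) + fsForm i c v u) c u := by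
  have h1 := hasLineDerivAt_herm (fun j => hasLineDerivAt_const (baseDir i v j) c u)
    (fun j => hasLineDerivAt_baseVec i j c u)
  have h2 := h1.mul' ((hasLineDerivAt_baseSq i c u).inv' (baseSq_ne_zero i c))
  refine h2.congr_deriv' ?_
  have h0 := baseSq_ne_zero i c
  simp only [fsForm, herm_baseVec]
  have : herm (fun _ => (0 : ℂ)) (baseVec i c) = 0 := by simp [herm]
  rw [this]
  field_simp
  ring

lemma hasLineDerivAt_fsForm (i : Fin m) (c u v w : Fin m → ℂ) :
    HasLineDerivAt ℝ (fun c => fsForm i c v w)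
      (-(connForm i c u * fsForm i c v w) - connForm i c v * fsForm i c u w -
        conj (connForm i c u) * fsForm i c v w - conj (connForm i c w) * fsForm i c v u) c u := by
  have h1 := (((hasLineDerivAt_baseSq i c u).inv' (baseSq_ne_zero i c)).const_mul'
    (herm (baseDir i v) (baseDir i w)))
  have h2 := h1.sub' ((hasLineDerivAt_connForm i c u v).mul' (hasLineDerivAt_connForm i c u w).conj')
  refine h2.congr_deriv' ?_
  have h0 := baseSq_ne_zero i c
  simp only [map_add, map_neg, map_mul, conj_fsForm]
  simp only [fsForm]
  field_simp
  ring

end TautCompact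

/-! ### The metric in a chart -/

namespace TautCompact

variable {m : ℕ}

lemma contDiff_coord (j : Fin m) : ContDiff ℝ ∞ fun c : Fin m → ℂ => c j := contDiff_apply ℝ ℂ j

lemma contDiff_baseVec_real (i j : Fin m) : ContDiff ℝ ∞ fun c : Fin m → ℂ => baseVec i c j :=
  ((contDiff_baseVec i j).restrict_scalars ℝ).of_le le_top

lemma contDiff_conj {F : (Fin m → ℂ) → ℂ} (hF : ContDiff ℝ ∞ F) :
    ContDiff ℝ ∞ fun c => conj (F c) := Complex.conjCLE.contDiff.comp hF

lemma contDiff_baseSq (i : Fin m) : ContDiff ℝ ∞ (baseSq (m := m) i) :=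
  show ContDiff ℝ ∞ fun c => ∑ j, ‖baseVec i c j‖ ^ 2 from
    ContDiff.sum fun j _ => (contDiff_baseVec_real i j).norm_sq ℝ

lemma contDiff_ofReal {F : (Fin m → ℂ) → ℝ} (hF : ContDiff ℝ ∞ F) :
    ContDiff ℝ ∞ fun c => (F c : ℂ) := Complex.ofRealCLM.contDiff.comp hF

lemma contDiff_re {F : (Fin m → ℂ) → ℂ} (hF : ContDiff ℝ ∞ F) :
    ContDiff ℝ ∞ fun c => (F c).re := Complex.reCLM.contDiff.comp hF

lemma contDiff_div_baseSq (i : Fin m) {F : (Fin m → ℂ) → ℂ} (hF : ContDiff ℝ ∞ F) :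
    ContDiff ℝ ∞ fun c => F c / baseSq i c := by
  simp only [div_eq_mul_inv]
  exact hF.mul ((contDiff_ofReal (contDiff_baseSq i)).inv (baseSq_ne_zero i))

lemma contDiff_connForm (i : Fin m) (u : Fin m → ℂ) : ContDiff ℝ ∞ fun c => connForm i c u :=
  contDiff_div_baseSq i
    (ContDiff.sum fun j _ => contDiff_const.mul (contDiff_conj (contDiff_baseVec_real i j)))

lemma contDiff_fsForm (i : Fin m) (u v : Fin m → ℂ) : ContDiff ℝ ∞ fun c => fsForm i c u v :=
  (contDiff_div_baseSq i contDiff_const).sub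
    ((contDiff_connForm i u).mul (contDiff_conj (contDiff_connForm i v)))

/-- The factor `N^{±k}` of the squared fibre norm. -/
def fibreWeight (k : ℕ) (b : Bool) (N : ℝ) : ℝ := bif b then (N ^ k)⁻¹ else N ^ k

lemma fibreWeight_pos (k : ℕ) (b : Bool) {N : ℝ} (hN : 0 < N) : 0 < fibreWeight k b N := by
  cases b <;> simp only [fibreWeight, cond_true, cond_false] <;> positivity

lemma hasDerivAt_fibreWeight (k : ℕ) (b : Bool) {N : ℝ} (hN : 0 < N) :
    HasDerivAt (fibreWeight k b) (sgn b * k * fibreWeight k b N / N) N := by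
  have h1 := hasDerivAt_pow k N
  have h3 : (k : ℝ) * N ^ (k - 1) = k * N ^ k / N := by
    rcases k with _ | k
    · simp
    · rw [Nat.add_sub_cancel, pow_succ]; field_simp
  rw [h3] at h1
  cases b
  · refine h1.congr_deriv ?_
    simp [fibreWeight, sgn]
  · refine (h1.inv (pow_pos hN k).ne').congr_deriv ?_
    simp only [fibreWeight, sgn, cond_true]
    field_simp

/-- The squared fibre norm `s = |ζ|² N^{±k}` of the point with coordinates `c`. -/
def fibreSq (k : ℕ) (i : Fin m) (b : Bool) (c : Fin m → ℂ) : ℝ :=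
  ‖c i‖ ^ 2 * fibreWeight k b (baseSq i c)

lemma fibreSq_nonneg (k : ℕ) (i : Fin m) (b : Bool) (c : Fin m → ℂ) : 0 ≤ fibreSq k i b c :=
  mul_nonneg (sq_nonneg _) (fibreWeight_pos k b (baseSq_pos i c)).le

lemma fibreSq_pos (k : ℕ) {i : Fin m} (b : Bool) {c : Fin m → ℂ} (hc : c i ≠ 0) :
    0 < fibreSq k i b c :=
  mul_pos (pow_pos (norm_pos_iff.2 hc) 2) (fibreWeight_pos k b (baseSq_pos i c))

lemma contDiff_fibreWeight (k : ℕ) (i : Fin m) (b : Bool) :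
    ContDiff ℝ ∞ fun c : Fin m → ℂ => fibreWeight k b (baseSq i c) := by
  cases b
  · exact (contDiff_baseSq i).pow k
  · exact ((contDiff_baseSq i).pow k).inv fun c => (pow_pos (baseSq_pos i c) k).ne'

lemma contDiff_fibreSq (k : ℕ) (i : Fin m) (b : Bool) : ContDiff ℝ ∞ (fibreSq k i b) :=
  ((contDiff_coord i).norm_sq ℝ).mul (contDiff_fibreWeight k i b)

/-- The form `θ = ±dζ/(kζ) + ∂ log N`, that is, `∂ log s / (±k)`. It is meaningful only where
`ζ = c i` is nonzero. -/
def vertForm (k : ℕ) (i : Fin m) (b : Bool) (c : Fin m → ℂ) : (Fin m → ℂ) →ₗ[ℂ] ℂ :=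
  ((sgn b : ℂ) / (k * c i)) • LinearMap.proj i + connForm i c

lemma vertForm_apply (k : ℕ) (i : Fin m) (b : Bool) (c u : Fin m → ℂ) :
    vertForm k i b c u = (sgn b : ℂ) / (k * c i) * u i + connForm i c u := rfl

/-- The multiple `kζ θ` of the form `θ = vertForm`, which is smooth on the whole chart. -/
def regForm (k : ℕ) (i : Fin m) (b : Bool) (c : Fin m → ℂ) : (Fin m → ℂ) →ₗ[ℂ] ℂ :=
  (sgn b : ℂ) • LinearMap.proj i + (k * c i) • connForm i c

lemma regForm_apply (k : ℕ) (i : Fin m) (b : Bool) (c u : Fin m → ℂ) :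
    regForm k i b c u = (sgn b : ℂ) * u i + k * c i * connForm i c u := rfl

lemma regForm_eq {k : ℕ} (hk : 0 < k) {i : Fin m} (b : Bool) {c : Fin m → ℂ} (hc : c i ≠ 0)
    (u : Fin m → ℂ) : regForm k i b c u = k * c i * vertForm k i b c u := by
  have : (k : ℂ) ≠ 0 := Nat.cast_ne_zero.2 hk.ne'
  rw [regForm_apply, vertForm_apply]
  field_simp

lemma contDiff_regForm (k : ℕ) (i : Fin m) (b : Bool) (u : Fin m → ℂ) :
    ContDiff ℝ ∞ fun c => regForm k i b c u :=
  contDiff_const.add ((contDiff_const.mul (contDiff_coord i)).mul (contDiff_connForm i u))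

/-- The function `t` in the chart `(i, b)`. -/
def tFun (k : ℕ) (S : Bool → ℝ → ℝ) (i : Fin m) (b : Bool) (c : Fin m → ℂ) : ℝ :=
  S b (fibreSq k i b c)

/-- The quotient `φ(t) / |kζ|²`, written by means of `k s dt/ds = ±φ(t)` in a form which is smooth
also where `ζ = 0`. -/
def vertWeight (k : ℕ) (S : Bool → ℝ → ℝ) (i : Fin m) (b : Bool) (c : Fin m → ℂ) : ℝ :=
  sgn b * derivWithin (S b) (Ici 0) (fibreSq k i b c) * fibreWeight k b (baseSq i c) / k

/-- The metric `2e^t Re (h + φ(t) θ ⊗ θ̄)` in the chart `(i, b)`, where `h = fsForm` and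
`θ = vertForm`. It is written with `kζ θ` and `φ(t) / |kζ|²` so as to include the points with
`ζ = 0`. -/
def chartMetric (k : ℕ) (S : Bool → ℝ → ℝ) (i : Fin m) (b : Bool) (c : Fin m → ℂ) :
    (Fin m → ℂ) →L[ℝ] (Fin m → ℂ) →L[ℝ] ℝ :=
  (LinearMap.mk₂ ℝ (fun u v => 2 * Real.exp (tFun k S i b c) * (fsForm i c u v +
      vertWeight k S i b c * (regForm k i b c u * conj (regForm k i b c v))).re)
    (fun u u' v => by
      simp only [fsForm_add_left, map_add, add_mul, mul_add, Complex.add_re]; ring)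
    (fun l u v => by
      rw [← Complex.coe_smul l u, fsForm_smul_left, map_smul, smul_eq_mul, smul_eq_mul,
        mul_assoc (l : ℂ), mul_left_comm _ (l : ℂ), ← mul_add, Complex.re_ofReal_mul]
      ring)
    (fun u v v' => by
      simp only [fsForm_add_right, map_add, mul_add, Complex.add_re]; ring)
    (fun l u v => by
      rw [← Complex.coe_smul l v, fsForm_smul_right, map_smul, smul_eq_mul, smul_eq_mul, map_mul,
        Complex.conj_ofReal, mul_left_comm _ (l : ℂ), mul_left_comm _ (l : ℂ), ← mul_add,
        Complex.re_ofReal_mul]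
      ring)).toContinuousBilinearMap

lemma chartMetric_apply (k : ℕ) (S : Bool → ℝ → ℝ) (i : Fin m) (b : Bool) (c u v : Fin m → ℂ) :
    chartMetric k S i b c u v = 2 * Real.exp (tFun k S i b c) * (fsForm i c u v +
      vertWeight k S i b c * (regForm k i b c u * conj (regForm k i b c v))).re := rfl

/-- The Fubini-Study form is positive semidefinite, by the inequality of Cauchy and Schwarz. -/
lemma norm_sq_le_fsForm (i : Fin m) (c u : Fin m → ℂ) :
    normSqVec (baseDir i u) / baseSq i c ^ 2 ≤ (fsForm i c u u).re := by
  have hN := baseSq_pos i c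
  set w := baseDir i c with hw
  have h1 : herm (baseDir i u) (baseVec i c) = herm (baseDir i u) w := by
    refine Finset.sum_congr rfl fun j _ => ?_
    rcases eq_or_ne j i with rfl | hj
    · rw [baseDir_self]; simp
    · simp [hw, baseDir_apply, baseVec, hj]
  have h2 : baseSq i c = 1 + normSqVec w := by
    rw [baseSq, normSqVec, normSqVec, ← Finset.add_sum_erase _ _ (Finset.mem_univ i),
      ← Finset.add_sum_erase _ (fun j => ‖w j‖ ^ 2) (Finset.mem_univ i), hw, baseDir_self]
    simp only [baseVec, update_self, norm_one, one_pow, norm_zero]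
    rw [zero_pow two_ne_zero, zero_add]
    congr 1
    refine Finset.sum_congr rfl fun j hj => ?_
    rw [baseDir_apply, update_of_ne (Finset.ne_of_mem_erase hj),
      update_of_ne (Finset.ne_of_mem_erase hj)]
  have h3 : ‖herm (baseDir i u) w‖ ^ 2 ≤ normSqVec (baseDir i u) * normSqVec w := by
    refine le_trans (pow_le_pow_left₀ (norm_nonneg _) (norm_sum_le _ _) 2) ?_
    simp only [norm_mul, RCLike.norm_conj]
    exact Finset.sum_mul_sq_le_sq_mul_sq _ _ _
  have h4 : (fsForm i c u u).re = normSqVec (baseDir i u) / baseSq i c -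
      ‖herm (baseDir i u) w‖ ^ 2 / baseSq i c ^ 2 := by
    rw [fsForm, connForm_apply, h1, herm_self, Complex.mul_conj, Complex.normSq_eq_norm_sq,
      norm_div, Complex.norm_real, Real.norm_of_nonneg hN.le, div_pow, ← Complex.ofReal_div,
      ← Complex.ofReal_sub, Complex.ofReal_re]
  rw [h4, div_sub_div _ _ hN.ne' (pow_pos hN 2).ne', div_le_div_iff₀ (by positivity) (by positivity)]
  have h5 : normSqVec (baseDir i u) * baseSq i c ≤
      normSqVec (baseDir i u) * baseSq i c ^ 2 - baseSq i c * ‖herm (baseDir i u) w‖ ^ 2 := by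
    rw [h2] at hN ⊢
    nlinarith
  nlinarith [mul_le_mul_of_nonneg_right h5 (pow_pos hN 2).le]

section Metric

variable {k : ℕ} {T : ℝ} {φ : ℝ → ℝ} {S : Bool → ℝ → ℝ} (hk : 0 < k) (hS : Profile k T φ S)
include hS

lemma contDiff_tFun (i : Fin m) (b : Bool) : ContDiff ℝ ∞ (tFun k S i b) := by
  rw [← contDiffOn_univ]
  exact (hS.smooth b).comp (contDiff_fibreSq k i b).contDiffOn fun c _ => fibreSq_nonneg k i b c

lemma contDiff_vertWeight (i : Fin m) (b : Bool) : ContDiff ℝ ∞ (vertWeight k S i b) := by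
  have h1 : ContDiff ℝ ∞ fun c : Fin m → ℂ =>
      derivWithin (S b) (Ici 0) (fibreSq k i b c) := by
    rw [← contDiffOn_univ]
    exact ((hS.smooth b).derivWithin (uniqueDiffOn_Ici 0) (by simp)).comp
      (contDiff_fibreSq k i b).contDiffOn fun c _ => fibreSq_nonneg k i b c
  exact ((contDiff_const.mul h1).mul (contDiff_fibreWeight k i b)).div_const _

include hk in
lemma vertWeight_pos (i : Fin m) (b : Bool) (c : Fin m → ℂ) : 0 < vertWeight k S i b c :=
  div_pos (mul_pos (hS.deriv_pos b _ (fibreSq_nonneg k i b c))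
    (fibreWeight_pos k b (baseSq_pos i c))) (Nat.cast_pos.2 hk)

include hk in
/-- The equation `k s dt/ds = ±φ(t)` in terms of the coordinate `ζ = c i`. -/
lemma vertWeight_mul (i : Fin m) (b : Bool) (c : Fin m → ℂ) :
    vertWeight k S i b c * ‖(k : ℂ) * c i‖ ^ 2 = φ (tFun k S i b c) := by
  have h := hS.deriv_eq b _ (fibreSq_nonneg k i b c)
  have hk' : (k : ℝ) ≠ 0 := Nat.cast_ne_zero.2 hk.ne'
  have h2 : sgn b * (k * (fibreSq k i b c * derivWithin (S b) (Ici 0) (fibreSq k i b c))) =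
      φ (tFun k S i b c) := by
    rw [h, ← mul_assoc, sgn_mul_self, one_mul]; rfl
  rw [← h2, vertWeight, norm_mul, mul_pow, Complex.norm_natCast]
  nth_rewrite 2 [fibreSq]
  field_simp

include hk in
lemma phi_tFun_ne_zero {i : Fin m} (b : Bool) {c : Fin m → ℂ} (hc : c i ≠ 0) :
    φ (tFun k S i b c) ≠ 0 := by
  rw [← vertWeight_mul hk hS i b c]
  refine (mul_pos (vertWeight_pos hk hS i b c) (pow_pos (norm_pos_iff.2 ?_) 2)).ne'
  exact mul_ne_zero (Nat.cast_ne_zero.2 hk.ne') hc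

lemma isMetricOn_chartMetric (hk : 0 < k) (i : Fin m) (b : Bool) :
    Coord.IsMetricOn (chartMetric k S i b) univ where
  isOpen := isOpen_univ
  smooth := by
    rw [contDiffOn_univ, contDiff_clm_apply_iff]
    intro u
    rw [contDiff_clm_apply_iff]
    intro v
    refine (contDiff_const.mul (Real.contDiff_exp.comp (contDiff_tFun hS i b))).mul (contDiff_re ?_)
    exact (contDiff_fsForm i u v).add ((contDiff_ofReal (contDiff_vertWeight hS i b)).mul
      ((contDiff_regForm k i b u).mul (contDiff_conj (contDiff_regForm k i b v))))
  symm c _ u v := by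
    rw [chartMetric_apply, chartMetric_apply, ← Complex.conj_re]
    simp only [map_add, map_mul, conj_fsForm, Complex.conj_ofReal, Complex.conj_conj]
    ring_nf
  pos c _ u hu := by
    rw [chartMetric_apply]
    refine mul_pos (by positivity) ?_
    have h1 := norm_sq_le_fsForm i c u
    have hN := baseSq_pos i c
    have hw := vertWeight_pos hk hS i b c
    have h2 : (fsForm i c u u + vertWeight k S i b c *
        (regForm k i b c u * conj (regForm k i b c u))).re =
        (fsForm i c u u).re + vertWeight k S i b c * ‖regForm k i b c u‖ ^ 2 := by
      rw [Complex.mul_conj, Complex.normSq_eq_norm_sq, ← Complex.ofReal_mul, Complex.add_re,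
        Complex.ofReal_re]
    rw [h2]
    by_cases h0 : baseDir i u = 0
    · have h3 : u i ≠ 0 := fun h => hu <| by
        funext j
        rcases eq_or_ne j i with rfl | hj
        · exact h
        · have := congrFun h0 j; simpa [baseDir_apply, hj] using this
      have h4 : regForm k i b c u = sgn b * u i := by
        rw [regForm_apply, connForm_apply, h0]; simp [herm]
      have h5 : 0 < ‖regForm k i b c u‖ := by
        rw [h4, norm_pos_iff]
        refine mul_ne_zero ?_ h3
        cases b <;> simp [sgn]
      have h6 : 0 ≤ (fsForm i c u u).re :=
        le_trans (div_nonneg (normSqVec_nonneg _) (sq_nonneg _)) h1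
      have := mul_pos hw (pow_pos h5 2)
      linarith
    · have h3 : 0 < normSqVec (baseDir i u) / baseSq i c ^ 2 :=
        div_pos (normSqVec_pos h0) (pow_pos hN 2)
      have := mul_nonneg hw.le (sq_nonneg ‖regForm k i b c u‖)
      linarith

include hk in
/-- Off the zero set of `ζ`, the metric has the form `2e^t Re (h + φ θ ⊗ θ̄)`. -/
lemma chartMetric_eq {i : Fin m} (b : Bool) {c : Fin m → ℂ} (hc : c i ≠ 0) (u v : Fin m → ℂ) :
    chartMetric k S i b c u v = 2 * (Real.exp (tFun k S i b c) * (fsForm i c u v +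
      φ (tFun k S i b c) * (vertForm k i b c u * conj (vertForm k i b c v))) : ℂ).re := by
  rw [chartMetric_apply, mul_assoc, Complex.re_ofReal_mul]
  congr 4
  rw [regForm_eq hk b hc, regForm_eq hk b hc, ← vertWeight_mul hk hS i b c, Complex.ofReal_mul,
    ← Complex.normSq_eq_norm_sq, ← Complex.mul_conj, map_mul]
  ring

omit hS in
lemma hasLineDerivAt_coord (j : Fin m) (c u : Fin m → ℂ) :
    HasLineDerivAt ℝ (fun c => c j) (u j) c u := by
  unfold HasLineDerivAt
  have := ((hasDerivAt_id (0 : ℝ)).ofReal_comp.mul_const (u j)).const_add (c j)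
  simpa using this

omit hS in
/-- `ds = ±k s · 2 Re θ`. -/
lemma hasLineDerivAt_fibreSq (hk : 0 < k) {i : Fin m} (b : Bool) {c : Fin m → ℂ} (hc : c i ≠ 0)
    (u : Fin m → ℂ) : HasLineDerivAt ℝ (fibreSq k i b)
      (sgn b * k * fibreSq k i b c * (2 * (vertForm k i b c u).re)) c u := by
  have hN := baseSq_pos i c
  have hk' : (k : ℂ) ≠ 0 := Nat.cast_ne_zero.2 hk.ne'
  have h1 : HasLineDerivAt ℝ (baseSq i) (baseSq i c * (2 * (connForm i c u).re)) c u := by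
    refine (hasLineDerivAt_baseSq i c u).re'.congr_deriv' ?_
    rw [Complex.re_ofReal_mul, Complex.add_re, Complex.conj_re]; ring
  have h2 := ((h1.comp_real (hasDerivAt_fibreWeight k b hN)).ofReal'.mul'
    ((hasLineDerivAt_coord i c u).mul' (hasLineDerivAt_coord i c u).conj')).re'
  have h3 : (fun c : Fin m → ℂ => ((fibreWeight k b (baseSq i c) : ℂ) * (c i * conj (c i))).re) =
      fibreSq k i b := by
    funext c
    rw [Complex.mul_conj, Complex.normSq_eq_norm_sq, ← Complex.ofReal_mul, Complex.ofReal_re,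
      fibreSq, mul_comm]
  rw [h3] at h2
  refine h2.congr_deriv' ?_
  have h4 : sgn b * k * (vertForm k i b c u).re * ‖c i‖ ^ 2 =
      (u i * conj (c i)).re + sgn b * k * (connForm i c u).re * ‖c i‖ ^ 2 := by
    have h5 : (sgn b * k * vertForm k i b c u * (c i * conj (c i)) : ℂ) =
        u i * conj (c i) + sgn b * k * connForm i c u * (c i * conj (c i)) := by
      have h6 : (sgn b : ℂ) * sgn b = 1 := by exact_mod_cast sgn_mul_self b
      rw [vertForm_apply]
      field_simp
      linear_combination (u i) * conj (c i) * h6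
    have h7 := congrArg Complex.re h5
    rw [Complex.mul_conj, Complex.normSq_eq_norm_sq, Complex.add_re, Complex.re_mul_ofReal,
      Complex.re_mul_ofReal, ← Complex.ofReal_natCast, ← Complex.ofReal_mul, Complex.re_ofReal_mul,
      Complex.re_ofReal_mul] at h7
    exact h7
  have h8 : (u i * conj (c i) + c i * conj (u i)).re = 2 * (u i * conj (c i)).re := by
    simp only [Complex.add_re, Complex.mul_re, Complex.conj_re, Complex.conj_im]; ring
  rw [Complex.mul_conj, Complex.normSq_eq_norm_sq, Complex.add_re, ← Complex.ofReal_mul,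
    Complex.ofReal_re, Complex.re_ofReal_mul, h8, fibreSq]
  field_simp
  linear_combination -fibreWeight k b (baseSq i c) * h4

include hk in
/-- `∂t = φ θ`. -/
lemma hasLineDerivAt_tFun {i : Fin m} (b : Bool) {c : Fin m → ℂ} (hc : c i ≠ 0)
    (u : Fin m → ℂ) : HasLineDerivAt ℝ (tFun k S i b)
      (φ (tFun k S i b c) * (2 * (vertForm k i b c u).re)) c u := by
  have hs := fibreSq_pos k b hc
  have h1 : HasDerivAt (S b) (derivWithin (S b) (Ici 0) (fibreSq k i b c)) (fibreSq k i b c) :=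
    (((hS.smooth b) _ hs.le).differentiableWithinAt (by simp)).hasDerivWithinAt.hasDerivAt
      (Ici_mem_nhds hs)
  refine ((hasLineDerivAt_fibreSq hk b hc u).comp_real h1).congr_deriv' ?_
  have h2 := hS.deriv_eq b _ hs.le
  have h3 : φ (tFun k S i b c) =
      sgn b * (k * (fibreSq k i b c * derivWithin (S b) (Ici 0) (fibreSq k i b c))) := by
    rw [h2, ← mul_assoc, sgn_mul_self, one_mul]; rfl
  rw [h3]
  ring

include hk in
/-- The derivative of a function of `t`. -/
lemma hasLineDerivAt_comp_tFun {i : Fin m} (b : Bool) {c : Fin m → ℂ} (hc : c i ≠ 0)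
    (u : Fin m → ℂ) {h : ℝ → ℝ} {d : ℝ} (hh : HasDerivAt h d (tFun k S i b c)) :
    HasLineDerivAt ℝ (fun c => (h (tFun k S i b c) : ℂ))
      (d * φ (tFun k S i b c) * (vertForm k i b c u + conj (vertForm k i b c u))) c u := by
  refine ((hasLineDerivAt_tFun hk hS b hc u).comp_real hh).ofReal'.congr_deriv' ?_
  rw [Complex.add_conj]
  push_cast
  ring

omit hS in
/-- The derivative of `θ = ±dζ/(kζ) + β`: the first term comes from the holomorphic form
`θ - β = ±dζ/(kζ)`, the others from `β`. -/
lemma hasLineDerivAt_vertForm (hk : 0 < k) {i : Fin m} (b : Bool) {c : Fin m → ℂ} (hc : c i ≠ 0)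
    (u v : Fin m → ℂ) : HasLineDerivAt ℝ (fun c => vertForm k i b c v)
      (-(sgn b * k * ((vertForm k i b c u - connForm i c u) *
        (vertForm k i b c v - connForm i c v))) -
        connForm i c u * connForm i c v + fsForm i c v u) c u := by
  have hk' : (k : ℂ) ≠ 0 := Nat.cast_ne_zero.2 hk.ne'
  have h6 : (sgn b : ℂ) * sgn b = 1 := by exact_mod_cast sgn_mul_self b
  have h1 := (((hasLineDerivAt_coord i c u).const_mul' (k : ℂ)).inv'
    (mul_ne_zero hk' hc)).const_mul' (sgn b * v i : ℂ)
  have h2 := h1.add' (hasLineDerivAt_connForm i c u v)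
  have h3 : (fun c : Fin m → ℂ => sgn b * v i * (k * c i : ℂ)⁻¹ + connForm i c v) =
      fun c => vertForm k i b c v := by
    funext c; rw [vertForm_apply]; ring
  rw [h3] at h2
  refine h2.congr_deriv' ?_
  simp only [vertForm_apply, add_sub_cancel_right]
  field_simp
  linear_combination (v i * u i * sgn b) * h6

/-- The holomorphic vertical vector field `E = ±kζ ∂/∂ζ`, for which `θ(E) = 1` where `ζ ≠ 0`. -/
def eulerField (k : ℕ) (i : Fin m) (b : Bool) (c : Fin m → ℂ) : Fin m → ℂ :=
  (sgn b * k * c i : ℂ) • Pi.single i 1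

omit hS

lemma connForm_eulerField (i : Fin m) (b : Bool) (c : Fin m → ℂ) :
    connForm i c (eulerField k i b c) = 0 := by
  have : baseDir i (eulerField k i b c) = 0 := by
    funext j
    rcases eq_or_ne j i with rfl | hj <;> simp [baseDir_apply, eulerField, *]
  rw [connForm_apply, this]; simp [herm]

lemma fsForm_eulerField_left (i : Fin m) (b : Bool) (c v : Fin m → ℂ) :
    fsForm i c (eulerField k i b c) v = 0 := by
  have : baseDir i (eulerField k i b c) = 0 := by
    funext j
    rcases eq_or_ne j i with rfl | hj <;> simp [baseDir_apply, eulerField, *]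
  rw [fsForm, connForm_eulerField, this]; simp [herm]

lemma vertForm_eulerField (hk : 0 < k) {i : Fin m} (b : Bool) {c : Fin m → ℂ} (hc : c i ≠ 0) :
    vertForm k i b c (eulerField k i b c) = 1 := by
  have hk' : (k : ℂ) ≠ 0 := Nat.cast_ne_zero.2 hk.ne'
  have h6 : (sgn b : ℂ) * sgn b = 1 := by exact_mod_cast sgn_mul_self b
  rw [vertForm_apply, connForm_eulerField]
  simp only [eulerField, Pi.smul_apply, Pi.single_eq_same, smul_eq_mul, mul_one, add_zero]
  field_simp
  linear_combination h6

lemma hasLineDerivAt_eulerField (hk : 0 < k) {i : Fin m} (b : Bool) {c : Fin m → ℂ} (hc : c i ≠ 0)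
    (u : Fin m → ℂ) : HasLineDerivAt ℝ (eulerField k i b)
      ((sgn b * k * (vertForm k i b c u - connForm i c u)) • eulerField k i b c) c u := by
  have hk' : (k : ℂ) ≠ 0 := Nat.cast_ne_zero.2 hk.ne'
  have h6 : (sgn b : ℂ) * sgn b = 1 := by exact_mod_cast sgn_mul_self b
  have h1 := ((hasLineDerivAt_coord i c u).const_mul' (sgn b * k : ℂ)).smul'
    (hasLineDerivAt_const (Pi.single i 1 : Fin m → ℂ) c u)
  refine h1.congr_deriv' ?_
  rw [smul_zero, zero_add, eulerField, smul_smul]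
  congr 1
  rw [vertForm_apply]
  field_simp
  linear_combination -(sgn b * u i) * h6

end Metric

end TautCompact

/-! ### The Levi-Civita connection in a chart -/

namespace TautCompact

variable {m k : ℕ} {T : ℝ} {φ : ℝ → ℝ} {S : Bool → ℝ → ℝ}

/-- The form `λ = φ(t) θ - β` in the Christoffel symbols, where `θ = vertForm` and `β = connForm`.
-/
def lamForm (k : ℕ) (φ : ℝ → ℝ) (S : Bool → ℝ → ℝ) (i : Fin m) (b : Bool) (c u : Fin m → ℂ) : ℂ :=
  φ (tFun k S i b c) * vertForm k i b c u - connForm i c u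

/-- The coefficient `C(u, v)` of the field `E = eulerField` in the Christoffel symbols. -/
def vertCoef (k : ℕ) (T : ℝ) (φ : ℝ → ℝ) (S : Bool → ℝ → ℝ) (i : Fin m) (b : Bool)
    (c u v : Fin m → ℂ) : ℂ :=
  (dot T φ (tFun k S i b c) - φ (tFun k S i b c)) * (vertForm k i b c u * vertForm k i b c v) +
    vertForm k i b c u * connForm i c v + connForm i c u * vertForm k i b c v -
    connForm i c u * connForm i c v - sgn b * k * ((vertForm k i b c u - connForm i c u) *
      (vertForm k i b c v - connForm i c v))

/-- The Christoffel symbols `Γ(u, v) = λ(u) v + λ(v) u + C(u, v) E` of the metric where `ζ ≠ 0`.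
They are complex-bilinear, the metric being Kähler. -/
def chartGamma (k : ℕ) (T : ℝ) (φ : ℝ → ℝ) (S : Bool → ℝ → ℝ) (i : Fin m) (b : Bool)
    (c u v : Fin m → ℂ) : Fin m → ℂ :=
  lamForm k φ S i b c u • v + lamForm k φ S i b c v • u +
    vertCoef k T φ S i b c u v • eulerField k i b c

lemma chartGamma_symm (i : Fin m) (b : Bool) (c u v : Fin m → ℂ) :
    chartGamma k T φ S i b c u v = chartGamma k T φ S i b c v u := by
  have : vertCoef k T φ S i b c u v = vertCoef k T φ S i b c v u := by
    simp only [vertCoef]; ring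
  rw [chartGamma, chartGamma, this, add_comm (lamForm k φ S i b c u • v)]

lemma chartGamma_smul_right (i : Fin m) (b : Bool) (c u v : Fin m → ℂ) (l : ℂ) :
    chartGamma k T φ S i b c u (l • v) = l • chartGamma k T φ S i b c u v := by
  simp only [chartGamma, lamForm, vertCoef, map_smul, smul_eq_mul]
  module

lemma vertForm_chartGamma (hk : 0 < k) {i : Fin m} (b : Bool) {c : Fin m → ℂ} (hc : c i ≠ 0)
    (u v : Fin m → ℂ) : vertForm k i b c (chartGamma k T φ S i b c u v) =
      lamForm k φ S i b c u * vertForm k i b c v + lamForm k φ S i b c v * vertForm k i b c u +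
      vertCoef k T φ S i b c u v := by
  simp only [chartGamma, map_add, map_smul, vertForm_eulerField hk b hc, smul_eq_mul, mul_one]

lemma connForm_chartGamma (i : Fin m) (b : Bool) (c u v : Fin m → ℂ) :
    connForm i c (chartGamma k T φ S i b c u v) =
      lamForm k φ S i b c u * connForm i c v + lamForm k φ S i b c v * connForm i c u := by
  simp only [chartGamma, map_add, map_smul, connForm_eulerField, smul_eq_mul, mul_zero, add_zero]

lemma fsForm_chartGamma (i : Fin m) (b : Bool) (c u v w : Fin m → ℂ) :
    fsForm i c (chartGamma k T φ S i b c u v) w =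
      lamForm k φ S i b c u * fsForm i c v w + lamForm k φ S i b c v * fsForm i c u w := by
  simp only [chartGamma, fsForm_add_left, fsForm_smul_left, fsForm_eulerField_left, mul_zero,
    add_zero]

lemma isOpen_coord_ne_zero (i : Fin m) : IsOpen {c : Fin m → ℂ | c i ≠ 0} :=
  isOpen_ne_fun (continuous_apply i) continuous_const

lemma eventually_coord_ne_zero {i : Fin m} {c : Fin m → ℂ} (hc : c i ≠ 0) :
    ∀ᶠ y in 𝓝 c, y i ≠ 0 := (isOpen_coord_ne_zero i).mem_nhds hc

section

variable (hk : 0 < k) (hS : Profile k T φ S) (hT : 0 < T) (hφ : ContDiffOn ℝ ∞ φ (Icc 0 T))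
include hk hS

omit hk in
lemma tFun_mem_Ioo {i : Fin m} (b : Bool) {c : Fin m → ℂ} (hc : c i ≠ 0) :
    tFun k S i b c ∈ Ioo 0 T := hS.mem b _ (fibreSq_pos k b hc)

omit hk hS in
lemma hasDerivAt_dot {h : ℝ → ℝ} (hh : ContDiffOn ℝ ∞ h (Icc 0 T)) {t : ℝ} (ht : t ∈ Ioo 0 T) :
    HasDerivAt h (dot T h t) t :=
  (hasDerivWithinAt_dot hh (Ioo_subset_Icc_self ht)).hasDerivAt (Icc_mem_nhds ht.1 ht.2)

lemma hasLineDerivAt_exp_tFun {i : Fin m} (b : Bool) {c : Fin m → ℂ} (hc : c i ≠ 0)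
    (u : Fin m → ℂ) : HasLineDerivAt ℝ (fun c => (Real.exp (tFun k S i b c) : ℂ))
      (Real.exp (tFun k S i b c) * φ (tFun k S i b c) *
        (vertForm k i b c u + conj (vertForm k i b c u))) c u :=
  hasLineDerivAt_comp_tFun hk hS b hc u (Real.hasDerivAt_exp _)

include hφ

lemma hasLineDerivAt_phi {i : Fin m} (b : Bool) {c : Fin m → ℂ} (hc : c i ≠ 0)
    (u : Fin m → ℂ) : HasLineDerivAt ℝ (fun c => (φ (tFun k S i b c) : ℂ))
      (dot T φ (tFun k S i b c) * φ (tFun k S i b c) *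
        (vertForm k i b c u + conj (vertForm k i b c u))) c u :=
  hasLineDerivAt_comp_tFun hk hS b hc u (hasDerivAt_dot hφ (tFun_mem_Ioo hS b hc))

/-- The Levi-Civita connection where `ζ ≠ 0`: the symmetric symbols `Γ` satisfy
`(D_z G)(u, v) = G(Γ(z, u), v) + G(u, Γ(z, v))`, which determines them. -/
lemma christoffel_chartMetric {i : Fin m} (b : Bool) {c : Fin m → ℂ} (hc : c i ≠ 0)
    (u v : Fin m → ℂ) : Coord.christoffel (chartMetric k S i b) c u v =
      chartGamma k T φ S i b c u v := by
  have hG := isMetricOn_chartMetric hS hk i b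
  refine hG.christoffel_eq (mem_univ c) _ (chartGamma_symm i b c) (fun z u v => ?_) u v
  rw [Coord.fderiv_bilin_apply (hG.differentiableAt (mem_univ c))]
  have h1 : (fun y => chartMetric k S i b y u v) =ᶠ[𝓝 c] fun y =>
      2 * (Real.exp (tFun k S i b y) * (fsForm i y u v +
        φ (tFun k S i b y) * (vertForm k i b y u * conj (vertForm k i b y v))) : ℂ).re := by
    filter_upwards [eventually_coord_ne_zero hc] with y hy using chartMetric_eq hk hS b hy u v
  have h2 : DifferentiableAt ℝ (fun y => chartMetric k S i b y u v) c :=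
    ((contDiff_clm_apply_iff.1 ((contDiff_clm_apply_iff.1
      (contDiffOn_univ.1 hG.smooth)) u)) v).differentiable (by simp) c
  have h3 := ((hasLineDerivAt_exp_tFun hk hS b hc z).mul' ((hasLineDerivAt_fsForm i c z u v).add'
    ((hasLineDerivAt_phi hk hS hφ b hc z).mul' ((hasLineDerivAt_vertForm hk b hc z u).mul'
      (hasLineDerivAt_vertForm hk b hc z v).conj')))).re'
  have h4 := HasDerivAt.const_mul (2 : ℝ) h3
  rw [h1.fderiv_eq, fderiv_eq_of_hasLineDerivAt (h2.congr_of_eventuallyEq h1.symm) h4,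
    chartMetric_eq hk hS b hc, chartMetric_eq hk hS b hc, ← mul_add, ← Complex.add_re]
  congr 2
  rw [← conj_fsForm i c (chartGamma k T φ S i b c z v) u]
  simp only [vertForm_chartGamma hk b hc, fsForm_chartGamma, map_add, map_sub, map_neg, map_mul,
    conj_fsForm, Complex.conj_ofReal, Complex.conj_natCast, lamForm, vertCoef]
  ring

end

end TautCompact

/-! ### The curvature in a chart -/

section RealTrace

variable {m : ℕ}

lemma trace_restrictScalars_eq (f : (Fin m → ℂ) →ₗ[ℝ] (Fin m → ℂ)) :
    LinearMap.trace ℝ _ f = ∑ j, ((f (Pi.single j 1) j).re + (f (Pi.single j Complex.I) j).im) := by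
  rw [LinearMap.trace_eq_matrix_trace ℝ
    (Pi.basis fun _ : Fin m => Complex.basisOneI), Matrix.trace, Fintype.sum_sigma]
  refine Finset.sum_congr rfl fun j _ => ?_
  rw [Fin.sum_univ_two]
  simp [LinearMap.toMatrix_apply, Pi.basis_repr]

/-- The real trace of the sum of a complex-linear and a complex-antilinear endomorphism is twice
the real part of the complex trace of the former. -/
lemma trace_eq_two_mul_re (f : (Fin m → ℂ) →ₗ[ℝ] (Fin m → ℂ)) (f₁ : (Fin m → ℂ) →ₗ[ℂ] (Fin m → ℂ))
    (f₂ : (Fin m → ℂ) → Fin m → ℂ) (h₂ : ∀ u, f₂ (Complex.I • u) = -(Complex.I • f₂ u))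
    (h : ∀ u, f u = f₁ u + f₂ u) :
    LinearMap.trace ℝ _ f = 2 * (LinearMap.trace ℂ _ f₁).re := by
  rw [trace_restrictScalars_eq, LinearMap.trace_eq_matrix_trace ℂ (Pi.basisFun ℂ (Fin m)),
    Matrix.trace, Complex.re_sum, Finset.mul_sum]
  refine Finset.sum_congr rfl fun j _ => ?_
  have h1 : (Pi.single j Complex.I : Fin m → ℂ) = Complex.I • Pi.single j 1 := by
    rw [← Pi.single_smul]; simp
  rw [h1, h, h, h₂, map_smul]
  simp
  ring

end RealTrace

namespace TautCompact

variable {m k : ℕ} {T : ℝ} {φ : ℝ → ℝ} {S : Bool → ℝ → ℝ}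

/-- The part antilinear in `u` of the derivative of `lamForm · v` in the direction `u`. -/
def lamBar (k : ℕ) (T : ℝ) (φ : ℝ → ℝ) (S : Bool → ℝ → ℝ) (i : Fin m) (b : Bool)
    (c u v : Fin m → ℂ) : ℂ :=
  dot T φ (tFun k S i b c) * φ (tFun k S i b c) * conj (vertForm k i b c u) * vertForm k i b c v +
    (φ (tFun k S i b c) - 1) * fsForm i c v u

/-- The part antilinear in `u` of the derivative of `vertCoef · v w` in the direction `u`. -/
def vertCoefBar (k : ℕ) (T : ℝ) (φ : ℝ → ℝ) (S : Bool → ℝ → ℝ) (i : Fin m) (b : Bool)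
    (c u v w : Fin m → ℂ) : ℂ :=
  (dot T (dot T φ) (tFun k S i b c) - dot T φ (tFun k S i b c)) * φ (tFun k S i b c) *
    conj (vertForm k i b c u) * vertForm k i b c v * vertForm k i b c w +
  (dot T φ (tFun k S i b c) - φ (tFun k S i b c) + 1) *
    (fsForm i c v u * vertForm k i b c w + vertForm k i b c v * fsForm i c w u)

/-- The part linear in `u` of the derivative of `vertCoef · v w` in the direction `u`. -/
def vertCoefHol (k : ℕ) (T : ℝ) (φ : ℝ → ℝ) (S : Bool → ℝ → ℝ) (i : Fin m) (b : Bool)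
    (c u v w : Fin m → ℂ) : ℂ :=
  (dot T (dot T φ) (tFun k S i b c) - dot T φ (tFun k S i b c)) * φ (tFun k S i b c) *
        vertForm k i b c u * vertForm k i b c v * vertForm k i b c w +
      (dot T φ (tFun k S i b c) - φ (tFun k S i b c)) *
        ((-(sgn b * k * ((vertForm k i b c u - connForm i c u) *
        (vertForm k i b c v - connForm i c v))) - connForm i c u * connForm i c v) *
          vertForm k i b c w + vertForm k i b c v *
          (-(sgn b * k * ((vertForm k i b c u - connForm i c u) *
        (vertForm k i b c w - connForm i c w))) - connForm i c u * connForm i c w)) +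
      ((-(sgn b * k * ((vertForm k i b c u - connForm i c u) *
        (vertForm k i b c v - connForm i c v))) - connForm i c u * connForm i c v) *
          connForm i c w + vertForm k i b c v * (-(connForm i c u * connForm i c w))) +
      ((-(sgn b * k * ((vertForm k i b c u - connForm i c u) *
        (vertForm k i b c w - connForm i c w))) - connForm i c u * connForm i c w) *
          connForm i c v + vertForm k i b c w * (-(connForm i c u * connForm i c v))) +
      2 * connForm i c u * connForm i c v * connForm i c w +
      2 * (sgn b * k) ^ 2 * (vertForm k i b c u - connForm i c u) *
        (vertForm k i b c v - connForm i c v) * (vertForm k i b c w - connForm i c w)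

/-- The complex-linear form `u ↦ fsForm u v`. -/
def fsLin (i : Fin m) (c v : Fin m → ℂ) : (Fin m → ℂ) →ₗ[ℂ] ℂ where
  toFun u := fsForm i c u v
  map_add' u u' := fsForm_add_left i c u u' v
  map_smul' l u := fsForm_smul_left i c l u v

section

variable (hk : 0 < k) (hS : Profile k T φ S) (hT : 0 < T) (hφ : ContDiffOn ℝ ∞ φ (Icc 0 T))
include hk hS hφ

lemma hasLineDerivAt_lamForm {i : Fin m} (b : Bool) {c : Fin m → ℂ} (hc : c i ≠ 0)
    (u v : Fin m → ℂ) : HasLineDerivAt ℝ (fun c => lamForm k φ S i b c v)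
      (lamForm k φ S i b c u * lamForm k φ S i b c v +
        φ (tFun k S i b c) * vertCoef k T φ S i b c u v + lamBar k T φ S i b c u v) c u := by
  refine (((hasLineDerivAt_phi hk hS hφ b hc u).mul' (hasLineDerivAt_vertForm hk b hc u v)).sub'
    (hasLineDerivAt_connForm i c u v)).congr_deriv' ?_
  simp only [lamForm, vertCoef, lamBar]
  ring

include hT

lemma hasLineDerivAt_dot_phi {i : Fin m} (b : Bool) {c : Fin m → ℂ} (hc : c i ≠ 0)
    (u : Fin m → ℂ) : HasLineDerivAt ℝ (fun c => (dot T φ (tFun k S i b c) : ℂ))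
      (dot T (dot T φ) (tFun k S i b c) * φ (tFun k S i b c) *
        (vertForm k i b c u + conj (vertForm k i b c u))) c u :=
  hasLineDerivAt_comp_tFun hk hS b hc u
    (hasDerivAt_dot (contDiffOn_dot hT hφ) (tFun_mem_Ioo hS b hc))

lemma hasLineDerivAt_vertCoef {i : Fin m} (b : Bool) {c : Fin m → ℂ} (hc : c i ≠ 0)
    (u v w : Fin m → ℂ) : HasLineDerivAt ℝ (fun c => vertCoef k T φ S i b c v w)
      (vertCoefHol k T φ S i b c u v w + vertCoefBar k T φ S i b c u v w) c u := by
  have hθ := hasLineDerivAt_vertForm hk b hc u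
  have hβ := hasLineDerivAt_connForm i c u
  refine ((((((hasLineDerivAt_dot_phi hk hS hT hφ b hc u).sub'
    (hasLineDerivAt_phi hk hS hφ b hc u)).mul' ((hθ v).mul' (hθ w))).add'
      ((hθ v).mul' (hβ w))).add' ((hβ v).mul' (hθ w))).sub' ((hβ v).mul' (hβ w))).sub'
      ((((hθ v).sub' (hβ v)).mul' ((hθ w).sub' (hβ w))).const_mul' (sgn b * k)) |>.congr_deriv' ?_
  simp only [vertCoefBar, vertCoefHol]
  ring

/-- The curvature comes from the antilinear part of the derivative of the Christoffel symbols, as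
for every Kähler metric: the linear part cancels against the quadratic terms. -/
lemma curvature_chartMetric {i : Fin m} (b : Bool) {c : Fin m → ℂ} (hc : c i ≠ 0)
    (u v w : Fin m → ℂ) : Coord.curvature (chartMetric k S i b) c v w u =
      (lamBar k T φ S i b c u v • w + lamBar k T φ S i b c u w • v +
        vertCoefBar k T φ S i b c u v w • eulerField k i b c) -
      (lamBar k T φ S i b c v u • w + lamBar k T φ S i b c v w • u +
        vertCoefBar k T φ S i b c v u w • eulerField k i b c) := by
  have hG := isMetricOn_chartMetric hS hk i b
  have hd := hG.differentiableAt_christoffel (mem_univ c)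
  have key : ∀ u v w, fderiv ℝ (Coord.christoffel (chartMetric k S i b)) c u v w =
      (lamForm k φ S i b c u * lamForm k φ S i b c v +
        φ (tFun k S i b c) * vertCoef k T φ S i b c u v + lamBar k T φ S i b c u v) • w +
      (lamForm k φ S i b c u * lamForm k φ S i b c w +
        φ (tFun k S i b c) * vertCoef k T φ S i b c u w + lamBar k T φ S i b c u w) • v +
      (vertCoef k T φ S i b c v w * (sgn b * k * (vertForm k i b c u - connForm i c u)) +
        vertCoefHol k T φ S i b c u v w + vertCoefBar k T φ S i b c u v w) •
          eulerField k i b c := by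
    intro u v w
    have hp := hasLineDerivAt_vertCoef hk hS hT hφ b hc u v w
    have h1 : (fun y => Coord.christoffel (chartMetric k S i b) y v w) =ᶠ[𝓝 c]
        fun y => chartGamma k T φ S i b y v w := by
      filter_upwards [eventually_coord_ne_zero hc] with y hy
        using christoffel_chartMetric hk hS hφ b hy v w
    have h2 : DifferentiableAt ℝ (fun y => Coord.christoffel (chartMetric k S i b) y v w) c :=
      (hd.clm_apply (differentiableAt_const v)).clm_apply (differentiableAt_const w)
    have h3 := ((((hasLineDerivAt_lamForm hk hS hφ b hc u v).smul'
      (hasLineDerivAt_const w c u)).add' ((hasLineDerivAt_lamForm hk hS hφ b hc u w).smul'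
      (hasLineDerivAt_const v c u))).add' (hp.smul' (hasLineDerivAt_eulerField hk b hc u)))
    rw [Coord.fderiv_bilin_apply hd, h1.fderiv_eq,
      fderiv_eq_of_hasLineDerivAt (h2.congr_of_eventuallyEq h1.symm) h3]
    module
  rw [Coord.curvature_apply, key, key]
  have hX : ∀ u v w, Coord.christoffel (chartMetric k S i b) c u
      (Coord.christoffel (chartMetric k S i b) c v w) =
      lamForm k φ S i b c u • (lamForm k φ S i b c v • w + lamForm k φ S i b c w • v +
        vertCoef k T φ S i b c v w • eulerField k i b c) +
      (2 * lamForm k φ S i b c v * lamForm k φ S i b c w +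
        vertCoef k T φ S i b c v w * φ (tFun k S i b c)) • u +
      (lamForm k φ S i b c v * vertCoef k T φ S i b c u w +
        lamForm k φ S i b c w * vertCoef k T φ S i b c u v +
        vertCoef k T φ S i b c v w * ((dot T φ (tFun k S i b c) - φ (tFun k S i b c)) *
          vertForm k i b c u + connForm i c u -
          sgn b * k * (vertForm k i b c u - connForm i c u))) • eulerField k i b c := by
    intro u v w
    have hE := vertForm_eulerField hk b hc
    rw [christoffel_chartMetric hk hS hφ b hc, christoffel_chartMetric hk hS hφ b hc, chartGamma]
    congr 1
    · congr 2
      rw [lamForm, vertForm_chartGamma hk b hc, connForm_chartGamma]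
      simp only [lamForm]
      ring
    · congr 1
      rw [vertCoef, vertForm_chartGamma hk b hc, connForm_chartGamma]
      simp only [vertCoef]
      ring
  rw [hX, hX]
  simp only [lamForm, vertCoef, vertCoefHol]
  match_scalars <;> ring

end

end TautCompact

/-! ### Ricci tensor and Hessian in a chart -/

namespace TautCompact

variable {m k : ℕ} {T : ℝ} {φ : ℝ → ℝ} {S : Bool → ℝ → ℝ}

/-- The symmetric form `Re (A h + B θ ⊗ θ̄)`, where `h = fsForm` and `θ = vertForm`. The metric, the
Hessian of `e^t` and the Ricci tensor are of this type. -/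
def reForm (k : ℕ) (i : Fin m) (b : Bool) (c : Fin m → ℂ) (A B : ℝ) (u v : Fin m → ℂ) : ℝ :=
  (A * fsForm i c u v + B * (vertForm k i b c u * conj (vertForm k i b c v)) : ℂ).re

lemma reForm_symm (i : Fin m) (b : Bool) (c : Fin m → ℂ) (A B : ℝ) (u v : Fin m → ℂ) :
    reForm k i b c A B u v = reForm k i b c A B v u := by
  rw [reForm, ← Complex.conj_re, reForm]
  simp only [map_add, map_mul, conj_fsForm, Complex.conj_ofReal, Complex.conj_conj]
  rw [mul_comm (vertForm k i b c v)]

section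

variable (hk : 0 < k) (hS : Profile k T φ S) (hT : 0 < T) (hφ : ContDiffOn ℝ ∞ φ (Icc 0 T))
include hk hS

lemma chartMetric_eq_reForm {i : Fin m} (b : Bool) {c : Fin m → ℂ} (hc : c i ≠ 0) (u v : Fin m → ℂ) :
    chartMetric k S i b c u v = reForm k i b c (2 * Real.exp (tFun k S i b c))
      (2 * Real.exp (tFun k S i b c) * φ (tFun k S i b c)) u v := by
  rw [chartMetric_eq hk hS b hc, reForm]
  rw [show (2 : ℝ) * (_ : ℂ).re = _ from (Complex.re_ofReal_mul 2 _).symm]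
  congr 1
  push_cast
  ring

include hT hφ

/-- The Ricci tensor, from the complex trace of the antiholomorphic derivative of the Christoffel
symbols. -/
lemma ricci_chartMetric {i : Fin m} (b : Bool) {c : Fin m → ℂ} (hc : c i ≠ 0)
    (v w : Fin m → ℂ) : Coord.ricci (chartMetric k S i b) c v w =
      reForm k i b c (-2 * (m * φ (tFun k S i b c) + dot T φ (tFun k S i b c) - m))
        (-2 * φ (tFun k S i b c) * (m * dot T φ (tFun k S i b c) +
          dot T (dot T φ) (tFun k S i b c))) v w := by
  set t := tFun k S i b c with ht
  have hE := vertForm_eulerField hk b hc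
  -- the forms `lamBar v` and `vertCoefBar v · w`, as linear forms
  set l₁ : (Fin m → ℂ) →ₗ[ℂ] ℂ := (dot T φ t * φ t * conj (vertForm k i b c v) : ℂ) •
    vertForm k i b c + (φ t - 1 : ℂ) • fsLin i c v with hl₁
  set l₂ : (Fin m → ℂ) →ₗ[ℂ] ℂ := ((dot T (dot T φ) t - dot T φ t) * φ t *
    conj (vertForm k i b c v) * vertForm k i b c w + (dot T φ t - φ t + 1) * fsForm i c w v : ℂ) •
      vertForm k i b c + ((dot T φ t - φ t + 1) * vertForm k i b c w : ℂ) • fsLin i c v with hl₂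
  have h1 : ∀ u, lamBar k T φ S i b c v u = l₁ u := fun u => rfl
  have h2 : ∀ u, vertCoefBar k T φ S i b c v u w = l₂ u := fun u => by
    change _ = _ * _ + _ * fsForm i c u v
    simp only [vertCoefBar]
    ring
  rw [Coord.ricci_apply, trace_eq_two_mul_re _
    (-(l₁.smulRight w + lamBar k T φ S i b c v w • LinearMap.id +
      l₂.smulRight (eulerField k i b c)))
    (fun u => lamBar k T φ S i b c u v • w + lamBar k T φ S i b c u w • v +
        vertCoefBar k T φ S i b c u v w • eulerField k i b c)]
  · rw [map_neg, map_add, map_add, map_smul, LinearMap.trace_id, LinearMap.trace_smulRight,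
      LinearMap.trace_smulRight, ← h1, ← h2, Module.finrank_fintype_fun_eq_card, Fintype.card_fin]
    rw [show (2 : ℝ) * (_ : ℂ).re = _ from (Complex.re_ofReal_mul 2 _).symm, reForm_symm, reForm]
    congr 1
    simp only [lamBar, vertCoefBar, hE, fsForm_eulerField_left, smul_eq_mul]
    push_cast
    ring
  · intro u
    have hI : ∀ w, fsForm i c w (Complex.I • u) = -(Complex.I * fsForm i c w u) := fun w => by
      rw [fsForm_smul_right, Complex.conj_I, neg_mul]
    have hJ : conj (vertForm k i b c (Complex.I • u)) = -(Complex.I * conj (vertForm k i b c u)) := by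
      rw [map_smul, smul_eq_mul, map_mul, Complex.conj_I, neg_mul]
    simp only [lamBar, vertCoefBar, hI, hJ]
    module
  · intro u
    have h3 := curvature_chartMetric hk hS hT hφ b hc u v w
    change Coord.curvature (chartMetric k S i b) c v w u = _
    rw [h3, h1 u, h2 u]
    simp only [LinearMap.neg_apply, LinearMap.add_apply, LinearMap.smulRight_apply,
      LinearMap.smul_apply, LinearMap.id_apply]
    abel

end

/-- The function `κ = e^t` in the chart. -/
def kappaFun (k : ℕ) (S : Bool → ℝ → ℝ) (i : Fin m) (b : Bool) (c : Fin m → ℂ) : ℝ :=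
  Real.exp (tFun k S i b c)

section

variable (hk : 0 < k) (hS : Profile k T φ S) (hT : 0 < T) (hφ : ContDiffOn ℝ ∞ φ (Icc 0 T))
include hS

lemma contDiff_kappaFun (i : Fin m) (b : Bool) : ContDiff ℝ ∞ (kappaFun k S i b) :=
  Real.contDiff_exp.comp (contDiff_tFun hS i b)

include hk

lemma fderiv_kappaFun {i : Fin m} (b : Bool) {c : Fin m → ℂ} (hc : c i ≠ 0) (u : Fin m → ℂ) :
    fderiv ℝ (kappaFun k S i b) c u = 2 * (Real.exp (tFun k S i b c) * φ (tFun k S i b c) *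
      vertForm k i b c u : ℂ).re := by
  have h1 := (hasLineDerivAt_tFun hk hS b hc u).comp_real (Real.hasDerivAt_exp _)
  rw [fderiv_eq_of_hasLineDerivAt ((contDiff_kappaFun hS i b).differentiable (by simp) c) h1,
    ← Complex.ofReal_mul, Complex.re_ofReal_mul]
  ring

include hφ

lemma hessian_kappaFun {i : Fin m} (b : Bool) {c : Fin m → ℂ} (hc : c i ≠ 0)
    (u v : Fin m → ℂ) : Coord.hessian (chartMetric k S i b) (kappaFun k S i b) c u v =
      reForm k i b c (2 * Real.exp (tFun k S i b c) * φ (tFun k S i b c))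
        (2 * Real.exp (tFun k S i b c) * φ (tFun k S i b c) *
          (φ (tFun k S i b c) + dot T φ (tFun k S i b c))) u v := by
  have hd : DifferentiableAt ℝ (fderiv ℝ (kappaFun k S i b)) c :=
    ((contDiff_kappaFun hS i b).fderiv_right (m := ∞) (by simp)).differentiable (by simp) c
  have h1 : (fun y => fderiv ℝ (kappaFun k S i b) y v) =ᶠ[𝓝 c] fun y =>
      2 * (Real.exp (tFun k S i b y) * φ (tFun k S i b y) * vertForm k i b y v : ℂ).re := by
    filter_upwards [eventually_coord_ne_zero hc] with y hy using fderiv_kappaFun hk hS b hy v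
  have h2 : DifferentiableAt ℝ (fun y => fderiv ℝ (kappaFun k S i b) y v) c :=
    hd.clm_apply (differentiableAt_const v)
  have h3 := (((hasLineDerivAt_exp_tFun hk hS b hc u).mul' (hasLineDerivAt_phi hk hS hφ b hc u)).mul'
    (hasLineDerivAt_vertForm hk b hc u v)).re'
  have h4 := HasDerivAt.const_mul (2 : ℝ) h3
  rw [Coord.hessian_apply, Coord.fderiv_lin_apply hd, h1.fderiv_eq,
    fderiv_eq_of_hasLineDerivAt (h2.congr_of_eventuallyEq h1.symm) h4, fderiv_kappaFun hk hS b hc,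
    christoffel_chartMetric hk hS hφ b hc, vertForm_chartGamma hk b hc, ← mul_sub,
    ← Complex.sub_re, show (2 : ℝ) * (_ : ℂ).re = _ from (Complex.re_ofReal_mul 2 _).symm,
    reForm_symm, reForm]
  congr 1
  simp only [lamForm, vertCoef]
  push_cast
  ring

end

end TautCompact

/-! ### Identities on the whole chart -/

namespace TautCompact

variable {m k : ℕ} {T : ℝ} {φ : ℝ → ℝ} {S : Bool → ℝ → ℝ}

lemma dense_coord_ne_zero (i : Fin m) : Dense {c : Fin m → ℂ | c i ≠ 0} :=
  (dense_compl_singleton (0 : ℂ)).preimage (isOpenMap_eval i)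

/-- Identities between continuous functions extend from `ζ ≠ 0` to the whole chart. -/
lemma eq_of_eq_of_coord_ne_zero {X : Type*} [TopologicalSpace X] [T2Space X]
    {F F' : (Fin m → ℂ) → X} (hF : Continuous F) (hF' : Continuous F') (i : Fin m)
    (h : ∀ c, c i ≠ 0 → F c = F' c) (c : Fin m → ℂ) : F c = F' c :=
  congrFun (hF.ext_on (dense_coord_ne_zero i) hF' fun c hc => h c hc) c

section

variable (hk : 0 < k) (hS : Profile k T φ S) (hT : 0 < T) (hφ : ContDiffOn ℝ ∞ φ (Icc 0 T))
include hS

lemma tFun_zero {i : Fin m} (b : Bool) {c : Fin m → ℂ} (hc : c i = 0) :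
    tFun k S i b c = bif b then T else 0 := by
  have : fibreSq k i b c = 0 := by simp [fibreSq, hc]
  rw [tFun, this]
  cases b
  · exact hS.zero_false
  · exact hS.zero_true

include hT in
lemma tFun_mem_Icc (i : Fin m) (b : Bool) (c : Fin m → ℂ) : tFun k S i b c ∈ Icc 0 T := by
  by_cases hc : c i = 0
  · rw [tFun_zero hS b hc]
    cases b
    · exact ⟨le_rfl, hT.le⟩
    · exact ⟨hT.le, le_rfl⟩
  · exact Ioo_subset_Icc_self (tFun_mem_Ioo hS b hc)

include hT in
lemma continuous_comp_tFun (i : Fin m) (b : Bool) {h : ℝ → ℝ} (hh : ContDiffOn ℝ ∞ h (Icc 0 T)) :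
    Continuous fun c => h (tFun k S i b c) :=
  hh.continuousOn.comp_continuous (contDiff_tFun hS i b).continuous (tFun_mem_Icc hS hT i b)

include hk

lemma chartMetric_pos (i : Fin m) (b : Bool) (c : Fin m → ℂ) {u : Fin m → ℂ} (hu : u ≠ 0) :
    0 < chartMetric k S i b c u u := (isMetricOn_chartMetric hS hk i b).pos c (mem_univ c) u hu

omit hS hk in
lemma chartMetric_I (i : Fin m) (b : Bool) (c u v : Fin m → ℂ) :
    chartMetric k S i b c (Complex.I • u) (Complex.I • v) = chartMetric k S i b c u v := by
  rw [chartMetric_apply, chartMetric_apply, fsForm_smul_left, fsForm_smul_right, map_smul, map_smul,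
    smul_eq_mul, smul_eq_mul, map_mul, Complex.conj_I]
  congr 2
  linear_combination (-fsForm i c u v - vertWeight k S i b c *
    (regForm k i b c u * conj (regForm k i b c v))) * Complex.I_mul_I

lemma contDiff_christoffel_chartMetric (i : Fin m) (b : Bool) :
    ContDiff ℝ ∞ (Coord.christoffel (chartMetric k S i b)) :=
  contDiffOn_univ.1 (isMetricOn_chartMetric hS hk i b).contDiffOn_christoffel

include hφ in
/-- The metric is Kähler: the Christoffel symbols are complex-linear in the second argument. -/
lemma christoffel_I (i : Fin m) (b : Bool) (c u v : Fin m → ℂ) :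
    Coord.christoffel (chartMetric k S i b) c u (Complex.I • v) =
      Complex.I • Coord.christoffel (chartMetric k S i b) c u v := by
  have hc := (contDiff_christoffel_chartMetric hk hS i b).continuous
  have h1 : ∀ v, Continuous fun c => Coord.christoffel (chartMetric k S i b) c u v := fun v =>
    (hc.clm_apply continuous_const).clm_apply continuous_const
  refine eq_of_eq_of_coord_ne_zero (h1 (Complex.I • v))
    (F' := fun c => Complex.I • Coord.christoffel (chartMetric k S i b) c u v)
    ((h1 v).const_smul Complex.I) i (fun c hc => ?_) c
  rw [christoffel_chartMetric hk hS hφ b hc, christoffel_chartMetric hk hS hφ b hc,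
    chartGamma_smul_right]

include hφ

/-- The Hessian of `e^t` as a combination of the metric and of squares of real forms, from which its
trace is computed. -/
lemma hessian_kappaFun_eq {i : Fin m} (b : Bool) {c : Fin m → ℂ} (hc : c i ≠ 0)
    {ξ η : (Fin m → ℂ) →L[ℝ] ℝ} (hξ : ∀ u, ξ u = (vertForm k i b c u).re)
    (hη : ∀ u, η u = (vertForm k i b c u).im) :
    Coord.hessian (chartMetric k S i b) (kappaFun k S i b) c =
      φ (tFun k S i b c) • chartMetric k S i b c + (2 * Real.exp (tFun k S i b c) *
        φ (tFun k S i b c) * dot T φ (tFun k S i b c)) • (Coord.tmul ξ ξ + Coord.tmul η η) := by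
  ext u v
  rw [hessian_kappaFun hk hS hφ b hc]
  change _ = φ (tFun k S i b c) * chartMetric k S i b c u v + (2 * Real.exp (tFun k S i b c) *
        φ (tFun k S i b c) * dot T φ (tFun k S i b c)) * (ξ u * ξ v + η u * η v)
  rw [chartMetric_eq_reForm hk hS b hc, reForm, reForm, hξ, hξ, hη, hη]
  simp only [Complex.add_re, Complex.re_ofReal_mul, Complex.mul_re (vertForm k i b c u),
    Complex.conj_re, Complex.conj_im]
  ring

include hT

lemma laplacian_kappaFun (i : Fin m) (b : Bool) (c : Fin m → ℂ) :
    Coord.trace (chartMetric k S i b c)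
      (Coord.hessian (chartMetric k S i b) (kappaFun k S i b) c) =
      2 * (dot T φ (tFun k S i b c) + m * φ (tFun k S i b c)) := by
  have hG := isMetricOn_chartMetric hS hk i b
  have h1 : Continuous fun c => Coord.trace (chartMetric k S i b c)
      (Coord.hessian (chartMetric k S i b) (kappaFun k S i b) c) := by
    have ht : Continuous fun A : (Fin m → ℂ) →L[ℝ] (Fin m → ℂ) =>
        LinearMap.trace ℝ (Fin m → ℂ) (A : (Fin m → ℂ) →ₗ[ℝ] (Fin m → ℂ)) :=
      LinearMap.continuous_of_finiteDimensional
        ((LinearMap.trace ℝ (Fin m → ℂ)).comp (ContinuousLinearMap.coeLM ℝ))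
    exact ht.comp ((contDiffOn_univ.1 hG.contDiffOn_inverse).continuous.clm_comp
      (contDiffOn_univ.1 (hG.contDiffOn_hessian (contDiff_kappaFun hS i b).contDiffOn)).continuous)
  have h2 := continuous_comp_tFun hS hT i b hφ
  have h3 := continuous_comp_tFun hS hT i b (contDiffOn_dot hT hφ)
  refine eq_of_eq_of_coord_ne_zero h1
    (F' := fun c => 2 * (dot T φ (tFun k S i b c) + m * φ (tFun k S i b c)))
    (continuous_const.mul (h3.add (continuous_const.mul h2))) i (fun c hc => ?_) c
  have hpos : ∀ u, u ≠ 0 → 0 < chartMetric k S i b c u u := fun u => chartMetric_pos hk hS i b c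
  set ξ : (Fin m → ℂ) →L[ℝ] ℝ := (Complex.reLm ∘ₗ
    (vertForm k i b c).restrictScalars ℝ).toContinuousLinearMap with hξ
  set η : (Fin m → ℂ) →L[ℝ] ℝ := (Complex.imLm ∘ₗ
    (vertForm k i b c).restrictScalars ℝ).toContinuousLinearMap with hη
  have hE := vertForm_eulerField hk b hc
  have hp : φ (tFun k S i b c) ≠ 0 := phi_tFun_ne_zero hk hS b hc
  set r : ℝ := (2 * Real.exp (tFun k S i b c) * φ (tFun k S i b c))⁻¹ with hr
  have he := (Real.exp_pos (tFun k S i b c)).ne'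
  have hri : r * (2 * Real.exp (tFun k S i b c) * φ (tFun k S i b c)) = 1 :=
    inv_mul_cancel₀ (by positivity)
  -- the vectors dual to the real and imaginary parts of `θ` are multiples of `E` and `iE`
  have h4 : (chartMetric k S i b c).inverse ξ = r • eulerField k i b c := by
    refine Coord.eq_inverse_of_pos hpos fun v => ?_
    rw [map_smul, smul_apply, chartMetric_eq_reForm hk hS b hc, reForm, fsForm_eulerField_left, hE,
      mul_zero, zero_add, one_mul, Complex.re_ofReal_mul, Complex.conj_re, smul_eq_mul, ← mul_assoc,
      hri, one_mul]
    rfl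
  have h5 : (chartMetric k S i b c).inverse η = r • Complex.I • eulerField k i b c := by
    refine Coord.eq_inverse_of_pos hpos fun v => ?_
    rw [map_smul, smul_apply, chartMetric_eq_reForm hk hS b hc, reForm, fsForm_smul_left,
      fsForm_eulerField_left, map_smul, hE,
      mul_zero, mul_zero, zero_add, Complex.re_ofReal_mul, smul_eq_mul, ← mul_assoc,
      hri, one_mul, smul_eq_mul, mul_one, Complex.I_mul_re, Complex.conj_im, neg_neg]
    rfl
  have h6 : ξ (eulerField k i b c) = 1 := by
    change (vertForm k i b c _).re = 1
    rw [hE, Complex.one_re]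
  have h7 : η (Complex.I • eulerField k i b c) = 1 := by
    change (vertForm k i b c _).im = 1
    rw [map_smul, hE, smul_eq_mul, mul_one, Complex.I_im]
  rw [hessian_kappaFun_eq hk hS hφ b hc (ξ := ξ) (η := η) (fun _ => rfl) (fun _ => rfl),
    Coord.trace_add, Coord.trace_smul, Coord.trace_smul, Coord.trace_add, Coord.trace_self hpos,
    Coord.trace_tmul, Coord.trace_tmul, h4, h5, map_smul, map_smul, h6, h7, finrank_real_pi,
    smul_eq_mul, mul_one]
  push_cast
  linear_combination 2 * dot T φ (tFun k S i b c) * hri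

omit hφ in
lemma gradSq_kappaFun (hφ : ContDiffOn ℝ ∞ φ (Icc 0 T)) (i : Fin m) (b : Bool) (c : Fin m → ℂ) :
    fderiv ℝ (kappaFun k S i b) c (Coord.grad (chartMetric k S i b) (kappaFun k S i b) c) =
      2 * Real.exp (tFun k S i b c) * φ (tFun k S i b c) := by
  have hG := isMetricOn_chartMetric hS hk i b
  have h1 : Continuous fun c => fderiv ℝ (kappaFun k S i b) c
      (Coord.grad (chartMetric k S i b) (kappaFun k S i b) c) :=
    ((contDiff_kappaFun hS i b).continuous_fderiv (by simp)).clm_apply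
      (contDiffOn_univ.1 (hG.contDiffOn_grad (contDiff_kappaFun hS i b).contDiffOn)).continuous
  have h2 := continuous_comp_tFun hS hT i b hφ
  refine eq_of_eq_of_coord_ne_zero h1
    (F' := fun c => 2 * Real.exp (tFun k S i b c) * φ (tFun k S i b c))
    ((continuous_const.mul (contDiff_kappaFun hS i b).continuous).mul h2) i (fun c hc => ?_) c
  have hE := vertForm_eulerField hk b hc
  have h3 : Coord.grad (chartMetric k S i b) (kappaFun k S i b) c = eulerField k i b c := by
    refine Coord.eq_inverse_of_pos (fun u => chartMetric_pos hk hS i b c) fun v => ?_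
    rw [fderiv_kappaFun hk hS b hc, chartMetric_eq hk hS b hc, fsForm_eulerField_left, hE, zero_add,
      one_mul, mul_assoc, Complex.re_ofReal_mul, Complex.re_ofReal_mul,
      Complex.re_ofReal_mul, Complex.re_ofReal_mul, Complex.conj_re]
  rw [h3, fderiv_kappaFun hk hS b hc, hE, mul_one, ← Complex.ofReal_mul, Complex.ofReal_re]
  ring

/-- The Ricci tensor is a combination of the metric and the Hessian of `κ = e^t`. Both being of the
form `Re (A h + B θ ⊗ θ̄)`, this is one relation between the coefficients, which is the
second-order equation `heq` for `φ`. -/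
lemma ricci_add_hessian (i : Fin m) (b : Bool) {a : ℝ → ℝ} (ha : ContDiffOn ℝ ∞ a (Icc 0 T))
    (heq : ∀ t ∈ Icc 0 T,
      dot T (dot T φ) t = (a t - (m - 1)) * dot T φ t + m * φ t - m) (c : Fin m → ℂ) :
    (a (tFun k S i b c) * Real.exp (-tFun k S i b c)) •
        Coord.hessian (chartMetric k S i b) (kappaFun k S i b) c +
      Coord.ricci (chartMetric k S i b) c =
    ((a (tFun k S i b c) * φ (tFun k S i b c) - m * φ (tFun k S i b c) - dot T φ (tFun k S i b c) + m)
      * Real.exp (-tFun k S i b c)) • chartMetric k S i b c := by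
  have hG := isMetricOn_chartMetric hS hk i b
  ext v w
  have h1 := continuous_comp_tFun hS hT i b ha
  have h2 := continuous_comp_tFun hS hT i b hφ
  have h3 := continuous_comp_tFun hS hT i b (contDiffOn_dot hT hφ)
  have h4 : Continuous fun c => Real.exp (-tFun k S i b c) :=
    Real.continuous_exp.comp (contDiff_tFun hS i b).continuous.neg
  have h5 : Continuous fun c =>
      Coord.hessian (chartMetric k S i b) (kappaFun k S i b) c v w :=
    ((contDiffOn_univ.1 (hG.contDiffOn_hessian
      (contDiff_kappaFun hS i b).contDiffOn)).continuous.clm_apply continuous_const).clm_apply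
        continuous_const
  have h6 : Continuous fun c => chartMetric k S i b c v w :=
    ((contDiffOn_univ.1 hG.smooth).continuous.clm_apply continuous_const).clm_apply continuous_const
  refine eq_of_eq_of_coord_ne_zero
    (F := fun c => (a (tFun k S i b c) * Real.exp (-tFun k S i b c)) *
        Coord.hessian (chartMetric k S i b) (kappaFun k S i b) c v w +
      Coord.ricci (chartMetric k S i b) c v w)
    (F' := fun c => ((a (tFun k S i b c) * φ (tFun k S i b c) - m * φ (tFun k S i b c) -
      dot T φ (tFun k S i b c) + m) * Real.exp (-tFun k S i b c)) * chartMetric k S i b c v w)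
    (((h1.mul h4).mul h5).add (continuousOn_univ.1 (hG.continuousOn_ricci v w)))
    ((((((h1.mul h2).sub (continuous_const.mul h2)).sub h3).add continuous_const).mul h4).mul h6)
    i (fun c hc => ?_) c
  rw [hessian_kappaFun hk hS hφ b hc, ricci_chartMetric hk hS hT hφ b hc,
    chartMetric_eq_reForm hk hS b hc, reForm, reForm, reForm, ← Complex.re_ofReal_mul,
    ← Complex.re_ofReal_mul, ← Complex.add_re]
  congr 1
  have h7 : (Real.exp (-tFun k S i b c) : ℂ) * Real.exp (tFun k S i b c) = 1 := by
    rw [← Complex.ofReal_mul, ← Real.exp_add, neg_add_cancel, Real.exp_zero, Complex.ofReal_one]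
  rw [heq _ (tFun_mem_Icc hS hT i b c)]
  push_cast [-Complex.ofReal_exp]
  set P : ℂ := (φ (tFun k S i b c) : ℂ)
  set Q : ℂ := (dot T φ (tFun k S i b c) : ℂ)
  set A : ℂ := (a (tFun k S i b c) : ℂ)
  set X := fsForm i c v w
  set Y := vertForm k i b c v * conj (vertForm k i b c w)
  linear_combination (A * 2 * P * X + A * 2 * P * (P + Q) * Y -
    (A * P - m * P - Q + m) * 2 * (X + P * Y)) * h7

end

end TautCompact

/-! ### Change of charts -/

namespace TautCompact

variable {m k : ℕ}

lemma baseVec_chartFun_pt (i : Fin m) (b : Bool) {z : Fin m → ℂ} (hz : z ≠ 0) {a : ℂ × ℂ}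
    (ha : a ≠ 0) (hi : z i ≠ 0) : baseVec i (chartFun i b (pt k z hz a ha)) = (z i)⁻¹ • z := by
  rw [chartFun_pt, baseVec]
  funext j
  rcases eq_or_ne j i with rfl | hj
  · simp [hi]
  · simp [hj, div_eq_inv_mul]

/-- The squared fibre norm in homogeneous coordinates. -/
lemma fibreSq_chartFun_pt (i : Fin m) (b : Bool) {z : Fin m → ℂ} (hz : z ≠ 0) {a : ℂ × ℂ}
    (ha : a ≠ 0) (hi : z i ≠ 0) : fibreSq k i b (chartFun i b (pt k z hz a ha)) =
      bif b then ‖a.2‖ ^ 2 / (‖a.1‖ ^ 2 * normSqVec z ^ k)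
        else ‖a.1‖ ^ 2 * normSqVec z ^ k / ‖a.2‖ ^ 2 := by
  have hn : ‖z i‖ ≠ 0 := norm_ne_zero_iff.2 hi
  have hN := (normSqVec_pos hz).ne'
  rw [fibreSq, baseSq, baseVec_chartFun_pt i b hz ha hi, normSqVec_smul, chartFun_pt]
  cases b
  · simp only [update_self, cond_false, fibreWeight, norm_div, norm_mul, norm_pow, norm_inv,
      mul_pow, inv_pow, div_pow, ← pow_mul, mul_comm 2 k]
    field_simp
  · simp only [update_self, cond_true, fibreWeight, norm_div, norm_mul, norm_pow, norm_inv,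
      mul_pow, inv_pow, div_pow, ← pow_mul, mul_comm 2 k]
    by_cases h1 : ‖a.1‖ = 0
    · simp [h1]
    · field_simp

section

variable {T : ℝ} {φ : ℝ → ℝ} {S : Bool → ℝ → ℝ} (hk : 0 < k) (hS : Profile k T φ S) (hT : 0 < T)
  (hφ : ContDiffOn ℝ ∞ φ (Icc 0 T))
include hS

/-- The function `t` does not depend on the chart. -/
lemma tFun_chartFun_eq {i i' : Fin m} {b b' : Bool} {x : TautCompact m k}
    (hx : x ∈ chartSource i b) (hx' : x ∈ chartSource i' b') :
    tFun k S i b (chartFun i b x) = tFun k S i' b' (chartFun i' b' x) := by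
  obtain ⟨z, hz, a, ha, rfl⟩ := exists_pt x
  rw [pt_mem_chartSource] at hx hx'
  have hN := normSqVec_pos hz
  -- the squared norms in the two kinds of charts are inverse to each other
  have key : ∀ a : ℂ × ℂ, a.1 ≠ 0 → a.2 ≠ 0 → S false (‖a.1‖ ^ 2 * normSqVec z ^ k / ‖a.2‖ ^ 2) =
      S true (‖a.2‖ ^ 2 / (‖a.1‖ ^ 2 * normSqVec z ^ k)) := by
    intro a h1 h2
    have h1' := norm_pos_iff.2 h1
    have h2' := norm_pos_iff.2 h2
    rw [← hS.inv _ (by positivity), inv_div]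
  rw [tFun, tFun, fibreSq_chartFun_pt i b hz ha hx.1, fibreSq_chartFun_pt i' b' hz ha hx'.1]
  cases b <;> cases b'
  · rfl
  · exact key a hx'.2 hx.2
  · exact (key a hx.2 hx'.2).symm
  · rfl

end

section Transition

variable (k) in
/-- The change of charts. -/
def transMap (i : Fin m) (b : Bool) (i' : Fin m) (b' : Bool) (c : Fin m → ℂ) : Fin m → ℂ :=
  chartFun i' b' (chartInv (k := k) i b c)

variable (k) in
/-- The domain of the change of charts. -/
def transSource (i : Fin m) (b : Bool) (i' : Fin m) (b' : Bool) : Set (Fin m → ℂ) :=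
  {c | chartInv (k := k) i b c ∈ chartSource i' b'}

variable {i i' : Fin m} {b b' : Bool} {c : Fin m → ℂ}

lemma isOpen_transSource : IsOpen (transSource k i b i' b') := by
  have := ((ochart m k i b).symm.trans (ochart m k i' b')).open_source
  convert this using 1
  ext c
  simp only [transSource, OpenPartialHomeomorph.trans_source, mem_inter_iff, mem_preimage]
  exact ⟨fun h => ⟨mem_univ _, h⟩, fun h => h.2⟩

lemma contDiffOn_transMap :
    ContDiffOn ℂ ω (transMap k i b i' b') (transSource k i b i' b') := by
  have := contDiffOn_chart_trans (k := k) i i' b b'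
  have h : ((chart m k i b).symm.trans (chart m k i' b')).source = transSource k i b i' b' := by
    ext c
    rw [PartialEquiv.trans_source]
    exact ⟨fun h => h.2, fun h => ⟨mem_univ _, h⟩⟩
  rw [h] at this
  exact this

lemma contDiffOn_transMap_real :
    ContDiffOn ℝ ∞ (transMap k i b i' b') (transSource k i b i' b') :=
  (contDiffOn_transMap.restrict_scalars ℝ).of_le le_top

lemma differentiableAt_transMap (hc : c ∈ transSource k i b i' b') :
    DifferentiableAt ℝ (transMap k i b i' b') c :=
  (contDiffOn_transMap_real.contDiffAt (isOpen_transSource.mem_nhds hc)).differentiableAt (by simp)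

lemma fderiv_transMap_I (hc : c ∈ transSource k i b i' b') (u : Fin m → ℂ) :
    fderiv ℝ (transMap k i b i' b') c (Complex.I • u) =
      Complex.I • fderiv ℝ (transMap k i b i' b') c u := by
  have h : DifferentiableAt ℂ (transMap k i b i' b') c :=
    (contDiffOn_transMap.contDiffAt (isOpen_transSource.mem_nhds hc)).differentiableAt (by simp)
  rw [h.fderiv_restrictScalars ℝ]
  exact (fderiv ℂ (transMap k i b i' b') c).map_smul Complex.I u

lemma coord_ne_zero_of_mem_transSource (hc : c ∈ transSource k i b i' b') : baseVec i c i' ≠ 0 :=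
  ((pt_mem_chartSource i' b' _ (baseVec_ne_zero i c) _ (fibreVec_ne_zero i b c)).1 hc).1

lemma baseVec_transMap (hc : c ∈ transSource k i b i' b') :
    baseVec i' (transMap k i b i' b' c) = (baseVec i c i')⁻¹ • baseVec i c :=
  baseVec_chartFun_pt i' b' _ _ (coord_ne_zero_of_mem_transSource hc)

/-- The derivative of the relation `z' = z / z_{i'}` between the homogeneous coordinates. -/
lemma baseDir_fderiv_transMap (hc : c ∈ transSource k i b i' b') (u : Fin m → ℂ) :
    baseDir i' (fderiv ℝ (transMap k i b i' b') c u) =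
      (baseVec i c i')⁻¹ • (baseDir i u + (-(baseDir i u i') / baseVec i c i') • baseVec i c) := by
  have h0 := coord_ne_zero_of_mem_transSource hc
  funext j
  have h1 : HasLineDerivAt ℝ (fun c => baseVec i' (transMap k i b i' b' c) j)
      (baseDir i' (fderiv ℝ (transMap k i b i' b') c u) j) c u := by
    rcases eq_or_ne j i' with rfl | hj
    · rw [baseDir_self]
      simp only [baseVec, update_self]
      exact hasLineDerivAt_const 1 c u
    · rw [baseDir_apply, update_of_ne hj]
      simp only [baseVec, update_of_ne hj]
      exact ((ContinuousLinearMap.proj (R := ℝ) (φ := fun _ : Fin m => ℂ) j).hasFDerivAt.comp c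
        (differentiableAt_transMap hc).hasFDerivAt).hasLineDerivAt u
  have h2 := (((hasLineDerivAt_baseVec i i' c u).inv' h0).mul'
    (hasLineDerivAt_baseVec i j c u)).congr_of_eventuallyEq
    (f₁ := fun c => baseVec i' (transMap k i b i' b' c) j) (by
      filter_upwards [isOpen_transSource.mem_nhds hc] with y hy
      rw [baseVec_transMap hy]; rfl)
  rw [h1.unique h2]
  simp only [Pi.smul_apply, Pi.add_apply, smul_eq_mul]
  field_simp
  ring

/-- The Fubini-Study form is invariant: it does not change if the homogeneous coordinates `z` are
multiplied by a function. -/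
lemma fsForm_transMap (hc : c ∈ transSource k i b i' b') (u v : Fin m → ℂ) :
    fsForm i' (transMap k i b i' b' c) (fderiv ℝ (transMap k i b i' b') c u)
      (fderiv ℝ (transMap k i b i' b') c v) = fsForm i c u v := by
  have h0 := coord_ne_zero_of_mem_transSource hc
  have hN := baseSq_ne_zero i c
  have h1 : (baseSq i' (transMap k i b i' b' c) : ℂ) =
      (baseVec i c i')⁻¹ * conj (baseVec i c i')⁻¹ * baseSq i c := by
    rw [baseSq, ← herm_self, baseVec_transMap hc, herm_smul_left, herm_smul_right, herm_self, baseSq]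
    ring
  have h2 : conj (baseVec i c i') ≠ 0 := by simpa using h0
  simp only [fsForm, connForm_apply, h1, baseDir_fderiv_transMap hc, baseVec_transMap hc,
    herm_smul_left, herm_smul_right, herm_add_left, herm_add_right, map_div₀, map_add, map_mul,
    Complex.conj_ofReal, conj_herm, map_inv₀, Complex.conj_conj, map_neg]
  rw [show herm (baseVec i c) (baseVec i c) = baseSq i c from herm_self _]
  field_simp
  ring

end Transition

section

variable {T : ℝ} {φ : ℝ → ℝ} {S : Bool → ℝ → ℝ} (hk : 0 < k) (hS : Profile k T φ S) (hT : 0 < T)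
  (hφ : ContDiffOn ℝ ∞ φ (Icc 0 T)) {i i' : Fin m} {b b' : Bool} {c : Fin m → ℂ}
include hS

lemma tFun_transMap (hc : c ∈ transSource k i b i' b') :
    tFun k S i' b' (transMap k i b i' b' c) = tFun k S i b c := by
  have h1 : chartInv (k := k) i b c ∈ chartSource i b := (chart m k i b).map_target (mem_univ c)
  have h2 : chartFun i b (chartInv (k := k) i b c) = c := (chart m k i b).right_inv (mem_univ c)
  rw [transMap, tFun_chartFun_eq hS hc h1, h2]

lemma transMap_apply_ne_zero (hc : c ∈ transSource k i b i' b') (h0 : c i ≠ 0) :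
    transMap k i b i' b' c i' ≠ 0 := by
  intro h
  have h1 := tFun_mem_Ioo hS b h0
  rw [← tFun_transMap hS hc, tFun_zero hS b' h] at h1
  cases b'
  · exact lt_irrefl _ h1.1
  · exact lt_irrefl _ h1.2

include hk in
/-- Since `φ(t) θ = ∂t`, the form `θ` is invariant: its real part is, as `dt` is, and the imaginary
part follows by complex linearity. -/
lemma vertForm_transMap (hc : c ∈ transSource k i b i' b') (h0 : c i ≠ 0) (hφ0 : φ (tFun k S i b c) ≠ 0)
    (u : Fin m → ℂ) :
    vertForm k i' b' (transMap k i b i' b' c) (fderiv ℝ (transMap k i b i' b') c u) =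
      vertForm k i b c u := by
  have h0' := transMap_apply_ne_zero hS hc h0
  have hre : ∀ u, (vertForm k i' b' (transMap k i b i' b' c)
      (fderiv ℝ (transMap k i b i' b') c u)).re = (vertForm k i b c u).re := by
    intro u
    have h1 : HasFDerivAt (fun c => tFun k S i' b' (transMap k i b i' b' c))
        ((fderiv ℝ (tFun k S i' b') (transMap k i b i' b' c)).comp
          (fderiv ℝ (transMap k i b i' b') c)) c :=
      ((contDiff_tFun hS i' b').differentiable (by simp) _).hasFDerivAt.comp c
        (differentiableAt_transMap hc).hasFDerivAt
    have h2 : (fun c => tFun k S i' b' (transMap k i b i' b' c)) =ᶠ[𝓝 c] tFun k S i b := by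
      filter_upwards [isOpen_transSource.mem_nhds hc] with y hy using tFun_transMap hS hy
    have h3 := (h1.hasLineDerivAt u).unique
      ((hasLineDerivAt_tFun hk hS b h0 u).congr_of_eventuallyEq h2)
    rw [ContinuousLinearMap.comp_apply, fderiv_eq_of_hasLineDerivAt
      ((contDiff_tFun hS i' b').differentiable (by simp) _)
      (hasLineDerivAt_tFun hk hS b' h0' _), tFun_transMap hS hc] at h3
    have h4 := mul_left_cancel₀ hφ0 h3
    linarith
  refine Complex.ext (hre u) ?_
  have h5 := hre (Complex.I • u)
  rw [fderiv_transMap_I hc, map_smul, map_smul, smul_eq_mul, smul_eq_mul, Complex.I_mul_re,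
    Complex.I_mul_re] at h5
  linarith

include hk in
/-- The metrics in the charts agree on the overlaps. For `ζ ≠ 0` this is the invariance of `t`, `h`
and `θ`, and it extends to `ζ = 0` by continuity. -/
lemma chartMetric_transMap (hc : c ∈ transSource k i b i' b') (u v : Fin m → ℂ) :
    chartMetric k S i' b' (transMap k i b i' b' c) (fderiv ℝ (transMap k i b i' b') c u)
      (fderiv ℝ (transMap k i b i' b') c v) = chartMetric k S i b c u v := by
  have hG := fun i b => contDiffOn_univ.1 (isMetricOn_chartMetric (m := m) hS hk i b).smooth
  have hd : ContinuousOn (fderiv ℝ (transMap k i b i' b')) (transSource k i b i' b') :=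
    contDiffOn_transMap_real.continuousOn_fderiv_of_isOpen isOpen_transSource (by simp)
  have h1 : ContinuousOn (fun c => chartMetric k S i' b' (transMap k i b i' b' c)
      (fderiv ℝ (transMap k i b i' b') c u) (fderiv ℝ (transMap k i b i' b') c v))
      (transSource k i b i' b') :=
    (((hG i' b').continuous.comp_continuousOn contDiffOn_transMap_real.continuousOn).clm_apply
      (hd.clm_apply continuousOn_const)).clm_apply (hd.clm_apply continuousOn_const)
  have h2 : Continuous fun c => chartMetric k S i b c u v :=
    ((hG i b).continuous.clm_apply continuous_const).clm_apply continuous_const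
  have : (𝓝[{c : Fin m → ℂ | c i ≠ 0}] c).NeBot :=
    mem_closure_iff_nhdsWithin_neBot.1 (dense_coord_ne_zero i c)
  have hn := isOpen_transSource.mem_nhds hc
  refine tendsto_nhds_unique
    ((h1.continuousAt hn).mono_left (nhdsWithin_le_nhds (s := {c | c i ≠ 0})))
    ((h2.continuousAt.mono_left nhdsWithin_le_nhds).congr' ?_)
  filter_upwards [self_mem_nhdsWithin, nhdsWithin_le_nhds hn] with y hy0 hy
  have h3 := phi_tFun_ne_zero hk hS b hy0
  rw [chartMetric_eq hk hS b hy0, chartMetric_eq hk hS b' (transMap_apply_ne_zero hS hy hy0),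
    tFun_transMap hS hy, fsForm_transMap hy, vertForm_transMap hk hS hy hy0 h3,
    vertForm_transMap hk hS hy hy0 h3]

end

/-! ### The metric and the function t on the manifold -/

variable (k) in
/-- The index of the preferred chart at a point. -/
def chartIdx (x : TautCompact m k) : Fin m × Bool := (exists_mem_chart x).choose

/-- The function `t` on `M^m_k`, computed in the preferred chart at each point. -/
def tMap (S : Bool → ℝ → ℝ) (x : TautCompact m k) : ℝ :=
  tFun k S (chartIdx k x).1 (chartIdx k x).2 (chartAt (Fin m → ℂ) x x)

/-- The metric on the tangent spaces of `M^m_k`, each of which is identified with `ℂ^m` by the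
preferred chart at the point. -/
def metricForm (S : Bool → ℝ → ℝ) (x : TautCompact m k) : Riem.Bilin (Fin m → ℂ) x :=
  chartMetric k S (chartIdx k x).1 (chartIdx k x).2 (chartAt (Fin m → ℂ) x x)

/-- In terms of the identifications of tangent spaces with `ℂ^m`, the differential of the inverse
of the chart at `p` is the derivative of the change to the preferred chart at the image point. -/
lemma frame_eq_fderiv (p : TautCompact m k) (y : Fin m → ℂ) :
    Riem.frame p y = fderiv ℝ (transMap k (chartIdx k p).1 (chartIdx k p).2
      (chartIdx k ((chartAt (Fin m → ℂ) p).symm y)).1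
      (chartIdx k ((chartAt (Fin m → ℂ) p).symm y)).2) y := by
  have h : MDifferentiableAt 𝓘(ℝ, Fin m → ℂ) 𝓘(ℝ, Fin m → ℂ) (chartAt (Fin m → ℂ) p).symm y :=
    ((contMDiffOn_chart_symm (I := 𝓘(ℝ, Fin m → ℂ)) (x := p) (n := ∞)).contMDiffAt
      ((chartAt (Fin m → ℂ) p).open_target.mem_nhds (mem_univ y))).mdifferentiableAt (by simp)
  rw [Riem.frame]
  simp [mfderiv, h, writtenInExtChartAt]
  rfl

section

variable {T : ℝ} {φ : ℝ → ℝ} {S : Bool → ℝ → ℝ} (hk : 0 < k) (hS : Profile k T φ S) (hT : 0 < T)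
  (hφ : ContDiffOn ℝ ∞ φ (Icc 0 T))
include hS

lemma tMap_chartInv (i : Fin m) (b : Bool) (c : Fin m → ℂ) :
    tMap S (chartInv (k := k) i b c) = tFun k S i b c :=
  tFun_transMap hS (mem_chart_source (Fin m → ℂ) (chartInv (k := k) i b c))

lemma contMDiff_tMap : ContMDiff 𝓘(ℝ, Fin m → ℂ) 𝓘(ℝ, ℝ) ∞ (tMap (k := k) (m := m) S) := by
  intro p
  have h1 := (Riem.contMDiffOn_comp_chartAt_iff p
    (tFun k S (chartIdx k p).1 (chartIdx k p).2)).2 (contDiff_tFun hS _ _).contDiffOn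
  refine (h1.congr fun q hq => ?_).contMDiffAt
    ((chartAt (Fin m → ℂ) p).open_source.mem_nhds (mem_chart_source _ p))
  have h2 := (chartAt (Fin m → ℂ) p).left_inv hq
  conv_lhs => rw [← h2]
  exact tMap_chartInv hS _ _ _

include hT

lemma range_tMap (hm : 0 < m) : range (tMap (k := k) (m := m) S) = Icc 0 T := by
  have i : Fin m := ⟨0, hm⟩
  refine Subset.antisymm ?_ fun t ht => ?_
  · rintro _ ⟨x, rfl⟩
    exact tFun_mem_Icc hS hT _ _ _
  · rcases eq_or_lt_of_le ht.1 with h0 | h0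
    · exact ⟨chartInv i false 0, by rw [tMap_chartInv hS, tFun_zero hS false rfl, ← h0]; rfl⟩
    rcases eq_or_lt_of_le ht.2 with h1 | h1
    · exact ⟨chartInv i true 0, by rw [tMap_chartInv hS, tFun_zero hS true rfl, h1]; rfl⟩
    obtain ⟨s, hs, rfl⟩ := hS.surj t ⟨h0, h1⟩
    refine ⟨chartInv i false (Pi.single i (Real.sqrt s : ℂ)), ?_⟩
    rw [tMap_chartInv hS, tFun]
    congr 1
    have h2 : baseVec i (Pi.single i (Real.sqrt s : ℂ)) = Pi.single i 1 := by
      funext j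
      rcases eq_or_ne j i with rfl | hj <;> simp [baseVec, *]
    have h3 : normSqVec (Pi.single i 1 : Fin m → ℂ) = 1 := by
      rw [normSqVec, Finset.sum_eq_single i]
      · simp
      · intro j _ hj; simp [hj]
      · simp
    rw [fibreSq, baseSq, h2, h3]
    simp [fibreWeight, Real.sq_sqrt hs.le]

omit hT
include hk

/-- By the invariance of the metric under changes of charts, it is given by the same formula in the
whole chart. -/
lemma bilinInChart_metricForm (p : TautCompact m k) :
    Riem.bilinInChart (metricForm (k := k) (m := m) S) p =
      chartMetric k S (chartIdx k p).1 (chartIdx k p).2 := by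
  funext y
  ext u v
  change metricForm S ((chartAt (Fin m → ℂ) p).symm y) (Riem.frame p y u) (Riem.frame p y v) = _
  rw [frame_eq_fderiv]
  exact chartMetric_transMap hk hS (mem_chart_source (Fin m → ℂ) ((chartAt (Fin m → ℂ) p).symm y)) u v

/-- The metric of an associated pair, for a given profile of `t`. -/
def assocMetric : Riem.Metric (Fin m → ℂ) (TautCompact m k) :=
  Riem.mkMetric (metricForm (k := k) (m := m) S)
    (fun q u v => (isMetricOn_chartMetric hS hk _ _).symm _ (mem_univ _) u v)
    (fun q u hu => (isMetricOn_chartMetric hS hk _ _).pos _ (mem_univ _) u hu)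
    (fun p => by
      rw [bilinInChart_metricForm hk hS p]
      exact (isMetricOn_chartMetric hS hk _ _).smooth)

lemma inChart_assocMetric (p : TautCompact m k) :
    Riem.inChart (assocMetric (m := m) hk hS) p =
      chartMetric k S (chartIdx k p).1 (chartIdx k p).2 := bilinInChart_metricForm hk hS p

include hφ

lemma isKahler_assocMetric : Riem.IsKahler (assocMetric (m := m) hk hS) where
  hermitian p u v := chartMetric_I _ _ _ u v
  parallel p W hW u := by
    rw [inChart_assocMetric]
    have h1 : fderiv ℝ (fun y => Complex.I • W y) (chartAt (Fin m → ℂ) p p) =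
        Complex.I • fderiv ℝ W (chartAt (Fin m → ℂ) p p) :=
      fderiv_const_smul (hW.differentiable (by simp) _) Complex.I
    rw [Coord.covDeriv, Coord.covDeriv, h1, christoffel_I hk hS hφ, smul_add]
    rfl

omit hφ

omit hk in
lemma exp_tMap_comp_symm (p : TautCompact m k) :
    (fun q => Real.exp (tMap S q)) ∘ (chartAt (Fin m → ℂ) p).symm =
      kappaFun k S (chartIdx k p).1 (chartIdx k p).2 := by
  funext y
  exact congrArg Real.exp (tMap_chartInv hS _ _ y)

lemma hessian_exp_tMap (p : TautCompact m k) :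
    Riem.hessian (assocMetric (m := m) hk hS) (fun q => Real.exp (tMap S q)) p =
      Coord.hessian (chartMetric k S (chartIdx k p).1 (chartIdx k p).2)
        (kappaFun k S (chartIdx k p).1 (chartIdx k p).2) (chartAt (Fin m → ℂ) p p) := by
  rw [Riem.hessian, inChart_assocMetric, exp_tMap_comp_symm hS]

lemma ricci_assocMetric (p : TautCompact m k) :
    Riem.ricci (assocMetric (m := m) hk hS) p =
      Coord.ricci (chartMetric k S (chartIdx k p).1 (chartIdx k p).2)
        (chartAt (Fin m → ℂ) p p) := by
  rw [Riem.ricci, inChart_assocMetric]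

end

/-- Associated pairs exist: the condition on the traceless part is `ricci_add_hessian`, and the
trace of the same identity gives the scalar curvature. -/
theorem exists_isAssociated (hm : 0 < m) (hk : 0 < k) {T : ℝ} (hT : 0 < T) {x y φ : ℝ → ℝ}
    (hsol : IsSolution m k T x y φ) : ∃ g t, IsAssociated m k T x φ g t := by
  obtain ⟨S, hS⟩ := Profile.exists_of_boundary hT (Nat.cast_pos.2 hk) hsol.smooth_phi hsol.phi_zero
    hsol.phi_T hsol.dot_zero hsol.dot_T hsol.phi_pos
  have hφ := hsol.smooth_phi
  have hmem : ∀ p : TautCompact m k, tMap S p ∈ Icc 0 T := fun p => tFun_mem_Icc hS hT _ _ _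
  have hlap : ∀ p : TautCompact m k, Riem.laplacian (assocMetric hk hS)
      (fun q => Real.exp (tMap S q)) p = 2 * (dot T φ (tMap S p) + m * φ (tMap S p)) := by
    intro p
    rw [Riem.laplacian, hessian_exp_tMap]
    exact laplacian_kappaFun hk hS hT hφ _ _ _
  set a : ℝ → ℝ := fun t => (m - 1) * (dot T x t + 1) with ha
  have has : ContDiffOn ℝ ∞ a (Icc 0 T) :=
    contDiffOn_const.mul ((contDiffOn_dot hT hsol.smooth_x).add contDiffOn_const)
  have heq : ∀ t ∈ Icc 0 T, dot T (dot T φ) t = (a t - (m - 1)) * dot T φ t + m * φ t - m := by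
    intro t ht
    rw [hsol.eq_phi t ht]
    simp only [ha]
    ring
  set ρ : TautCompact m k → ℝ := fun p => (a (tMap S p) * φ (tMap S p) - m * φ (tMap S p) -
    dot T φ (tMap S p) + m) * Real.exp (-tMap S p) with hρ
  have hric : ∀ p : TautCompact m k, (a (tMap S p) * Real.exp (-tMap S p)) •
      Riem.hessian (assocMetric hk hS) (fun q => Real.exp (tMap S q)) p +
        Riem.ricci (assocMetric hk hS) p = ρ p • (assocMetric hk hS).inner p := by
    intro p
    rw [hessian_exp_tMap, ricci_assocMetric]
    exact ricci_add_hessian hk hS hT hφ _ _ has heq _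
  have hn : (Module.finrank ℝ (Fin m → ℂ) : ℝ) = 2 * m := by rw [finrank_real_pi]; push_cast; ring
  have htr : ∀ p : TautCompact m k, Riem.trace (assocMetric hk hS) p
      (ρ p • (assocMetric hk hS).inner p) = ρ p * (2 * m) := fun p => by
    rw [← hn, ← Riem.trace_inner (assocMetric hk hS) p]
    exact Coord.trace_smul (V := Fin m → ℂ) _ _ _
  have hm' : (m : ℝ) ≠ 0 := Nat.cast_ne_zero.2 hm.ne'
  refine ⟨assocMetric hk hS, tMap S, ⟨isKahler_assocMetric hk hS hφ, contMDiff_tMap hS,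
    range_tMap hS hT hm, fun p => ?_, hlap, fun p => ?_, fun p => ?_⟩⟩
  · change Riem.traceless _ p ((a (tMap S p) * Real.exp (-tMap S p)) • _ + _) = 0
    rw [hric, Riem.traceless, htr, hn, mul_div_assoc, div_self (by positivity), mul_one, sub_self]
  · have hs : ContMDiff 𝓘(ℝ, Fin m → ℂ) 𝓘(ℝ, ℝ) ∞ fun q : TautCompact m k => Real.exp (tMap S q) :=
      Real.contDiff_exp.contMDiff.comp (contMDiff_tMap hS)
    rw [Riem.gradSq_eq _ hs, inChart_assocMetric, exp_tMap_comp_symm hS]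
    exact gradSq_kappaFun hk hS hT hφ _ _ _
  · have h1 := congrArg (Riem.trace (assocMetric hk hS) p) (hric p)
    rw [htr] at h1
    have h2 : Riem.trace (assocMetric hk hS) p ((a (tMap S p) * Real.exp (-tMap S p)) •
        Riem.hessian (assocMetric hk hS) (fun q => Real.exp (tMap S q)) p +
        Riem.ricci (assocMetric hk hS) p) = (a (tMap S p) * Real.exp (-tMap S p)) *
        Riem.laplacian (assocMetric hk hS) (fun q => Real.exp (tMap S q)) p +
        Riem.scalar (assocMetric hk hS) p := by
      refine (Coord.trace_add (V := Fin m → ℂ) _ _ _).trans ?_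
      exact congrArg (· + _) (Coord.trace_smul (V := Fin m → ℂ) _ _ _)
    rw [h2, hlap] at h1
    have h3 : Real.exp (tMap S p) * Real.exp (-tMap S p) = 1 := by
      rw [← Real.exp_add, add_neg_cancel, Real.exp_zero]
    rw [heq _ (hmem p)]
    simp only [hρ] at h1
    set s := Riem.scalar (assocMetric hk hS) p
    set A := a (tMap S p)
    set P := φ (tMap S p)
    set Q := dot T φ (tMap S p)
    linear_combination Real.exp (tMap S p) / 2 * h1 +
      (m * (A * P - m * P - Q + m) - A * (Q + m * P)) * h3

end TautCompact

theorem mainTheorem3 (m k : ℕ) (hk : 0 < k) (hkm : k < m) (T : ℝ) (hT : 0 < T) (x y φ : ℝ → ℝ)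
    (hsol : IsSolution m k T x y φ) :
    CompactSpace (TautCompact m k) ∧ T2Space (TautCompact m k) ∧
      ConnectedSpace (TautCompact m k) ∧
    (∃ g t, IsAssociated m k T x φ g t) ∧
    ∀ g t, IsAssociated m k T x φ g t →
      ∃ gbar : Riem.Metric (Fin m → ℂ) (TautCompact m k),
        (∀ p, gbar.inner p = (Real.exp ((x (t p) - y (t p) + t p) / 2) ^ 2)⁻¹ • g.inner p) ∧
        Riem.IsRicciSoliton gbar 1 ∧
        Riem.IsNormalizedGradientSoliton gbar (fun p => (m - 1) * y (t p)) ∧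
        Riem.SolitonSystem gbar (fun p => (m - 1) * y (t p)) := by
  have hm : 1 < m := by omega
  exact ⟨TautCompact.compactSpace, TautCompact.t2Space, TautCompact.connectedSpace hm.le,
    TautCompact.exists_isAssociated (by omega) hk hT hsol,
    fun g t h => TautCompact.soliton_of_isAssociated hm hT hsol g t h⟩

end
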